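/- Let $L,Q,R$ be natural numbers with $R\ge 2$ and $Q<L$, and let $\mathbf Q\in\mathbb C^{L\times Q}$ be a matrix of rank $Q$ none of whose rows is zero. Consider the Rayleigh block-fading SIMO channel with $R$ receive antennas, block length $L$, signal-to-noise ratio $\rho>0$ and input-output relation $$\mathbf y_m=\sqrt{\rho}\,\operatorname{diag}(\mathbf h_m)\,\mathbf x+\mathbf n_m,\qquad \mathbf h_m=\mathbf Q\mathbf s_m,\qquad m=1,\dots,R,$$ where the input $\mathbf x\in\mathbb C^L$, the vectors $\mathbf s_m\sim\mathcal{CN}(\mathbf 0,\mathbf I_Q)$ and the noise vectors $\mathbf n_m\sim\mathcal{CN}(\mathbf 0,\mathbf I_L)$ $(m=1,\dots,R)$ are mutually independent. Neither transmitter nor receiver knows the realizations of the $\mathbf s_m$. Put $\mathbf y=(\mathbf y_1,\dots,\mathbf y_R)$. The (noncoherent) capacity is $$C(\rho)=\frac1L\,\sup I(\mathbf x;\mathbf y),$$ where $I$ is mutual information in bits and the supremum is over all probability distributions of $\mathbf x$ on $\mathbb C^L$ with $\mathbb E[\|\mathbf x\|^2]\le L$. Write $\log$ for the logarithm to base $2$.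 Assume Property (A): there is a set $\mathcal K\subseteq\{1,\dots,L\}$ with $|\mathcal K|=\min\big(\lceil (QR-1)/(R-1)\rceil,\,L\big)$ such that every $Q$ rows of $\mathbf Q$ with (distinct) indices in $\mathcal K$ are linearly independent. Then, as $\rho\to\infty$, $$C(\rho)\ \ge\ \begin{cases}(1-1/L)\log\rho+\mathcal O(1), & \text{if } \frac{QR-1}{R-1}\le L,\\[2pt] R\,(1-Q/L)\log\rho+\mathcal O(1), & \text{otherwise.}\end{cases}$$ Moreover, if $R=2$ and $L\ge 2Q-1$, then the pre-log $\lim_{\rho\to\infty}C(\rho)/\log\rho$ exists and equals $1-1/L$. -/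

import Mathlib

open MeasureTheory ProbabilityTheory Filter Topology Asymptotics
open scoped ENNReal NNReal Matrix

noncomputable section

namespace SIMO

/-- The circularly symmetric complex Gaussian law `CN(0,1)`: independent real and imaginary
parts, each `N(0, 1/2)`. -/
def complexGaussian : Measure ℂ :=
  ((gaussianReal 0 (1 / 2)).prod (gaussianReal 0 (1 / 2))).map
    (fun p : ℝ × ℝ => (⟨p.1, p.2⟩ : ℂ))

/-- The law of an `R`-tuple of independent `CN(0, I_n)` vectors in `ℂ^n`. -/
def complexGaussianVectors (R n : ℕ) : Measure (Fin R → Fin n → ℂ) :=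
  Measure.pi fun _ => Measure.pi fun _ => complexGaussian

/-- The input-output relation of one block at signal-to-noise ratio `ρ`:
`y_m = √ρ diag(h_m) x + n_m` with `h_m = A s_m`, for the receive antennas `m`. -/
def output {L Q R : ℕ} (A : Matrix (Fin L) (Fin Q) ℂ) (ρ : ℝ)
    (x : Fin L → ℂ) (s : Fin R → Fin Q → ℂ) (n : Fin R → Fin L → ℂ) : Fin R → Fin L → ℂ :=
  fun m => ((Real.sqrt ρ : ℝ) : ℂ) • (Matrix.diagonal (A *ᵥ s m) *ᵥ x) + n m

/-- The joint law of `(x, y)` when the input `x` has law `μ` and `x`, the fading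
`s_1, …, s_R` and the noise `n_1, …, n_R` are independent. -/
def jointLaw {L Q : ℕ} (A : Matrix (Fin L) (Fin Q) ℂ) (R : ℕ) (ρ : ℝ)
    (μ : Measure (Fin L → ℂ)) : Measure ((Fin L → ℂ) × (Fin R → Fin L → ℂ)) :=
  (μ.prod ((complexGaussianVectors R Q).prod (complexGaussianVectors R L))).map
    (fun p => (p.1, output A ρ p.1 p.2.1 p.2.2))

/-- The mutual information, in bits, of a pair with joint law `γ`: the relative entropy of `γ`
with respect to the product of its marginals. -/
def mutualInformation {α β : Type*} [MeasurableSpace α] [MeasurableSpace β]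
    (γ : Measure (α × β)) : ℝ≥0∞ :=
  InformationTheory.klDiv γ (γ.fst.prod γ.snd) / ENNReal.ofReal (Real.log 2)

/-- The input distributions on `ℂ^L` with average power `E[‖x‖²] ≤ L`. -/
def admissibleInputs (L : ℕ) : Set (Measure (Fin L → ℂ)) :=
  {μ | IsProbabilityMeasure μ ∧ ∫⁻ x, ∑ i, ‖x i‖ₑ ^ 2 ∂μ ≤ (L : ℝ≥0∞)}

/-- The noncoherent capacity `C(ρ) = (1/L) sup I(x; y)`, in bits per channel use, of the channel
with `R` receive antennas and `h_m ~ CN(0, A Aᴴ)`. -/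
def capacity {L Q : ℕ} (A : Matrix (Fin L) (Fin Q) ℂ) (R : ℕ) (ρ : ℝ) : ℝ≥0∞ :=
  (⨆ μ ∈ admissibleInputs L, mutualInformation (jointLaw A R ρ μ)) / (L : ℝ≥0∞)

/-- Property (A): there is a set of `min(⌈(QR-1)/(R-1)⌉, L)` row indices such that every `Q`
rows with index in this set are linearly independent. -/
def PropertyA {L Q : ℕ} (A : Matrix (Fin L) (Fin Q) ℂ) (R : ℕ) : Prop :=
  ∃ K : Finset (Fin L),
    K.card = min ⌈((Q : ℝ) * R - 1) / ((R : ℝ) - 1)⌉₊ L ∧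
    ∀ S ⊆ K, S.card = Q → LinearIndependent ℂ (fun i : S => A.row i)

end SIMO

end

noncomputable section

namespace SIMO

/- Mutual information is bounded below by the Donsker–Varadhan inequality and above by its dual, in
which the output law may be replaced by any reference measure.

Lower bound: all but `|P|` entries of the input are pilots. By Property (A), `P` can be chosen so
large that for a generic state the noiseless outputs determine the free inputs and the state. The
`|P| + QR` unknowns are then the injective image, under an everywhere nonsingular polynomial map, of
equally many outputs; each of these outputs is known up to noise of relative size `ρ⁻¹`, so the
change of variables yields a test function with exponent `|P| log ρ` up to the logarithm of a
Jacobian determinant. As a nonzero polynomial, this determinant has an integrable logarithm.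

Upper bound: the channel sees only the products of the state and the input, so the scale of the
input is lost. In the reference output law one distinguished input entry has a heavy tail and the
other `L - 1` entries are Gaussian of variance `ρ`. Averaging over complex rescalings of the pair
(state, input) by an annulus shows that only these `L - 1` entries cost a factor `ρ` each, up to
an arbitrarily small power of `ρ` from the heavy tail. -/

section KullbackLeibler

open InformationTheory

variable {Ω Z : Type*} [MeasurableSpace Ω] [MeasurableSpace Z] {P : Measure Ω}
  {γ ν : Measure Z} [IsProbabilityMeasure γ] [IsProbabilityMeasure ν]
  {π : Ω → Z} {g : Ω → ℝ}

lemma integrable_and_integral_le_of_lintegral_ofReal_le {h : Ω → ℝ} (hm : AEStronglyMeasurable h P)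
    (h0 : 0 ≤ h) {C : ℝ≥0} (hC : ∫⁻ ω, ENNReal.ofReal (h ω) ∂P ≤ C) :
    Integrable h P ∧ ∫ ω, h ω ∂P ≤ C := by
  have hfin : ∫⁻ ω, ENNReal.ofReal (h ω) ∂P < ∞ := hC.trans_lt ENNReal.coe_lt_top
  refine ⟨⟨hm, (hasFiniteIntegral_iff_ofReal (ae_of_all _ h0)).2 hfin⟩, ?_⟩
  rw [integral_eq_lintegral_of_nonneg_ae (ae_of_all _ h0) hm]
  exact ENNReal.toReal_le_coe_of_le_coe hC

lemma integrable_exp_neg_llr (hac : γ ≪ ν) : Integrable (fun z ↦ Real.exp (-llr γ ν z)) γ :=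
  Measure.integrable_toReal_rnDeriv.congr (exp_neg_llr hac).symm

lemma integral_add_one_sub_integral_exp_sub_le [IsProbabilityMeasure P] {h : Ω → ℝ}
    (hg : Integrable g P) (hh : Integrable h P)
    (hexp : Integrable (fun ω ↦ Real.exp (g ω - h ω)) P) :
    ∫ ω, g ω ∂P + 1 - ∫ ω, Real.exp (g ω - h ω) ∂P ≤ ∫ ω, h ω ∂P := by
  have hg1 : Integrable (fun ω ↦ g ω + 1) P := hg.add (integrable_const 1)
  calc ∫ ω, g ω ∂P + 1 - ∫ ω, Real.exp (g ω - h ω) ∂P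
      = ∫ ω, g ω + 1 - Real.exp (g ω - h ω) ∂P := by
        rw [integral_sub hg1 hexp, integral_add hg (integrable_const 1), integral_const,
          probReal_univ, one_smul]
    _ ≤ ∫ ω, h ω ∂P := integral_mono (hg1.sub hexp) hh fun ω ↦ by
        linarith [Real.add_one_le_exp (g ω - h ω)]

lemma lintegral_mul_exp_neg_llr_le (hac : γ ≪ ν) {G : Z → ℝ≥0∞} (hG : Measurable G) :
    ∫⁻ z, G z * ENNReal.ofReal (Real.exp (-llr γ ν z)) ∂γ ≤ ∫⁻ z, G z ∂ν :=
  calc ∫⁻ z, G z * ENNReal.ofReal (Real.exp (-llr γ ν z)) ∂γ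
      = ∫⁻ z, ν.rnDeriv γ z * G z ∂γ := by
        refine lintegral_congr_ae ?_
        filter_upwards [exp_neg_llr hac, ν.rnDeriv_lt_top γ] with z hz hfin
        rw [hz, ENNReal.ofReal_toReal hfin.ne, mul_comm]
    _ = ∫⁻ z, G z ∂(γ.withDensity (ν.rnDeriv γ)) :=
        (lintegral_withDensity_eq_lintegral_mul _ (Measure.measurable_rnDeriv ν γ) hG).symm
    _ ≤ ∫⁻ z, G z ∂ν := lintegral_mono' (Measure.withDensity_rnDeriv_le ν γ) le_rfl

/-- Donsker–Varadhan lower bound. The test function `g` may depend on randomness `u` beyond the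
observed pair: this spares an application of Jensen's inequality. -/
theorem ofReal_integral_le_klDiv {U : Type*} [MeasurableSpace U] [IsProbabilityMeasure P]
    {η : Measure U} [IsProbabilityMeasure η] {g : Ω × U → ℝ} (hπ : MeasurePreserving π P γ)
    (hg : Integrable g (P.prod η)) {G : Z → ℝ≥0∞} (hG : Measurable G)
    (hgG : ∀ᵐ ω ∂P, ∫⁻ u, ENNReal.ofReal (Real.exp (g (ω, u))) ∂η ≤ G (π ω))
    {C : ℝ≥0} (hC : ∫⁻ z, G z ∂ν ≤ C) :
    ENNReal.ofReal (∫ p, g p ∂(P.prod η) + 1 - C) ≤ klDiv γ ν := by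
  by_cases hac : γ ≪ ν
  swap; · simp [klDiv_of_not_ac hac]
  by_cases hllr : Integrable (llr γ ν) γ
  swap; · simp [klDiv_of_not_integrable hllr]
  have hπ' : MeasurePreserving (fun p : Ω × U ↦ π p.1) (P.prod η) γ :=
    hπ.comp measurePreserving_fst
  let r (p : Ω × U) : ℝ := Real.exp (g p - llr γ ν (π p.1))
  have hrC : ∫⁻ p, ENNReal.ofReal (r p) ∂(P.prod η) ≤ C := by
    have hbound : ∀ᵐ ω ∂P, ∫⁻ u, ENNReal.ofReal (r (ω, u)) ∂η
        ≤ G (π ω) * ENNReal.ofReal (Real.exp (-llr γ ν (π ω))) := by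
      filter_upwards [hgG] with ω hω
      simp only [r, sub_eq_add_neg, Real.exp_add, ENNReal.ofReal_mul (Real.exp_pos _).le]
      rw [lintegral_mul_const' _ _ ENNReal.ofReal_ne_top]
      gcongr
    calc ∫⁻ p, ENNReal.ofReal (r p) ∂(P.prod η)
        ≤ ∫⁻ ω, G (π ω) * ENNReal.ofReal (Real.exp (-llr γ ν (π ω))) ∂P :=
          (lintegral_prod_le _).trans (lintegral_mono_ae hbound)
      _ = ∫⁻ z, G z * ENNReal.ofReal (Real.exp (-llr γ ν z)) ∂γ :=
          hπ.lintegral_comp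
            (hG.mul (ENNReal.measurable_ofReal.comp (measurable_llr γ ν).neg.exp))
      _ ≤ ∫⁻ z, G z ∂ν := lintegral_mul_exp_neg_llr_le hac hG
      _ ≤ C := hC
  have hllr' : Integrable (fun p : Ω × U ↦ llr γ ν (π p.1)) (P.prod η) :=
    hπ'.integrable_comp_of_integrable hllr
  obtain ⟨hr, hrC⟩ := integrable_and_integral_le_of_lintegral_ofReal_le (h := r)
    (Real.continuous_exp.comp_aestronglyMeasurable (hg.1.sub hllr'.1))
    (fun p ↦ (Real.exp_pos _).le) hrC
  have hllr_eq : ∫ p, llr γ ν (π p.1) ∂(P.prod η) = ∫ z, llr γ ν z ∂γ := by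
    rw [← hπ'.map_eq, integral_map hπ'.aemeasurable (measurable_llr _ _).aestronglyMeasurable,
      hπ'.map_eq]
  rw [klDiv_of_ac_of_integrable hac hllr]
  refine ENNReal.ofReal_le_ofReal ?_
  simp only [probReal_univ, add_sub_cancel_right]
  linarith [integral_add_one_sub_integral_exp_sub_le hg hllr' hr]

lemma klDiv_le_ofReal_integral (hπ : MeasurePreserving π P γ) (hac : γ ≪ ν) (hg : Integrable g P)
    (hle : ∀ᵐ ω ∂P, llr γ ν (π ω) ≤ g ω) : klDiv γ ν ≤ ENNReal.ofReal (∫ ω, g ω ∂P) := by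
  have hllr : Integrable (fun ω ↦ llr γ ν (π ω)) P := by
    refine Integrable.mono' (hg.abs.add (hπ.integrable_comp_of_integrable
      (integrable_exp_neg_llr hac)))
      ((measurable_llr γ ν).comp hπ.measurable).aestronglyMeasurable ?_
    filter_upwards [hle] with ω hω
    have h := Real.add_one_le_exp (-llr γ ν (π ω))
    have h' := Real.exp_pos (-llr γ ν (π ω))
    rw [Real.norm_eq_abs, abs_le]
    constructor <;> simp only [Pi.add_apply, Function.comp_apply] <;>
      linarith [le_abs_self (g ω), abs_nonneg (g ω)]
  have hllr' : Integrable (llr γ ν) γ :=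
    (hπ.integrable_comp (measurable_llr _ _).aestronglyMeasurable).1 hllr
  rw [klDiv_of_ac_of_integrable hac hllr', ← hπ.map_eq,
    integral_map hπ.aemeasurable (measurable_llr _ _).aestronglyMeasurable, hπ.map_eq]
  refine ENNReal.ofReal_le_ofReal ?_
  simpa only [probReal_univ, add_sub_cancel_right] using integral_mono_ae hllr hg hle

theorem klDiv_le_ofReal_integral_add [IsProbabilityMeasure P] (hπ : MeasurePreserving π P γ)
    (hac : γ ≪ ν) (hg : Integrable g P) {ξ : Measure Z}
    (hξ : (P.withDensity fun ω ↦ ENNReal.ofReal (Real.exp (-g ω))).map π ≤ ξ) {C : ℝ≥0}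
    (hC : ∫⁻ z, γ.rnDeriv ν z ∂ξ ≤ C) : klDiv γ ν ≤ ENNReal.ofReal (∫ ω, g ω ∂P + C - 1) := by
  let r : Ω → ℝ := fun ω ↦ Real.exp (-g ω) * Real.exp (llr γ ν (π ω))
  have hrm : AEStronglyMeasurable r P :=
    (Real.continuous_exp.comp_aestronglyMeasurable hg.1.neg).mul
      ((measurable_llr γ ν).comp hπ.measurable).exp.aestronglyMeasurable
  have hrC : ∫⁻ ω, ENNReal.ofReal (r ω) ∂P ≤ C := by
    have hdens : AEMeasurable (fun ω ↦ ENNReal.ofReal (Real.exp (-g ω))) P :=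
      (Real.continuous_exp.comp_aestronglyMeasurable hg.1.neg).aemeasurable.ennreal_ofReal
    have hrn := Measure.measurable_rnDeriv γ ν
    calc ∫⁻ ω, ENNReal.ofReal (r ω) ∂P
        = ∫⁻ ω, ENNReal.ofReal (Real.exp (-g ω)) * γ.rnDeriv ν (π ω) ∂P := by
          refine lintegral_congr_ae ?_
          filter_upwards [hπ.quasiMeasurePreserving.ae (exp_llr_of_ac γ ν hac),
            hπ.quasiMeasurePreserving.ae (hac.ae_le (γ.rnDeriv_lt_top ν))] with ω hω hfin
          simp only [r]
          rw [ENNReal.ofReal_mul (Real.exp_pos _).le, hω, ENNReal.ofReal_toReal hfin.ne]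
      _ = ∫⁻ z, γ.rnDeriv ν z
            ∂((P.withDensity fun ω ↦ ENNReal.ofReal (Real.exp (-g ω))).map π) := by
          rw [lintegral_map hrn hπ.measurable]
          exact (lintegral_withDensity_eq_lintegral_mul₀ hdens
            (hrn.comp hπ.measurable).aemeasurable).symm
      _ ≤ ∫⁻ z, γ.rnDeriv ν z ∂ξ := lintegral_mono' hξ le_rfl
      _ ≤ C := hC
  obtain ⟨hr, hrC⟩ := integrable_and_integral_le_of_lintegral_ofReal_le hrm
    (fun ω ↦ by positivity) hrC
  have hle (ω : Ω) : llr γ ν (π ω) ≤ g ω + r ω - 1 := by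
    have h := Real.add_one_le_exp (-g ω + llr γ ν (π ω))
    rw [Real.exp_add] at h
    simp only [r]; linarith
  refine (klDiv_le_ofReal_integral hπ hac ((hg.add hr).sub (integrable_const 1))
    (ae_of_all _ hle)).trans (ENNReal.ofReal_le_ofReal ?_)
  rw [integral_sub' (hg.add hr) (integrable_const 1), integral_add' hg hr]
  simpa using hrC

section MutualInformation

variable {X Y : Type*} [MeasurableSpace X] [MeasurableSpace Y] {γ : Measure (X × Y)}
  [IsProbabilityMeasure γ]

lemma lintegral_rnDeriv_fst_prod_snd (hac : γ ≪ γ.fst.prod γ.snd) :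
    ∀ᵐ y ∂γ.snd, ∫⁻ x, γ.rnDeriv (γ.fst.prod γ.snd) (x, y) ∂γ.fst = 1 := by
  have hm := Measure.measurable_rnDeriv γ (γ.fst.prod γ.snd)
  refine ae_eq_of_forall_setLIntegral_eq_of_sigmaFinite₀ hm.lintegral_prod_left'.aemeasurable
    aemeasurable_const fun s hs _ ↦ ?_
  calc ∫⁻ y in s, ∫⁻ x, γ.rnDeriv (γ.fst.prod γ.snd) (x, y) ∂γ.fst ∂γ.snd
      = ∫⁻ z in Set.univ ×ˢ s, γ.rnDeriv (γ.fst.prod γ.snd) z ∂(γ.fst.prod γ.snd) := by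
        rw [← Measure.prod_restrict, Measure.restrict_univ, lintegral_prod_symm _ hm.aemeasurable]
    _ = γ (Set.univ ×ˢ s) := Measure.setLIntegral_rnDeriv hac _
    _ = ∫⁻ _ in s, 1 ∂γ.snd := by
        rw [setLIntegral_one, Measure.snd_apply hs, Set.univ_prod]

/-- The upper bound dual to the Donsker–Varadhan inequality, for mutual information: the reference
measure `γ.fst.prod ξ` replaces the second marginal by an arbitrary output measure. -/
theorem klDiv_fst_prod_snd_le [IsProbabilityMeasure P] {π : Ω → X × Y}
    (hπ : MeasurePreserving π P γ) (hac : γ ≪ γ.fst.prod γ.snd) (hg : Integrable g P)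
    {ξ : Measure Y} [SFinite ξ] (hξs : ξ ≪ γ.snd)
    (hξ : (P.withDensity fun ω ↦ ENNReal.ofReal (Real.exp (-g ω))).map π ≤ γ.fst.prod ξ) {C : ℝ≥0}
    (hC : ξ Set.univ ≤ C) :
    klDiv γ (γ.fst.prod γ.snd) ≤ ENNReal.ofReal (∫ ω, g ω ∂P + C - 1) := by
  refine klDiv_le_ofReal_integral_add hπ hac hg hξ (le_of_eq_of_le ?_ hC)
  rw [lintegral_prod_symm _ (Measure.measurable_rnDeriv _ _).aemeasurable,
    lintegral_congr_ae (hξs.ae_le (lintegral_rnDeriv_fst_prod_snd hac)), lintegral_one]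

theorem ofReal_integral_le_klDiv_fst_prod_snd {U : Type*} [MeasurableSpace U]
    [IsProbabilityMeasure P] {η : Measure U} [IsProbabilityMeasure η] {π : Ω → X × Y}
    {g : Ω × U → ℝ} (hπ : MeasurePreserving π P γ) (hg : Integrable g (P.prod η))
    {G : X × Y → ℝ≥0∞} (hG : Measurable G)
    (hgG : ∀ᵐ ω ∂P, ∫⁻ u, ENNReal.ofReal (Real.exp (g (ω, u))) ∂η ≤ G (π ω))
    {C : ℝ≥0} (hC : ∀ y, ∫⁻ x, G (x, y) ∂γ.fst ≤ C) :
    ENNReal.ofReal (∫ p, g p ∂(P.prod η) + 1 - C) ≤ klDiv γ (γ.fst.prod γ.snd) := by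
  refine ofReal_integral_le_klDiv hπ hg hG hgG ?_
  calc ∫⁻ z, G z ∂(γ.fst.prod γ.snd)
      = ∫⁻ y, ∫⁻ x, G (x, y) ∂γ.fst ∂γ.snd := lintegral_prod_symm _ hG.aemeasurable
    _ ≤ ∫⁻ _, C ∂γ.snd := lintegral_mono hC
    _ = C := by simp

end MutualInformation

end KullbackLeibler

section PiDensity

variable {ι : Type*} {α : ι → Type*} [∀ i, MeasurableSpace (α i)]
  (μ : ∀ i, Measure (α i)) [∀ i, SigmaFinite (μ i)] {f : ∀ i, α i → ℝ≥0∞}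

lemma lmarginal_prod [DecidableEq ι] (hf : ∀ i, Measurable (f i)) (s : Finset ι) :
    (∫⋯∫⁻_s, (fun x ↦ ∏ i ∈ s, f i (x i)) ∂μ) = fun _ ↦ ∏ i ∈ s, ∫⁻ t, f i t ∂(μ i) := by
  induction s using Finset.induction_on with
  | empty => simp
  | insert a s ha ih =>
    have hmarginal : (fun x ↦ ∫⁻ t, ∏ i ∈ insert a s, f i (Function.update x a t i) ∂μ a)
        = fun x ↦ (∫⁻ t, f a t ∂μ a) * ∏ i ∈ s, f i (x i) := by
      ext x
      rw [← lintegral_mul_const _ (hf a)]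
      refine lintegral_congr fun t ↦ ?_
      rw [Finset.prod_insert ha, Function.update_self]
      congr 1
      exact Finset.prod_congr rfl fun i hi ↦ by
        rw [Function.update_of_ne (ne_of_mem_of_not_mem hi ha)]
    rw [lmarginal_insert' _ (by fun_prop) ha, hmarginal]
    ext x
    rw [Finset.prod_insert ha, ← congrFun ih x]
    exact lintegral_const_mul _ ((Finset.measurable_fun_prod s fun i _ ↦
      (hf i).comp (measurable_pi_apply i)).comp measurable_updateFinset)

theorem lintegral_pi_prod [Fintype ι] (hf : ∀ i, Measurable (f i)) :
    ∫⁻ x, ∏ i, f i (x i) ∂(Measure.pi μ) = ∏ i, ∫⁻ t, f i t ∂(μ i) := by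
  classical
  rcases isEmpty_or_nonempty (∀ i, α i) with h | ⟨⟨x⟩⟩
  · obtain ⟨i, hi⟩ := isEmpty_pi.1 h
    rw [lintegral_of_isEmpty, Finset.prod_eq_zero (Finset.mem_univ i) (by simp)]
  · rw [lintegral_eq_lmarginal_univ x, lmarginal_prod μ hf]

theorem pi_withDensity [Fintype ι] (hf : ∀ i, Measurable (f i))
    [∀ i, SigmaFinite ((μ i).withDensity (f i))] :
    Measure.pi (fun i ↦ (μ i).withDensity (f i))
      = (Measure.pi μ).withDensity (fun x ↦ ∏ i, f i (x i)) := by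
  refine Measure.pi_eq fun s hs ↦ ?_
  rw [withDensity_apply _ (MeasurableSet.univ_pi hs), Measure.restrict_pi_pi,
    lintegral_pi_prod _ hf]
  exact Finset.prod_congr rfl fun i _ ↦ (withDensity_apply _ (hs i)).symm

end PiDensity

section ComplexGaussian

lemma measurable_complex_mk : Measurable fun p : ℝ × ℝ ↦ (⟨p.1, p.2⟩ : ℂ) :=
  Complex.measurableEquivRealProd.symm.measurable

lemma gaussianReal_prod_eq_withDensity :
    (gaussianReal 0 (1 / 2)).prod (gaussianReal 0 (1 / 2))
      = (volume : Measure (ℝ × ℝ)).withDensity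
        (fun p ↦ ENNReal.ofReal (Real.pi⁻¹ * Real.exp (-(p.1 ^ 2 + p.2 ^ 2)))) := by
  rw [gaussianReal_of_var_ne_zero _ (by norm_num),
    prod_withDensity (measurable_gaussianPDF _ _) (measurable_gaussianPDF _ _),
    Measure.volume_eq_prod]
  congr 1
  ext p
  have hvar : 2 * Real.pi * ((1 / 2 : ℝ≥0) : ℝ) = Real.pi := by push_cast; ring
  rw [gaussianPDF, gaussianPDF, ← ENNReal.ofReal_mul (gaussianPDFReal_nonneg _ _ _),
    gaussianPDFReal, gaussianPDFReal, hvar, mul_mul_mul_comm, ← Real.exp_add, ← mul_inv,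
    Real.mul_self_sqrt Real.pi_pos.le]
  congr 3
  push_cast
  ring

theorem complexGaussian_eq_withDensity :
    complexGaussian = (volume : Measure ℂ).withDensity
      (fun z ↦ ENNReal.ofReal (Real.pi⁻¹ * Real.exp (-‖z‖ ^ 2))) := by
  have he : (fun p : ℝ × ℝ ↦ (⟨p.1, p.2⟩ : ℂ)) = Complex.measurableEquivRealProd.symm := rfl
  rw [complexGaussian, gaussianReal_prod_eq_withDensity, he]
  ext s hs
  rw [MeasurableEquiv.map_apply, withDensity_apply _ hs, withDensity_apply _
    (Complex.measurableEquivRealProd.symm.measurable hs),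
    ← (Complex.volume_preserving_equiv_real_prod.symm).setLIntegral_comp_preimage hs
      (by fun_prop)]
  refine lintegral_congr fun p ↦ ?_
  rw [Complex.sq_norm, Complex.normSq_apply, sq, sq]
  rfl

instance : IsProbabilityMeasure complexGaussian :=
  Measure.isProbabilityMeasure_map measurable_complex_mk.aemeasurable

instance (R n : ℕ) : IsProbabilityMeasure (complexGaussianVectors R n) := by
  unfold complexGaussianVectors; infer_instance

lemma integrable_sq_norm_complexGaussian :
    Integrable (fun z : ℂ ↦ ‖z‖ ^ 2) complexGaussian := by
  rw [complexGaussian, integrable_map_measure (by fun_prop) measurable_complex_mk.aemeasurable]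
  have hsq : Integrable (fun x : ℝ ↦ x ^ 2) (gaussianReal 0 (1 / 2)) :=
    (memLp_id_gaussianReal 2).integrable_sq
  refine ((hsq.comp_fst (gaussianReal 0 (1 / 2))).add
    (hsq.comp_snd (gaussianReal 0 (1 / 2)))).congr (ae_of_all _ fun p ↦ ?_)
  simp only [Function.comp, Pi.add_apply, Complex.sq_norm, Complex.normSq_mk]
  ring

variable {R n : ℕ}

/-- The squared Euclidean norm of an `R`-tuple of vectors in `ℂ^n`: `Fin R → Fin n → ℂ` itself
carries the supremum norm. -/
def sqNorm (y : Fin R → Fin n → ℂ) : ℝ := ∑ m, ∑ i, ‖y m i‖ ^ 2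

lemma sqNorm_nonneg (y : Fin R → Fin n → ℂ) : 0 ≤ sqNorm y := by
  unfold sqNorm; positivity

lemma sq_norm_apply_le_sqNorm (y : Fin R → Fin n → ℂ) (m : Fin R) (i : Fin n) :
    ‖y m i‖ ^ 2 ≤ sqNorm y :=
  (Finset.single_le_sum (f := fun i ↦ ‖y m i‖ ^ 2) (fun i _ ↦ by positivity)
    (Finset.mem_univ i)).trans
    (Finset.single_le_sum (f := fun m ↦ ∑ i, ‖y m i‖ ^ 2) (fun m _ ↦ by positivity)
      (Finset.mem_univ m))

@[fun_prop]
lemma continuous_sqNorm : Continuous (sqNorm (R := R) (n := n)) := by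
  unfold sqNorm; fun_prop

@[fun_prop]
lemma measurable_sqNorm : Measurable (sqNorm (R := R) (n := n)) :=
  continuous_sqNorm.measurable

lemma integrable_sqNorm (R n : ℕ) :
    Integrable (sqNorm (R := R) (n := n)) (complexGaussianVectors R n) := by
  unfold sqNorm complexGaussianVectors
  refine integrable_finsetSum _ fun m _ ↦ integrable_finsetSum _ fun i _ ↦ ?_
  have hrow : Integrable (fun v : Fin n → ℂ ↦ ‖v i‖ ^ 2)
      (Measure.pi fun _ : Fin n ↦ complexGaussian) :=
    integrable_comp_eval (μ := fun _ : Fin n ↦ complexGaussian) integrable_sq_norm_complexGaussian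
  exact integrable_comp_eval
    (μ := fun _ : Fin R ↦ Measure.pi fun _ : Fin n ↦ complexGaussian) (i := m) hrow

/-- The density of `complexGaussianVectors R n` with respect to Lebesgue measure. -/
def gaussianDensity (R n : ℕ) (y : Fin R → Fin n → ℂ) : ℝ≥0∞ :=
  ENNReal.ofReal ((Real.pi⁻¹) ^ (R * n) * Real.exp (-sqNorm y))

@[fun_prop]
lemma measurable_gaussianDensity (R n : ℕ) : Measurable (gaussianDensity R n) := by
  unfold gaussianDensity; fun_prop

lemma gaussianDensity_pos (y : Fin R → Fin n → ℂ) : 0 < gaussianDensity R n y := by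
  exact ENNReal.ofReal_pos.2 (by positivity)

lemma gaussianDensity_le_exp (y : Fin R → Fin n → ℂ) :
    gaussianDensity R n y ≤ ENNReal.ofReal (Real.exp (-sqNorm y)) := by
  refine ENNReal.ofReal_le_ofReal (mul_le_of_le_one_left (Real.exp_pos _).le
    (pow_le_one₀ (inv_nonneg.2 Real.pi_pos.le) (inv_le_one_of_one_le₀ ?_)))
  linarith [Real.pi_gt_three]

theorem complexGaussianVectors_eq_withDensity (R n : ℕ) :
    complexGaussianVectors R n = volume.withDensity (gaussianDensity R n) := by
  let g : ℂ → ℝ≥0∞ := fun z ↦ ENNReal.ofReal (Real.pi⁻¹ * Real.exp (-‖z‖ ^ 2))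
  have hg : Measurable g := by fun_prop
  have : IsProbabilityMeasure ((volume : Measure ℂ).withDensity g) := by
    rw [← complexGaussian_eq_withDensity]; infer_instance
  have hvec : (Measure.pi fun _ : Fin n ↦ complexGaussian)
      = (volume : Measure (Fin n → ℂ)).withDensity (fun x ↦ ∏ i, g (x i)) := by
    rw [complexGaussian_eq_withDensity, pi_withDensity _ fun _ ↦ hg, ← volume_pi]
  have : IsProbabilityMeasure
      ((volume : Measure (Fin n → ℂ)).withDensity (fun x ↦ ∏ i, g (x i))) := by
    rw [← hvec]; infer_instance
  rw [complexGaussianVectors, hvec, pi_withDensity _ fun _ ↦ by fun_prop, ← volume_pi]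
  congr 1
  ext y
  have hrow (m : Fin R) :
      ∏ i, g (y m i) = ENNReal.ofReal (∏ i, (Real.pi⁻¹ * Real.exp (-‖y m i‖ ^ 2))) :=
    (ENNReal.ofReal_prod_of_nonneg fun i _ ↦ by positivity).symm
  rw [gaussianDensity, Finset.prod_congr rfl fun m _ ↦ hrow m,
    ← ENNReal.ofReal_prod_of_nonneg fun i _ ↦ by positivity]
  congr 1
  simp_rw [Finset.prod_mul_distrib, Finset.prod_const, ← Real.exp_sum]
  simp [sqNorm, ← pow_mul, mul_comm]

lemma lintegral_add_complexGaussianVectors (v : Fin R → Fin n → ℂ)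
    {g : (Fin R → Fin n → ℂ) → ℝ≥0∞} (hg : Measurable g) :
    ∫⁻ z, g (v + z) ∂(complexGaussianVectors R n) = ∫⁻ y, gaussianDensity R n (y - v) * g y := by
  rw [complexGaussianVectors_eq_withDensity,
    lintegral_withDensity_eq_lintegral_mul _ (measurable_gaussianDensity R n) (by fun_prop),
    ← lintegral_add_left_eq_self (μ := volume) (fun y ↦ gaussianDensity R n (y - v) * g y) v]
  simp

end ComplexGaussian

section AdditiveNoise

variable {X S Y : Type*} [MeasurableSpace X] [MeasurableSpace S] [MeasurableSpace Y]
  [AddCommGroup Y] {φ : X → S → Y}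

/-- The input `x` and the output `φ x s + n` of a channel with state `s` and additive noise `n`. -/
def inputOutput (φ : X → S → Y) (p : X × S × Y) : X × Y := (p.1, φ p.1 p.2.1 + p.2.2)

variable [MeasurableAdd₂ Y] (hφ : Measurable (Function.uncurry φ)) {μ : Measure X} {κ : Measure S}
  [IsProbabilityMeasure κ]

include hφ

lemma measurable_inputOutput : Measurable (inputOutput φ) :=
  measurable_fst.prodMk
    ((hφ.comp (measurable_fst.prodMk (measurable_fst.comp measurable_snd))).add
      (measurable_snd.comp measurable_snd))

lemma fst_map_inputOutput [SFinite μ] {N : Measure Y} [IsProbabilityMeasure N] :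
    ((μ.prod (κ.prod N)).map (inputOutput φ)).fst = μ := by
  rw [Measure.fst, Measure.map_map measurable_fst (measurable_inputOutput hφ)]
  exact Measure.fst_prod

section Invariant

variable [SFinite μ] {N τ : Measure Y} [SFinite τ] [τ.IsAddLeftInvariant]

lemma measurePreserving_inputOutput :
    MeasurePreserving (inputOutput φ) (μ.prod (κ.prod τ)) (μ.prod τ) := by
  have hstate (x : X) : MeasurePreserving (fun q : S × Y ↦ φ x q.1 + q.2) (κ.prod τ) τ :=
    measurePreserving_snd.comp ((MeasurePreserving.id κ).skew_product (g := fun s n ↦ φ x s + n)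
      (((hφ.comp measurable_prodMk_left).comp measurable_fst).add measurable_snd)
      (ae_of_all _ fun s ↦ map_add_left_eq_self τ (φ x s)))
  exact (MeasurePreserving.id μ).skew_product (g := fun x (q : S × Y) ↦ φ x q.1 + q.2)
    (measurable_snd.comp (measurable_inputOutput hφ)) (ae_of_all _ fun x ↦ (hstate x).map_eq)

lemma map_inputOutput_absolutelyContinuous (hN : N ≪ τ) :
    (μ.prod (κ.prod N)).map (inputOutput φ) ≪ μ.prod τ := by
  rw [← (measurePreserving_inputOutput hφ (κ := κ)).map_eq]
  exact (Measure.AbsolutelyContinuous.rfl.prod (Measure.AbsolutelyContinuous.rfl.prod hN)).map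
    (measurable_inputOutput hφ)

lemma absolutelyContinuous_snd_map_inputOutput [IsProbabilityMeasure μ] [SFinite N] (hN : τ ≪ N) :
    τ ≪ ((μ.prod (κ.prod N)).map (inputOutput φ)).snd := by
  have h : μ.prod τ ≪ (μ.prod (κ.prod N)).map (inputOutput φ) := by
    rw [← (measurePreserving_inputOutput hφ (κ := κ)).map_eq]
    exact (Measure.AbsolutelyContinuous.rfl.prod (Measure.AbsolutelyContinuous.rfl.prod hN)).map
      (measurable_inputOutput hφ)
  have hsnd := h.map measurable_snd
  rwa [measurePreserving_snd.map_eq] at hsnd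

lemma map_inputOutput_absolutelyContinuous_fst_prod_snd [IsProbabilityMeasure μ]
    [IsProbabilityMeasure N] (hN : N ≪ τ) (hN' : τ ≪ N) :
    (μ.prod (κ.prod N)).map (inputOutput φ) ≪
      ((μ.prod (κ.prod N)).map (inputOutput φ)).fst.prod
        ((μ.prod (κ.prod N)).map (inputOutput φ)).snd := by
  rw [fst_map_inputOutput hφ]
  exact (map_inputOutput_absolutelyContinuous hφ hN).trans
    (Measure.AbsolutelyContinuous.rfl.prod (absolutelyContinuous_snd_map_inputOutput hφ hN'))

end Invariant

variable [MeasurableSub₂ Y] {τ : Measure Y} [SFinite τ] [τ.IsAddLeftInvariant]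

lemma lintegral_prod_eq_lintegral_sub {k : X × S × Y → ℝ≥0∞} (hk : Measurable k) :
    ∫⁻ p, k p ∂(μ.prod (κ.prod τ)) = ∫⁻ x, ∫⁻ y, ∫⁻ s, k (x, s, y - φ x s) ∂κ ∂τ ∂μ := by
  rw [lintegral_prod _ hk.aemeasurable]
  refine lintegral_congr fun x ↦ ?_
  have hφx : Measurable (φ x) := hφ.comp measurable_prodMk_left
  have hshift (s : S) : ∫⁻ n, k (x, s, n) ∂τ = ∫⁻ y, k (x, s, y - φ x s) ∂τ := by
    rw [← lintegral_add_left_eq_self (fun y ↦ k (x, s, y - φ x s)) (φ x s)]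
    simp only [add_sub_cancel_left]
  rw [lintegral_prod _ (by fun_prop), lintegral_congr hshift, lintegral_lintegral_swap]
  exact (hk.comp (by fun_prop : Measurable fun q : S × Y ↦ (x, q.1, q.2 - φ x q.1))).aemeasurable

variable {d G : Y → ℝ≥0∞}

lemma map_inputOutput_withDensity_le [SFinite μ] {e : X × S × Y → ℝ≥0∞} (hd : Measurable d)
    (he : Measurable e) (hG : Measurable G)
    (hle : ∀ x y, ∫⁻ s, d (y - φ x s) * e (x, s, y - φ x s) ∂κ ≤ G y) :
    ((μ.prod (κ.prod (τ.withDensity d))).withDensity e).map (inputOutput φ)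
      ≤ μ.prod (τ.withDensity G) := by
  have hπ := measurable_inputOutput hφ
  have hd' : Measurable fun p : X × S × Y ↦ d p.2.2 := by fun_prop
  rw [prod_withDensity_right hd, prod_withDensity_right (by fun_prop), ← withDensity_mul _ hd' he,
    prod_withDensity_right hG]
  refine Measure.le_iff.2 fun A hA ↦ ?_
  let f : X × Y → ℝ≥0∞ := A.indicator 1
  have hf : Measurable f := measurable_one.indicator hA
  rw [Measure.map_apply hπ hA, withDensity_apply _ (hπ hA), withDensity_apply _ hA,
    ← lintegral_indicator (hπ hA), ← lintegral_indicator hA]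
  have hφx (x : X) : Measurable (φ x) := hφ.comp measurable_prodMk_left
  calc ∫⁻ p, (inputOutput φ ⁻¹' A).indicator ((fun p ↦ d p.2.2) * e) p ∂(μ.prod (κ.prod τ))
      = ∫⁻ p, d p.2.2 * e p * f (inputOutput φ p) ∂(μ.prod (κ.prod τ)) := by
        refine lintegral_congr fun p ↦ ?_
        by_cases hp : inputOutput φ p ∈ A <;> simp [f, hp]
    _ = ∫⁻ x, ∫⁻ y, (∫⁻ s, d (y - φ x s) * e (x, s, y - φ x s) ∂κ) * f (x, y) ∂τ ∂μ := by
        rw [lintegral_prod_eq_lintegral_sub hφ (by fun_prop)]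
        refine lintegral_congr fun x ↦ lintegral_congr fun y ↦ ?_
        simp only [inputOutput, add_sub_cancel]
        exact lintegral_mul_const _ (by fun_prop)
    _ ≤ ∫⁻ x, ∫⁻ y, G y * f (x, y) ∂τ ∂μ := by
        gcongr with x y
        exact hle x y
    _ = ∫⁻ z, A.indicator (fun z ↦ G z.2) z ∂(μ.prod τ) := by
        rw [← lintegral_prod (fun z : X × Y ↦ G z.2 * f z) (by fun_prop)]
        refine lintegral_congr fun z ↦ ?_
        by_cases hz : z ∈ A <;> simp [f, hz]

/-- The function `g` compares the density `d` of the noise with an arbitrary reference density `G`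
of the output. -/
theorem klDiv_map_inputOutput_le [IsProbabilityMeasure μ] {N : Measure Y} [IsProbabilityMeasure N]
    (hN : N = τ.withDensity d) (hd : Measurable d) (hd0 : ∀ y, d y ≠ 0)
    {g : X × S × Y → ℝ} (hg : Measurable g) (hgi : Integrable g (μ.prod (κ.prod N)))
    (hG : Measurable G)
    (hle : ∀ x y, ∫⁻ s, d (y - φ x s) * ENNReal.ofReal (Real.exp (-g (x, s, y - φ x s))) ∂κ ≤ G y)
    {C : ℝ≥0} (hC : ∫⁻ y, G y ∂τ ≤ C) :
    InformationTheory.klDiv ((μ.prod (κ.prod N)).map (inputOutput φ))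
        (((μ.prod (κ.prod N)).map (inputOutput φ)).fst.prod
          ((μ.prod (κ.prod N)).map (inputOutput φ)).snd)
      ≤ ENNReal.ofReal (∫ p, g p ∂(μ.prod (κ.prod N)) + C - 1) := by
  have hNτ : N ≪ τ := hN ▸ withDensity_absolutelyContinuous _ _
  have hτN : τ ≪ N := hN ▸ withDensity_absolutelyContinuous' hd.aemeasurable (ae_of_all _ hd0)
  have hπ := measurable_inputOutput hφ
  have := Measure.isProbabilityMeasure_map (μ := μ.prod (κ.prod N)) hπ.aemeasurable
  refine klDiv_fst_prod_snd_le (ξ := τ.withDensity G) ⟨hπ, rfl⟩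
    (map_inputOutput_absolutelyContinuous_fst_prod_snd hφ hNτ hτN) hgi
    ((withDensity_absolutelyContinuous _ _).trans (absolutelyContinuous_snd_map_inputOutput hφ hτN))
    ?_ (by rwa [withDensity_apply _ MeasurableSet.univ, Measure.restrict_univ])
  rw [fst_map_inputOutput hφ, hN]
  exact map_inputOutput_withDensity_le hφ hd (by fun_prop) hG hle

end AdditiveNoise

section Channel

variable {L Q R : ℕ} (A : Matrix (Fin L) (Fin Q) ℂ) (ρ : ℝ)

/-- The noiseless output of the channel: entry `(m, i)` is `√ρ x_i (A s_m)_i`. -/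
def signal (x : Fin L → ℂ) (s : Fin R → Fin Q → ℂ) : Fin R → Fin L → ℂ :=
  fun m i ↦ ((Real.sqrt ρ : ℝ) : ℂ) * (x i * (A *ᵥ s m) i)

lemma output_eq_signal_add (x : Fin L → ℂ) (s : Fin R → Fin Q → ℂ) (n : Fin R → Fin L → ℂ) :
    output A ρ x s n = signal A ρ x s + n := by
  ext m i
  simp only [output, signal, Pi.add_apply, Pi.smul_apply, smul_eq_mul,
    Matrix.mulVec, dotProduct, Matrix.diagonal_apply, ite_mul, zero_mul, Finset.sum_ite_eq,
    Finset.mem_univ, if_true]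
  ring

lemma jointLaw_eq_map_inputOutput (μ : Measure (Fin L → ℂ)) :
    jointLaw A R ρ μ = (μ.prod ((complexGaussianVectors R Q).prod
      (complexGaussianVectors R L))).map (inputOutput (signal A ρ)) := by
  simp only [jointLaw, output_eq_signal_add]
  rfl

lemma measurable_signal : Measurable (Function.uncurry (signal (R := R) A ρ)) := by
  unfold signal Function.uncurry Matrix.mulVec dotProduct; fun_prop

@[fun_prop]
lemma measurable_signal_comp {α : Type*} [MeasurableSpace α] {f : α → Fin L → ℂ}
    {g : α → Fin R → Fin Q → ℂ} (hf : Measurable f) (hg : Measurable g) :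
    Measurable fun a ↦ signal A ρ (f a) (g a) :=
  (measurable_signal A ρ).comp (hf.prodMk hg)

instance (μ : Measure (Fin L → ℂ)) [IsProbabilityMeasure μ] :
    IsProbabilityMeasure (jointLaw A R ρ μ) := by
  rw [jointLaw_eq_map_inputOutput]
  exact Measure.isProbabilityMeasure_map
    (measurable_inputOutput (measurable_signal A ρ)).aemeasurable

end Channel

section LogarithmicIntegral

lemma ofReal_neg_log_mul_le (a b : ℝ) :
    ENNReal.ofReal (-Real.log (a * b)) ≤
      ENNReal.ofReal (-Real.log a) + ENNReal.ofReal (-Real.log b) := by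
  rcases eq_or_ne a 0 with rfl | ha
  · simp
  rcases eq_or_ne b 0 with rfl | hb
  · simp
  rw [Real.log_mul ha hb, neg_add]
  exact ENNReal.ofReal_add_le

lemma ofReal_mul_neg_log_le_indicator {r : ℝ} (hr : 0 < r) :
    ENNReal.ofReal (r * -Real.log r) ≤ (Set.Icc 0 1).indicator 1 r := by
  rcases le_or_gt r 1 with h1 | h1
  · rw [Set.indicator_of_mem (Set.mem_Icc.2 ⟨hr.le, h1⟩), Pi.one_apply, ENNReal.ofReal_le_one]
    have hlog : -Real.log r ≤ r⁻¹ := by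
      rw [← Real.log_inv]
      linarith [Real.log_le_sub_one_of_pos (inv_pos.2 hr)]
    calc r * -Real.log r ≤ r * r⁻¹ := by gcongr
      _ = 1 := mul_inv_cancel₀ hr.ne'
  · rw [ENNReal.ofReal_of_nonpos (mul_nonpos_of_nonneg_of_nonpos hr.le
      (neg_nonpos.2 (Real.log_nonneg h1.le)))]
    exact zero_le

lemma lintegral_neg_log_norm_ne_top : ∫⁻ z : ℂ, ENNReal.ofReal (-Real.log ‖z‖) ≠ ∞ := by
  rw [← Complex.lintegral_comp_polarCoord_symm]
  let B : Set (ℝ × ℝ) := Set.Icc 0 1 ×ˢ Set.Icc (-Real.pi) Real.pi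
  have hB : volume B ≠ ∞ := (isCompact_Icc.prod isCompact_Icc).measure_lt_top.ne
  refine ne_top_of_le_ne_top hB ?_
  rw [← lintegral_indicator_one (measurableSet_Icc.prod measurableSet_Icc),
    ← lintegral_indicator polarCoord.open_target.measurableSet]
  refine lintegral_mono fun p ↦ Set.indicator_le (fun p hp ↦ ?_) p
  simp only [polarCoord_target, Set.mem_prod, Set.mem_Ioi, Set.mem_Ioo] at hp
  rw [Complex.norm_polarCoord_symm, abs_of_pos hp.1, smul_eq_mul, ← ENNReal.ofReal_mul hp.1.le]
  refine (ofReal_mul_neg_log_le_indicator hp.1).trans ?_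
  refine Set.indicator_apply_le (g := fun _ ↦ B.indicator 1 p) fun h1 ↦ ?_
  rw [Set.indicator_of_mem (show p ∈ B from ⟨h1, hp.2.1.le, hp.2.2.le⟩)]
  rfl

lemma setLIntegral_neg_log_norm_prod_sub_le (D : Set ℂ) (S : Multiset ℂ) :
    ∫⁻ τ in D, ENNReal.ofReal (-Real.log ‖(S.map fun r ↦ τ - r).prod‖)
      ≤ S.card * ∫⁻ z : ℂ, ENNReal.ofReal (-Real.log ‖z‖) := by
  induction S using Multiset.induction_on with
  | empty => simp
  | cons r S ih =>
    simp only [Multiset.map_cons, Multiset.prod_cons, norm_mul, Multiset.card_cons]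
    calc _ ≤ ∫⁻ τ in D, (ENNReal.ofReal (-Real.log ‖τ - r‖) +
          ENNReal.ofReal (-Real.log ‖(S.map fun r ↦ τ - r).prod‖)) :=
          lintegral_mono fun τ ↦ ofReal_neg_log_mul_le _ _
      _ ≤ (∫⁻ z : ℂ, ENNReal.ofReal (-Real.log ‖z‖)) +
          S.card * ∫⁻ z : ℂ, ENNReal.ofReal (-Real.log ‖z‖) := by
          rw [lintegral_add_left (by fun_prop)]
          refine add_le_add ((setLIntegral_le_lintegral _ _).trans ?_) ih
          exact (lintegral_sub_right_eq_self (fun z : ℂ ↦ ENNReal.ofReal (-Real.log ‖z‖)) r).le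
      _ = _ := by push_cast; ring

lemma setLIntegral_neg_log_norm_eval_le (D : Set ℂ) (p : Polynomial ℂ) :
    ∫⁻ τ in D, ENNReal.ofReal (-Real.log ‖p.eval τ‖)
      ≤ ENNReal.ofReal (-Real.log ‖p.leadingCoeff‖) * volume D
        + p.natDegree * ∫⁻ z : ℂ, ENNReal.ofReal (-Real.log ‖z‖) := by
  calc _ ≤ ∫⁻ τ in D, (ENNReal.ofReal (-Real.log ‖p.leadingCoeff‖) +
            ENNReal.ofReal (-Real.log ‖(p.roots.map fun r ↦ τ - r).prod‖)) := by
        refine lintegral_mono fun τ ↦ ?_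
        rw [(IsAlgClosed.splits p).eval_eq_prod_roots τ, norm_mul]
        exact ofReal_neg_log_mul_le _ _
    _ ≤ _ := by
        rw [lintegral_add_left (by fun_prop), setLIntegral_const]
        gcongr
        refine (setLIntegral_neg_log_norm_prod_sub_le D _).trans ?_
        gcongr
        exact p.card_roots'

end LogarithmicIntegral

section LineAverage

variable {R n : ℕ}

instance isAddHaarMeasure_volume_pi_pi (R n : ℕ) :
    (volume : Measure (Fin R → Fin n → ℂ)).IsAddHaarMeasure :=
  Measure.pi.isAddHaarMeasure _

lemma sqNorm_smul (c : ℂ) (y : Fin R → Fin n → ℂ) : sqNorm (c • y) = ‖c‖ ^ 2 * sqNorm y := by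
  simp only [sqNorm, Pi.smul_apply, norm_smul, mul_pow, Finset.mul_sum]

lemma sqNorm_sub_le (y w : Fin R → Fin n → ℂ) :
    sqNorm (y - w) ≤ 2 * sqNorm y + 2 * sqNorm w := by
  simp only [sqNorm, Finset.mul_sum, ← Finset.sum_add_distrib]
  gcongr with m _ i _
  have h1 : ‖(y - w) m i‖ ≤ ‖y m i‖ + ‖w m i‖ := norm_sub_le _ _
  nlinarith [sq_nonneg (‖y m i‖ - ‖w m i‖), norm_nonneg ((y - w) m i)]

lemma half_sqNorm_sub_le (y w : Fin R → Fin n → ℂ) :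
    2⁻¹ * sqNorm y - sqNorm w ≤ sqNorm (y + w) := by
  have h := sqNorm_sub_le (y + w) w
  rw [add_sub_cancel_right] at h
  linarith

lemma sqNorm_le_of_norm_le_one {v : Fin R → Fin n → ℂ} (hv : ‖v‖ ≤ 1) : sqNorm v ≤ R * n := by
  have h (m i) : ‖v m i‖ ^ 2 ≤ 1 :=
    pow_le_one₀ (norm_nonneg _) (((norm_le_pi_norm (v m) i).trans (norm_le_pi_norm v m)).trans hv)
  calc sqNorm v ≤ ∑ _m : Fin R, ∑ _i : Fin n, (1 : ℝ) := by
        unfold sqNorm; gcongr with m _ i _; exact h m i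
    _ = R * n := by simp

lemma gaussianDensity_add_le (y w : Fin R → Fin n → ℂ) :
    gaussianDensity R n (y + w) ≤
      ENNReal.ofReal (Real.exp (sqNorm w)) * ENNReal.ofReal (Real.exp (-(2⁻¹ * sqNorm y))) := by
  refine (gaussianDensity_le_exp _).trans ?_
  rw [← ENNReal.ofReal_mul (Real.exp_pos _).le, ← Real.exp_add]
  gcongr
  linarith [half_sqNorm_sub_le y w]

lemma integrable_exp_neg_mul_sqNorm (R n : ℕ) {c : ℝ} (hc : 0 < c) :
    Integrable (fun y : Fin R → Fin n → ℂ ↦ Real.exp (-(c * sqNorm y))) := by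
  have hdensity : Integrable fun y : Fin R → Fin n → ℂ ↦
      (Real.pi⁻¹) ^ (R * n) * Real.exp (-sqNorm y) := by
    refine ⟨by fun_prop, ?_⟩
    have h1 : complexGaussianVectors R n Set.univ = 1 := measure_univ
    rw [complexGaussianVectors_eq_withDensity, withDensity_apply _ MeasurableSet.univ,
      Measure.restrict_univ] at h1
    unfold gaussianDensity at h1
    rw [hasFiniteIntegral_iff_ofReal (ae_of_all _ fun _ ↦ by positivity), h1]
    exact ENNReal.one_lt_top
  have h1 := ((integrable_const_mul_iff (IsUnit.mk0 _ (by positivity)) _).1 hdensity).comp_smul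
    (Real.sqrt_pos.2 hc).ne'
  refine h1.congr (ae_of_all _ fun y ↦ ?_)
  simp only [sqNorm, Pi.smul_apply, norm_smul, mul_pow, Real.norm_eq_abs, sq_abs,
    Real.sq_sqrt hc.le, ← Finset.mul_sum]

lemma lintegral_exp_neg_mul_sqNorm_ne_top (R n : ℕ) {c : ℝ} (hc : 0 < c) :
    ∫⁻ y : Fin R → Fin n → ℂ, ENNReal.ofReal (Real.exp (-(c * sqNorm y))) ≠ ∞ :=
  ((hasFiniteIntegral_iff_ofReal (ae_of_all _ fun _ ↦ (Real.exp_pos _).le)).1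
    (integrable_exp_neg_mul_sqNorm R n hc).2).ne

variable {ℓ : (Fin R → Fin n → ℂ) → ℝ≥0∞}

lemma lintegral_gaussianDensity_sub_mul_le (hℓ : Measurable ℓ) {v w : Fin R → Fin n → ℂ} {M : ℝ}
    (hM : sqNorm (w - v) ≤ M) :
    ∫⁻ y, gaussianDensity R n (y - v) * ℓ y ≤
      ENNReal.ofReal (Real.exp M) *
        ∫⁻ y, ENNReal.ofReal (Real.exp (-(2⁻¹ * sqNorm y))) * ℓ (y + w) := by
  rw [← lintegral_const_mul _ (by fun_prop), ← lintegral_add_right_eq_self _ w]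
  refine lintegral_mono fun y ↦ ?_
  rw [← mul_assoc, add_sub_assoc]
  gcongr
  exact (gaussianDensity_add_le _ _).trans (by gcongr)

/- A Gaussian density is comparable to its translates along the disc `{τ • s₀}`, so the expectation
can be averaged over this disc first. -/
theorem exists_lintegral_add_le_of_line_average (hℓ : Measurable ℓ) (s₀ : Fin R → Fin n → ℂ)
    {K : ℝ≥0∞} (hK : K ≠ ∞)
    (hav : ∀ s, ∫⁻ τ in Metric.closedBall (0 : ℂ) 1, ℓ (s + τ • s₀) ≤ K) :
    ∃ C : ℝ≥0, ∀ v : Fin R → Fin n → ℂ, ‖v‖ ≤ 1 →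
      ∫⁻ s, ℓ (v + s) ∂(complexGaussianVectors R n) ≤ C := by
  set V := volume (Metric.closedBall (0 : ℂ) 1)
  have hV0 : V ≠ 0 := (Metric.measure_closedBall_pos volume _ one_pos).ne'
  have hVt : V ≠ ∞ := (isCompact_closedBall _ _).measure_lt_top.ne
  set M : ℝ := 2 * sqNorm s₀ + 2 * (R * n)
  set F : (Fin R → Fin n → ℂ) → ℝ≥0∞ := fun y ↦ ENNReal.ofReal (Real.exp (-(2⁻¹ * sqNorm y)))
  have hF : Measurable F := by fun_prop
  have hFt : ∫⁻ y, F y ≠ ∞ := lintegral_exp_neg_mul_sqNorm_ne_top R n (by norm_num)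
  have hCt : V⁻¹ * (ENNReal.ofReal (Real.exp M) * ((∫⁻ y, F y) * K)) ≠ ∞ := by finiteness
  refine ⟨(V⁻¹ * (ENNReal.ofReal (Real.exp M) * ((∫⁻ y, F y) * K))).toNNReal, fun v hv ↦ ?_⟩
  rw [ENNReal.coe_toNNReal hCt, lintegral_add_complexGaussianVectors v hℓ]
  set E := ∫⁻ y, gaussianDensity R n (y - v) * ℓ y
  have hbound : ∀ τ ∈ Metric.closedBall (0 : ℂ) 1,
      E ≤ ENNReal.ofReal (Real.exp M) * ∫⁻ y, F y * ℓ (y + τ • s₀) := by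
    intro τ hτ
    refine lintegral_gaussianDensity_sub_mul_le hℓ ((sqNorm_sub_le _ _).trans ?_)
    have hsmul : sqNorm (τ • s₀) ≤ sqNorm s₀ := by
      rw [sqNorm_smul]
      exact mul_le_of_le_one_left (sqNorm_nonneg _)
        (pow_le_one₀ (norm_nonneg _) (by simpa using hτ))
    linarith [sqNorm_le_of_norm_le_one hv]
  have hV : V * E ≤ ENNReal.ofReal (Real.exp M) * ((∫⁻ y, F y) * K) := by
    calc V * E = ∫⁻ _ in Metric.closedBall (0 : ℂ) 1, E := by rw [setLIntegral_const, mul_comm]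
      _ ≤ ∫⁻ τ in Metric.closedBall (0 : ℂ) 1,
          ENNReal.ofReal (Real.exp M) * ∫⁻ y, F y * ℓ (y + τ • s₀) :=
          setLIntegral_mono' measurableSet_closedBall hbound
      _ = ENNReal.ofReal (Real.exp M) *
          ∫⁻ y, F y * ∫⁻ τ in Metric.closedBall (0 : ℂ) 1, ℓ (y + τ • s₀) := by
          rw [lintegral_const_mul _ (by fun_prop), lintegral_lintegral_swap
            (f := fun (τ : ℂ) y ↦ F y * ℓ (y + τ • s₀)) (by unfold Function.uncurry; fun_prop)]
          simp_rw [← lintegral_const_mul' (F _) _ ENNReal.ofReal_ne_top]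
      _ ≤ ENNReal.ofReal (Real.exp M) * ((∫⁻ y, F y) * K) := by
          rw [← lintegral_mul_const _ hF]
          gcongr with y
          exact hav y
  calc E = V⁻¹ * (V * E) := by rw [← mul_assoc, ENNReal.inv_mul_cancel hV0 hVt, one_mul]
    _ ≤ _ := by gcongr

/-- The function `D` restricts to polynomials of degree at most `N` on the complex lines in
direction `s₀`, with the same coefficient `κ` of degree `N` on all of them. -/
def IsPolynomialAlong (D : (Fin R → Fin n → ℂ) → ℂ) (s₀ : Fin R → Fin n → ℂ) (N : ℕ) (κ : ℂ) :
    Prop :=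
  ∀ s, ∃ p : Polynomial ℂ, p.natDegree ≤ N ∧ p.coeff N = κ ∧ ∀ τ, p.eval τ = D (s + τ • s₀)

namespace IsPolynomialAlong

variable {D : (Fin R → Fin n → ℂ) → ℂ} (hD : Measurable D) {s₀ : Fin R → Fin n → ℂ} {N : ℕ}
  {κ : ℂ} (hp : IsPolynomialAlong D s₀ N κ) (hκ : κ ≠ 0)

include hD hp hκ

theorem exists_lintegral_neg_log_le :
    ∃ C : ℝ≥0, ∀ v : Fin R → Fin n → ℂ, ‖v‖ ≤ 1 →
      ∫⁻ s, ENNReal.ofReal (-Real.log ‖D (v + s)‖) ∂(complexGaussianVectors R n) ≤ C := by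
  have hV : volume (Metric.closedBall (0 : ℂ) 1) ≠ ∞ := (isCompact_closedBall _ _).measure_lt_top.ne
  have hlog := lintegral_neg_log_norm_ne_top
  refine exists_lintegral_add_le_of_line_average
    (ℓ := fun s ↦ ENNReal.ofReal (-Real.log ‖D s‖)) (by fun_prop) s₀
    (K := ENNReal.ofReal (-Real.log ‖κ‖) * volume (Metric.closedBall (0 : ℂ) 1)
        + N * ∫⁻ z : ℂ, ENNReal.ofReal (-Real.log ‖z‖)) (by finiteness) fun s ↦ ?_
  obtain ⟨p, hdeg, hcoeff, heval⟩ := hp s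
  have hdeg' : p.natDegree = N := hdeg.antisymm
    (Polynomial.le_natDegree_of_ne_zero (by rwa [hcoeff]))
  have hlc : p.leadingCoeff = κ := by rw [Polynomial.leadingCoeff, hdeg', hcoeff]
  simpa only [heval, hdeg', hlc] using setLIntegral_neg_log_norm_eval_le (Metric.closedBall 0 1) p

theorem ae_ne_zero : ∀ᵐ s, D s ≠ 0 := by
  have hset : MeasurableSet {s | D s = 0} := hD (measurableSet_singleton 0)
  have hline (s) : ∀ᵐ τ : ℂ, D (s + τ • s₀) ≠ 0 := by
    obtain ⟨p, -, hcoeff, heval⟩ := hp s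
    have hp0 : p ≠ 0 := by
      rintro rfl
      exact hκ (by simpa using hcoeff.symm)
    refine measure_mono_null (t := (p.roots.toFinset : Set ℂ)) (fun τ hτ ↦ ?_)
      (p.roots.toFinset.finite_toSet.measure_zero _)
    simpa [hp0, heval] using hτ
  let ℓ : (Fin R → Fin n → ℂ) → ℝ≥0∞ := {s | D s = 0}.indicator fun _ ↦ ∞
  have hℓ : Measurable ℓ := measurable_const.indicator hset
  obtain ⟨C, hC⟩ := exists_lintegral_add_le_of_line_average hℓ s₀ ENNReal.zero_ne_top fun s ↦ by
      have hmeas : Measurable fun τ : ℂ ↦ ℓ (s + τ • s₀) := by fun_prop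
      rw [nonpos_iff_eq_zero, lintegral_eq_zero_iff hmeas]
      filter_upwards [ae_restrict_of_ae (hline s)] with τ hτ
      simp [ℓ, hτ]
  have hgauss : complexGaussianVectors R n {s | D s = 0} = 0 := by
    have h0 := (hC 0 (by simp)).trans_lt ENNReal.coe_lt_top
    simp only [ℓ, zero_add, lintegral_indicator hset, lintegral_const,
      Measure.restrict_apply_univ] at h0
    by_contra h
    exact h0.ne (ENNReal.top_mul h)
  rw [complexGaussianVectors_eq_withDensity] at hgauss
  have hvol := (withDensity_absolutelyContinuous' (measurable_gaussianDensity R n).aemeasurable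
    (ae_of_all _ fun y ↦ (gaussianDensity_pos y).ne')) hgauss
  rw [ae_iff]
  simpa using hvol

end IsPolynomialAlong

end LineAverage

section GeneralPosition

variable {L Q : ℕ} {A : Matrix (Fin L) (Fin Q) ℂ} {K : Finset (Fin L)}

/-- Every `Q` rows of `A` with indices in `K` are linearly independent. -/
def InGeneralPosition (A : Matrix (Fin L) (Fin Q) ℂ) (K : Finset (Fin L)) : Prop :=
  ∀ S ⊆ K, S.card = Q → LinearIndependent ℂ (fun i : S ↦ A.row i)

namespace InGeneralPosition

lemma bijective_mulVec (hK : InGeneralPosition A K) (hcard : K.card = Q) :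
    Function.Bijective fun (t : Fin Q → ℂ) (i : K) ↦ (A *ᵥ t) i := by
  let B : Matrix K (Fin Q) ℂ := A.submatrix (fun i : K ↦ (i : Fin L)) id
  have hrank : B.rank = Fintype.card K :=
    LinearIndependent.rank_matrix (M := B) (hK K subset_rfl hcard)
  have hsurj : Function.Surjective B.mulVecLin := by
    rw [← LinearMap.range_eq_top]
    refine Submodule.eq_top_of_finrank_eq ?_
    rw [← Matrix.rank, hrank, Module.finrank_fintype_fun_eq_card]
  have hfin : Module.finrank ℂ (Fin Q → ℂ) = Module.finrank ℂ (K → ℂ) := by simp [hcard]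
  exact ⟨(LinearMap.injective_iff_surjective_of_finrank_eq_finrank hfin).2 hsurj, hsurj⟩

lemma mono (hK : InGeneralPosition A K) {S : Finset (Fin L)} (hS : S ⊆ K) :
    InGeneralPosition A S :=
  fun U hU ↦ hK U (hU.trans hS)

lemma eq_zero_of_mulVec_eq_zero (hK : InGeneralPosition A K) (hQK : Q ≤ K.card)
    {t : Fin Q → ℂ} (ht : ∀ i ∈ K, (A *ᵥ t) i = 0) : t = 0 := by
  obtain ⟨S, hSK, hS⟩ := Finset.exists_subset_card_eq hQK
  refine ((hK.mono hSK).bijective_mulVec hS).1 ?_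
  funext i
  simpa using ht i (hSK i.2)

lemma exists_mulVec_eq_one (hK : InGeneralPosition A K) (hcard : K.card = Q) {i₀ : Fin L}
    (hi₀ : i₀ ∈ K) : ∃ s : Fin Q → ℂ, (A *ᵥ s) i₀ = 1 ∧ ∀ i ∈ K.erase i₀, (A *ᵥ s) i = 0 := by
  obtain ⟨s, hs⟩ := (hK.bijective_mulVec hcard).2 fun j ↦ if (j : Fin L) = i₀ then 1 else 0
  refine ⟨s, by simpa using congrFun hs ⟨i₀, hi₀⟩, fun i hi ↦ ?_⟩
  obtain ⟨hne, hiK⟩ := Finset.mem_erase.1 hi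
  simpa [hne] using congrFun hs ⟨i, hiK⟩

/- If `A s` vanishes on `K \ T`, then so does `A t` for any solution `(δ, t)`; as `K \ T` has
`Q - 1` elements, `t` is a multiple of `s`. -/
lemma exists_fading_eq (hK : InGeneralPosition A K) {T : Finset (Fin L)} (hTK : T ⊆ K)
    {i₀ : Fin L} (hi₀ : i₀ ∈ T) (hcard : (K \ T).card + 1 = Q) :
    ∃ s : Fin Q → ℂ, ∀ (δ : Fin L → ℂ) (t : Fin Q → ℂ),
      (∀ i ∈ K, δ i * (A *ᵥ s) i + (A *ᵥ t) i = 0) → ∀ i ∈ T, δ i = δ i₀ := by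
  have hins (i) (hi : i ∈ T) : InGeneralPosition A (insert i (K \ T)) ∧
      (insert i (K \ T)).card = Q := by
    refine ⟨hK.mono (Finset.insert_subset (hTK hi) Finset.sdiff_subset), ?_⟩
    rw [Finset.card_insert_of_notMem (by simp [hi]), hcard]
  have hker (i) (hi : i ∈ T) (t : Fin Q → ℂ) (hti : (A *ᵥ t) i = 0)
      (ht : ∀ j ∈ K \ T, (A *ᵥ t) j = 0) : t = 0 := by
    refine (hins i hi).1.eq_zero_of_mulVec_eq_zero (hins i hi).2.ge fun j hj ↦ ?_
    rcases Finset.mem_insert.1 hj with rfl | hj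
    exacts [hti, ht j hj]
  obtain ⟨s, hs₀, hs⟩ := (hins i₀ hi₀).1.exists_mulVec_eq_one (hins i₀ hi₀).2
    (Finset.mem_insert_self _ _)
  rw [Finset.erase_insert (by simp [hi₀])] at hs
  have hsT (i) (hi : i ∈ T) : (A *ᵥ s) i ≠ 0 := by
    intro h
    simp [hker i hi s h hs] at hs₀
  refine ⟨s, fun δ t h i hi ↦ ?_⟩
  have ht : t = -(δ i₀ • s) := by
    refine eq_neg_of_add_eq_zero_left (hker i₀ hi₀ _ ?_ fun j hj ↦ ?_)
    · simpa [Matrix.mulVec_add, Matrix.mulVec_smul, hs₀, add_comm] using h i₀ (hTK hi₀)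
    · simpa [Matrix.mulVec_add, Matrix.mulVec_smul, hs j hj] using h j (Finset.mem_sdiff.1 hj).1
  have hi' := h i (hTK hi)
  rw [ht, Matrix.mulVec_neg, Matrix.mulVec_smul, Pi.neg_apply, Pi.smul_apply, smul_eq_mul] at hi'
  refine mul_right_cancel₀ (hsT i hi) ?_
  linear_combination hi'

end InGeneralPosition

end GeneralPosition

section Windows

variable {α : Type*} [DecidableEq α] {K : Finset α} {i₀ : α} {d : ℕ}

lemma exists_mem_card_eq_le_card_union (hi₀ : i₀ ∈ K) (hd : d + 1 ≤ K.card) (U : Finset α) :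
    ∃ T ⊆ K, i₀ ∈ T ∧ T.card = d + 1 ∧ min K.card (U.card + d) ≤ (U ∪ T).card := by
  obtain ⟨V, hVK, hV⟩ := Finset.exists_subset_card_eq (s := K \ U) (min_le_right d _)
  obtain ⟨T, hVT, hTK, hT⟩ := Finset.exists_subsuperset_card_eq (n := d + 1)
    (Finset.insert_subset hi₀ (hVK.trans Finset.sdiff_subset))
    ((Finset.card_insert_le i₀ V).trans (by omega)) hd
  refine ⟨T, hTK, hVT (Finset.mem_insert_self _ _), hT, ?_⟩
  calc min K.card (U.card + d) ≤ U.card + V.card := by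
        have := Finset.card_le_card_sdiff_add_card (s := K) (t := U)
        omega
    _ = (U ∪ V).card :=
        (Finset.card_union_of_disjoint (Finset.disjoint_sdiff.mono_right hVK)).symm
    _ ≤ (U ∪ T).card :=
        Finset.card_le_card (Finset.union_subset_union_right ((Finset.subset_insert _ _).trans hVT))

lemma exists_windows (hi₀ : i₀ ∈ K) (hd : d + 1 ≤ K.card) (R : ℕ) :
    ∃ T : Fin R → Finset α, (∀ m, T m ⊆ K ∧ i₀ ∈ T m ∧ (T m).card = d + 1) ∧
      min K.card (R * d + 1) ≤ (insert i₀ (Finset.univ.biUnion T)).card := by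
  induction R with
  | zero => exact ⟨Fin.elim0, fun m ↦ m.elim0, by simp⟩
  | succ R ih =>
    obtain ⟨T, hT, hcard⟩ := ih
    obtain ⟨T', hT'K, hi₀T', hT'card, hunion⟩ := exists_mem_card_eq_le_card_union hi₀ hd
      (insert i₀ (Finset.univ.biUnion T))
    have hcons : Finset.univ.biUnion (Fin.cons T' T : Fin (R + 1) → Finset α) =
        T' ∪ Finset.univ.biUnion T := by
      ext i
      simp [Fin.exists_fin_succ]
    refine ⟨Fin.cons T' T, Fin.cases ⟨hT'K, hi₀T', hT'card⟩ hT, ?_⟩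
    rw [hcons, ← Finset.union_insert, Finset.union_comm, Nat.succ_mul]
    omega

end Windows

section Jacobian

/-- The unknowns of the linearized channel: the inputs with index in `P` and the fading
coefficients of the `R` antennas. -/
abbrev Unknown {L : ℕ} (P : Finset (Fin L)) (R Q : ℕ) : Type := P ⊕ (Fin R × Fin Q)

variable {L Q R : ℕ} (A : Matrix (Fin L) (Fin Q) ℂ) (P : Finset (Fin L))

/-- The inputs among the unknowns. -/
def freeInputs (z : Unknown P R Q → ℂ) : P → ℂ := fun p ↦ z (Sum.inl p)

/-- The fading coefficients among the unknowns. -/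
def fadings (z : Unknown P R Q → ℂ) : Fin R → Fin Q → ℂ := fun m j ↦ z (Sum.inr (m, j))

/-- The Jacobian matrix of the noiseless channel `(x, s) ↦ (x_i (A s_m)_i)_{m, i}` at the input `X`
and the fading `s`, with respect to the unknowns; the inputs with index outside `P` are frozen. -/
def jacobian (X : Fin L → ℂ) (s : Fin R → Fin Q → ℂ) :
    Matrix (Fin R × Fin L) (Unknown P R Q) ℂ :=
  Matrix.of fun a ↦ Sum.elim (fun p ↦ if a.2 = p then (A *ᵥ s a.1) a.2 else 0)
    (fun q ↦ if q.1 = a.1 then X a.2 * A a.2 q.2 else 0)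

lemma jacobian_mulVec (X : Fin L → ℂ) (s : Fin R → Fin Q → ℂ) (z : Unknown P R Q → ℂ)
    (a : Fin R × Fin L) :
    (jacobian A P X s *ᵥ z) a =
      (if h : a.2 ∈ P then freeInputs P z ⟨a.2, h⟩ else 0) * (A *ᵥ s a.1) a.2 +
        X a.2 * (A *ᵥ fadings P z a.1) a.2 := by
  rw [Matrix.mulVec, dotProduct, Fintype.sum_sum_type, Fintype.sum_prod_type]
  congr 1
  · by_cases h : a.2 ∈ P
    · rw [Finset.sum_eq_single ⟨a.2, h⟩ (fun p _ hp ↦ ?_) (by simp)]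
      · simp [jacobian, freeInputs, h, mul_comm]
      · have hne : a.2 ≠ p := fun heq ↦ hp (Subtype.ext heq.symm)
        simp [jacobian, hne]
    · refine (Finset.sum_eq_zero fun p _ ↦ ?_).trans (by simp [h])
      have hne : a.2 ≠ p := fun heq ↦ h (heq ▸ p.2)
      simp [jacobian, hne]
  · rw [Finset.sum_eq_single a.1 (fun m _ hm ↦ by simp [jacobian, hm]) (by simp)]
    simp [jacobian, fadings, Matrix.mulVec, dotProduct, Finset.mul_sum, mul_assoc]

lemma continuous_jacobian (X : Fin L → ℂ) : Continuous (jacobian (R := R) A P X) := by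
  refine continuous_matrix fun a b ↦ ?_
  rcases b with p | q
  all_goals
    simp only [jacobian, Matrix.of_apply, Sum.elim_inl, Sum.elim_inr, Matrix.mulVec, dotProduct]
    split_ifs <;> fun_prop

end Jacobian

section Injectivity

variable {m n : Type*} [Finite m] [Fintype n]

lemma isOpen_setOf_injective_mulVec :
    IsOpen {M : Matrix m n ℂ | Function.Injective M.mulVec} := by
  have := Fintype.ofFinite m
  have hcont : Continuous fun M : Matrix m n ℂ ↦ LinearMap.toContinuousLinearMap M.mulVecLin :=
    continuous_clm_apply.2 fun x ↦ continuous_id.matrix_mulVec continuous_const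
  exact ContinuousLinearMap.isOpen_injective.preimage hcont

lemma exists_submatrix_det_ne_zero [DecidableEq n] (M : Matrix m n ℂ)
    (hM : Function.Injective M.mulVec) : ∃ σ : n → m, (M.submatrix σ id).det ≠ 0 := by
  have := Fintype.ofFinite m
  have hspan : Submodule.span ℂ (Set.range M.row) = ⊤ := by
    refine Submodule.eq_top_of_finrank_eq ?_
    rw [← Matrix.rank_eq_finrank_span_row, Matrix.rank,
      LinearMap.finrank_range_of_inj (f := M.mulVecLin) hM]
  obtain ⟨κ, a, -, hspan', hli⟩ := exists_linearIndependent' ℂ M.row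
  let e : κ ≃ n := (Module.Basis.mk hli (hspan'.trans hspan).ge).indexEquiv (Pi.basisFun ℂ n)
  have hrows : LinearIndependent ℂ (M.submatrix (a ∘ e.symm) id).row :=
    hli.comp e.symm e.symm.injective
  exact ⟨a ∘ e.symm, ((Matrix.isUnit_iff_isUnit_det _).1
    (Matrix.linearIndependent_rows_iff_isUnit.1 hrows)).ne_zero⟩

end Injectivity

section Identifiability

variable {L Q R : ℕ} {A : Matrix (Fin L) (Fin Q) ℂ} {K P : Finset (Fin L)}
  {s : Fin R → Fin Q → ℂ}

/-- The noiseless channel, linearized at the all-ones input and the fading `s`, is injective on the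
input perturbations `δ` supported on `P` and the fading perturbations `t`, even when only the
outputs with index in `K` are observed. -/
def IsIdentifiable (A : Matrix (Fin L) (Fin Q) ℂ) (K P : Finset (Fin L))
    (s : Fin R → Fin Q → ℂ) : Prop :=
  ∀ (δ : Fin L → ℂ) (t : Fin R → Fin Q → ℂ), (∀ i ∉ P, δ i = 0) →
    (∀ m, ∀ i ∈ K, δ i * (A *ᵥ s m) i + (A *ᵥ t m) i = 0) → δ = 0 ∧ t = 0

lemma isIdentifiable_iff_injective_mulVec : IsIdentifiable A K P s ↔ Function.Injective
    ((jacobian A P 1 s).submatrix ((↑) : {a : Fin R × Fin L // a.2 ∈ K} → _) id).mulVec := by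
  rw [← Matrix.coe_mulVecLin, ← LinearMap.ker_eq_bot, LinearMap.ker_eq_bot']
  have hmulVec (z : Unknown P R Q → ℂ) (a : {a : Fin R × Fin L // a.2 ∈ K}) :
      ((jacobian A P 1 s).submatrix ((↑) : {a : Fin R × Fin L // a.2 ∈ K} → _) id *ᵥ z) a =
        (jacobian A P 1 s *ᵥ z) a := rfl
  refine ⟨fun h z hz ↦ ?_, fun h δ t hδ hδt ↦ ?_⟩
  · obtain ⟨hinputs, hfadings⟩ := h (fun i ↦ if hi : i ∈ P then freeInputs P z ⟨i, hi⟩ else 0)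
      (fadings P z) (fun i hi ↦ by simp [hi]) fun m i hi ↦ by
        simpa [hmulVec, jacobian_mulVec] using congrFun hz ⟨(m, i), hi⟩
    funext b
    rcases b with p | q
    · simpa [freeInputs] using congrFun hinputs p
    · exact congrFun (congrFun hfadings q.1) q.2
  · have hδP (i : Fin L) : (if i ∈ P then δ i else 0) = δ i := by
      split_ifs with hi
      exacts [rfl, (hδ i hi).symm]
    let z : Unknown P R Q → ℂ := Sum.elim (fun p ↦ δ p) fun q ↦ t q.1 q.2
    have hfadings : fadings P z = t := rfl
    have hz := h z <| funext fun a ↦ by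
      simpa [hmulVec, jacobian_mulVec, hfadings, freeInputs, z, hδP] using hδt a.1.1 a.1.2 a.2
    refine ⟨funext fun i ↦ ?_, funext fun m ↦ funext fun j ↦ congrFun hz (Sum.inr (m, j))⟩
    by_cases hi : i ∈ P
    exacts [congrFun hz (Sum.inl ⟨i, hi⟩), hδ i hi]

lemma isOpen_setOf_isIdentifiable (A : Matrix (Fin L) (Fin Q) ℂ) (K P : Finset (Fin L)) (R : ℕ) :
    IsOpen {s : Fin R → Fin Q → ℂ | IsIdentifiable A K P s} := by
  simp_rw [isIdentifiable_iff_injective_mulVec]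
  exact isOpen_setOf_injective_mulVec.preimage
    ((continuous_jacobian A P 1).matrix_submatrix _ id)

/- All `R` fading vectors force `δ` to be constant on sets of size `K.card - Q + 1`, which can be
chosen to share an index and otherwise to overlap as little as possible. -/
lemma InGeneralPosition.exists_isIdentifiable (hK : InGeneralPosition A K) (hQ : 1 ≤ Q)
    (hQK : Q ≤ K.card) (R : ℕ) :
    ∃ P ⊆ K, ∃ s : Fin R → Fin Q → ℂ, P.card = min (K.card - 1) (R * (K.card - Q)) ∧
      IsIdentifiable A K P s := by
  obtain ⟨i₀, hi₀⟩ : K.Nonempty := Finset.card_pos.1 (by omega)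
  obtain ⟨T, hT, hcard⟩ := exists_windows hi₀ (d := K.card - Q) (by omega) R
  have hfading (m : Fin R) := hK.exists_fading_eq (hT m).1 (hT m).2.1 (by
    rw [Finset.card_sdiff_of_subset (hT m).1, (hT m).2.2]
    omega)
  choose s hs using hfading
  obtain ⟨P, hPT, hP⟩ := Finset.exists_subset_card_eq
    (s := (insert i₀ (Finset.univ.biUnion T)).erase i₀)
    (n := min (K.card - 1) (R * (K.card - Q)))
    (by rw [Finset.card_erase_of_mem (Finset.mem_insert_self _ _)]; omega)
  have hi₀P : i₀ ∉ P := fun h ↦ Finset.notMem_erase i₀ _ (hPT h)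
  have hPT' (i) (hi : i ∈ P) : ∃ m, i ∈ T m := by
    obtain ⟨hne, hmem⟩ := Finset.mem_erase.1 (hPT hi)
    simpa using (Finset.mem_insert.1 hmem).resolve_left hne
  refine ⟨P, fun i hi ↦ ?_, s, hP, fun δ t hδ h ↦ ?_⟩
  · obtain ⟨m, hm⟩ := hPT' i hi
    exact (hT m).1 hm
  have hδ0 : δ = 0 := by
    funext i
    by_cases hi : i ∈ P
    · obtain ⟨m, hm⟩ := hPT' i hi
      rw [hs m δ (t m) (h m) i hm, hδ i₀ hi₀P, Pi.zero_apply]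
    · exact hδ i hi
  refine ⟨hδ0, funext fun m ↦ hK.eq_zero_of_mulVec_eq_zero hQK fun i hi ↦ ?_⟩
  simpa [hδ0] using h m i hi

lemma IsIdentifiable.union_compl (h : IsIdentifiable A K P s) {m : Fin R}
    (hs : ∀ i, (A *ᵥ s m) i ≠ 0) :
    IsIdentifiable A Finset.univ (P ∪ Kᶜ) s := by
  intro δ t hδ hδt
  obtain ⟨-, rfl⟩ := h (fun i ↦ if i ∈ K then δ i else 0) t
    (fun i hi ↦ by
      by_cases hiK : i ∈ K
      · simpa [hiK] using hδ i (by simp [hi, hiK])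
      · simp [hiK])
    fun m i hi ↦ by simpa [hi] using hδt m i (Finset.mem_univ i)
  refine ⟨funext fun i ↦ ?_, rfl⟩
  simpa [hs i] using hδt m i (Finset.mem_univ i)

lemma dense_setOf_forall_apply_ne_zero {ι E : Type*} [Finite ι] [NormedAddCommGroup E]
    [NormedSpace ℂ E] [FiniteDimensional ℂ E] (f : ι → E →ₗ[ℂ] ℂ) (hf : ∀ i, f i ≠ 0) :
    Dense {x | ∀ i, f i x ≠ 0} := by
  have : CompleteSpace E := FiniteDimensional.complete ℂ E
  rw [Set.ofPred_forall]
  refine dense_iInter_of_isOpen (fun i ↦ ?_) fun i ↦ ?_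
  · exact isOpen_ne_fun (f i).continuous_of_finiteDimensional continuous_const
  · have hker : interior (LinearMap.ker (f i) : Set E) = ∅ := by
      by_contra h
      exact hf i (LinearMap.ker_eq_top.1 (Submodule.eq_top_of_nonempty_interior' _
        (Set.nonempty_iff_ne_empty.2 h)))
    exact interior_eq_empty_iff_dense_compl.1 hker

theorem InGeneralPosition.exists_isIdentifiable_univ (hK : InGeneralPosition A K)
    (hrow : ∀ i, A.row i ≠ 0) (hQ : 1 ≤ Q) (hQK : Q ≤ K.card) (hR : 0 < R) :
    ∃ (P : Finset (Fin L)) (s : Fin R → Fin Q → ℂ),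
      P.card = min (K.card - 1) (R * (K.card - Q)) + (L - K.card) ∧
        IsIdentifiable A Finset.univ P s := by
  obtain ⟨P, hPK, s₀, hP, hs₀⟩ := hK.exists_isIdentifiable hQ hQK R
  have hdense : Dense {s : Fin R → Fin Q → ℂ | ∀ i, (A *ᵥ s ⟨0, hR⟩) i ≠ 0} :=
    dense_setOf_forall_apply_ne_zero (fun i ↦
      LinearMap.proj i ∘ₗ A.mulVecLin ∘ₗ LinearMap.proj (φ := fun _ : Fin R ↦ Fin Q → ℂ) ⟨0, hR⟩)
      fun i h ↦ hrow i <| funext fun j ↦ by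
        simpa using LinearMap.congr_fun h fun _ ↦ Pi.single j 1
  obtain ⟨s, hs, hs'⟩ := hdense.inter_open_nonempty _ (isOpen_setOf_isIdentifiable A K P R)
    ⟨s₀, hs₀⟩
  refine ⟨P ∪ Kᶜ, s, ?_, IsIdentifiable.union_compl hs hs'⟩
  rw [Finset.card_union_of_disjoint (disjoint_compl_right.mono_left hPK), hP,
    Finset.card_compl, Fintype.card_fin]

end Identifiability

section ComplexLinear

variable {E : Type*} [NormedAddCommGroup E] [NormedSpace ℝ E] [NormedSpace ℂ E]
  [IsScalarTower ℝ ℂ E]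

lemma det_restrictScalars_eq_sq_norm (f : E →ₗ[ℂ] E) :
    LinearMap.det (f.restrictScalars ℝ) = ‖LinearMap.det f‖ ^ 2 := by
  rw [LinearMap.det_restrictScalars, Algebra.norm_complex_apply, Complex.sq_norm]

lemma lintegral_comp_complex_smul [FiniteDimensional ℝ E] [MeasurableSpace E]
    [BorelSpace E] (μ : Measure E) [μ.IsAddHaarMeasure] {c : ℂ} (hc : c ≠ 0) {g : E → ℝ≥0∞}
    (hg : Measurable g) :
    ∫⁻ w, g (c • w) ∂μ =
      ENNReal.ofReal ((‖c‖ ^ 2) ^ Module.finrank ℂ E)⁻¹ * ∫⁻ w, g w ∂μ := by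
  have : FiniteDimensional ℂ E := FiniteDimensional.right ℝ ℂ E
  let f : E →ₗ[ℂ] E := c • LinearMap.id
  have hdet : LinearMap.det (f.restrictScalars ℝ) = (‖c‖ ^ 2) ^ Module.finrank ℂ E := by
    rw [det_restrictScalars_eq_sq_norm, LinearMap.det_smul, LinearMap.det_id, mul_one, norm_pow,
      pow_right_comm]
  have hdet0 : LinearMap.det (f.restrictScalars ℝ) ≠ 0 := by
    rw [hdet]
    positivity
  calc ∫⁻ w, g (c • w) ∂μ = ∫⁻ w, g w ∂(μ.map (f.restrictScalars ℝ)) :=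
        (lintegral_map hg
          (f.restrictScalars ℝ).continuous_of_finiteDimensional.measurable).symm
    _ = ENNReal.ofReal ((‖c‖ ^ 2) ^ Module.finrank ℂ E)⁻¹ * ∫⁻ w, g w ∂μ := by
        rw [Measure.map_linearMap_addHaar_eq_smul_addHaar μ hdet0, lintegral_smul_measure, hdet,
          abs_of_nonneg (by positivity), smul_eq_mul]

lemma lintegral_exp_neg_sq_norm :
    ∫⁻ z : ℂ, ENNReal.ofReal (Real.exp (-‖z‖ ^ 2)) = ENNReal.ofReal Real.pi := by
  have hπ : ENNReal.ofReal Real.pi ≠ 0 := (ENNReal.ofReal_pos.2 Real.pi_pos).ne'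
  have hmass : (ENNReal.ofReal Real.pi)⁻¹ *
      ∫⁻ z : ℂ, ENNReal.ofReal (Real.exp (-‖z‖ ^ 2)) = 1 := by
    rw [← lintegral_const_mul _ (by fun_prop), ← ENNReal.ofReal_inv_of_pos Real.pi_pos,
      ← measure_univ (μ := complexGaussian), complexGaussian_eq_withDensity,
      withDensity_apply _ MeasurableSet.univ, Measure.restrict_univ]
    simp_rw [ENNReal.ofReal_mul (inv_nonneg.2 Real.pi_pos.le)]
  rw [← mul_one (ENNReal.ofReal Real.pi), ← hmass,
    ENNReal.mul_inv_cancel_left hπ ENNReal.ofReal_ne_top]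

lemma lintegral_exp_neg_sq_norm_sub_mul (y : ℂ) {β : ℂ} (hβ : β ≠ 0) :
    ∫⁻ z : ℂ, ENNReal.ofReal (Real.exp (-‖y - β * z‖ ^ 2)) =
      ENNReal.ofReal (Real.pi / ‖β‖ ^ 2) := by
  have hscale := lintegral_comp_complex_smul (volume : Measure ℂ) hβ
    (g := fun w ↦ ENNReal.ofReal (Real.exp (-‖y - w‖ ^ 2))) (by fun_prop)
  simp only [smul_eq_mul, Module.finrank_self, pow_one] at hscale
  rw [hscale, lintegral_sub_left_eq_self (fun w : ℂ ↦ ENNReal.ofReal (Real.exp (-‖w‖ ^ 2))) y,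
    lintegral_exp_neg_sq_norm, ← ENNReal.ofReal_mul (by positivity), inv_mul_eq_div]

end ComplexLinear

section PolynomialDeterminant

variable {S p q : Type*} [CommRing S] [Fintype p] [Fintype q] [DecidableEq p] [DecidableEq q]

/- Multiplying the columns in `q` by `X` turns the matrix into a pencil `X • M + B`. -/
lemma exists_polynomial_eval_eq_det (M : Matrix (p ⊕ q) (p ⊕ q) S) (B : Matrix (p ⊕ q) p S) :
    ∃ f : Polynomial S, f.natDegree ≤ Fintype.card p ∧ f.coeff (Fintype.card p) = M.det ∧
      ∀ τ, f.eval τ = (Matrix.of fun a ↦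
        Sum.elim (fun b ↦ B a b + M a (Sum.inl b) * τ) fun b ↦ M a (Sum.inr b)).det := by
  let N : Matrix (p ⊕ q) (p ⊕ q) (Polynomial S) := Matrix.of fun a ↦
    Sum.elim (fun b ↦ .C (B a b) + .C (M a (Sum.inl b)) * .X) fun b ↦ .C (M a (Sum.inr b))
  let B₀ : Matrix (p ⊕ q) (p ⊕ q) S := Matrix.of fun a ↦ Sum.elim (B a) 0
  have hpencil : N.det * .X ^ Fintype.card q =
      ((Polynomial.X : Polynomial S) • M.map Polynomial.C + B₀.map Polynomial.C).det := by
    have hcols := Matrix.det_mul_row (Sum.elim (fun _ ↦ 1) fun _ ↦ .X) N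
    rw [Fintype.prod_sum_type] at hcols
    simp only [Sum.elim_inl, Sum.elim_inr, Finset.prod_const_one, Finset.prod_const, one_mul,
      Finset.card_univ] at hcols
    rw [mul_comm, ← hcols]
    congr 1
    ext1 a b
    rcases b with b | b <;> simp [N, B₀, add_comm, Polynomial.X_mul_C]
  have hcoeff (n : ℕ) : N.det.coeff n =
      ((Polynomial.X : Polynomial S) • M.map Polynomial.C + B₀.map Polynomial.C).det.coeff
        (n + Fintype.card q) := by
    rw [← hpencil, Polynomial.coeff_mul_X_pow]
  refine ⟨N.det, Polynomial.natDegree_le_iff_coeff_eq_zero.2 fun n hn ↦ ?_, ?_, fun τ ↦ ?_⟩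
  · rw [hcoeff]
    refine Polynomial.coeff_eq_zero_of_natDegree_lt
      ((Polynomial.natDegree_det_X_add_C_le M B₀).trans_lt ?_)
    rw [Fintype.card_sum]
    omega
  · rw [hcoeff, ← Fintype.card_sum, Polynomial.coeff_det_X_add_C_card]
  · rw [← Polynomial.coe_evalRingHom, RingHom.map_det]
    congr 1
    ext a b
    rcases b with b | b <;> simp [N]

end PolynomialDeterminant

section SquareJacobian

variable {L Q R : ℕ} (A : Matrix (Fin L) (Fin Q) ℂ) (P : Finset (Fin L))
  (σ : Unknown P R Q → Fin R × Fin L)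

/-- The input whose entries with index in `P` are `x` and whose remaining entries are pilots equal
to one. -/
def pilotInput (x : P → ℂ) : Fin L → ℂ := fun i ↦ if h : i ∈ P then x ⟨i, h⟩ else 1

/-- The Jacobian matrix of the square subsystem that consists of the outputs selected by `σ`. -/
def squareJacobian (X : Fin L → ℂ) (s : Fin R → Fin Q → ℂ) :
    Matrix (Unknown P R Q) (Unknown P R Q) ℂ :=
  (jacobian A P X s).submatrix σ id

variable {A P} in
lemma IsIdentifiable.exists_det_squareJacobian_ne_zero {s : Fin R → Fin Q → ℂ}
    (h : IsIdentifiable A Finset.univ P s) :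
    ∃ σ : Unknown P R Q → Fin R × Fin L, (squareJacobian A P σ 1 s).det ≠ 0 := by
  obtain ⟨σ, hσ⟩ := exists_submatrix_det_ne_zero _ (isIdentifiable_iff_injective_mulVec.1 h)
  exact ⟨fun b ↦ σ b, hσ⟩

lemma prod_mul_det_squareJacobian (s : Fin R → Fin Q → ℂ) (x : P → ℂ) :
    (∏ b, pilotInput P x (σ b).2) * (squareJacobian A P σ 1 s).det =
      (∏ p, x p) * (squareJacobian A P σ (pilotInput P x) s).det := by
  have hcol : ∏ p, x p = ∏ b : Unknown P R Q, Sum.elim x (fun _ ↦ 1) b := by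
    simp [Fintype.prod_sum_type]
  rw [hcol, ← Matrix.det_mul_column (fun b ↦ pilotInput P x (σ b).2), ← Matrix.det_mul_row]
  congr 1
  ext a b
  rcases b with p | q
  · by_cases h : (σ a).2 = p <;> simp [squareJacobian, jacobian, pilotInput, h]
  · simp [squareJacobian, jacobian]

lemma norm_det_squareJacobian_le (s : Fin R → Fin Q → ℂ) {x : P → ℂ}
    (hx : ∀ p, 2⁻¹ ≤ ‖x p‖ ∧ ‖x p‖ ≤ 1) :
    ‖(squareJacobian A P σ 1 s).det‖ ≤ 2 ^ Fintype.card (Unknown P R Q) *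
      ‖(squareJacobian A P σ (pilotInput P x) s).det‖ := by
  have hpilot (i : Fin L) : (2⁻¹ : ℝ) ≤ ‖pilotInput P x i‖ := by
    rw [pilotInput]
    split_ifs with h
    exacts [(hx ⟨i, h⟩).1, by norm_num]
  have hrow : (2⁻¹ : ℝ) ^ Fintype.card (Unknown P R Q) ≤
      ‖∏ b, pilotInput P x (σ b).2‖ := by
    rw [norm_prod, ← Finset.card_univ, ← Finset.prod_const]
    exact Finset.prod_le_prod (fun _ _ ↦ by norm_num) fun b _ ↦ hpilot _
  have hcol : ‖∏ p, x p‖ ≤ 1 := by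
    rw [norm_prod]
    exact Finset.prod_le_one (fun _ _ ↦ norm_nonneg _) fun p _ ↦ (hx p).2
  rw [← inv_mul_le_iff₀ (by positivity), ← inv_pow]
  calc (2⁻¹ : ℝ) ^ Fintype.card (Unknown P R Q) * ‖(squareJacobian A P σ 1 s).det‖
      ≤ ‖∏ b, pilotInput P x (σ b).2‖ * ‖(squareJacobian A P σ 1 s).det‖ := by gcongr
    _ = ‖∏ p, x p‖ * ‖(squareJacobian A P σ (pilotInput P x) s).det‖ := by
        rw [← norm_mul, prod_mul_det_squareJacobian, norm_mul]
    _ ≤ ‖(squareJacobian A P σ (pilotInput P x) s).det‖ :=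
        mul_le_of_le_one_left (norm_nonneg _) hcol

lemma measurable_det_squareJacobian_one :
    Measurable fun s : Fin R → Fin Q → ℂ ↦ (squareJacobian A P σ 1 s).det :=
  ((continuous_jacobian A P 1).matrix_submatrix σ id).matrix_det.measurable

lemma isPolynomialAlong_det_squareJacobian (s₀ : Fin R → Fin Q → ℂ) :
    IsPolynomialAlong (fun s ↦ (squareJacobian A P σ 1 s).det) s₀ P.card
      (squareJacobian A P σ 1 s₀).det := by
  intro s
  obtain ⟨f, hdeg, hcoeff, heval⟩ := exists_polynomial_eval_eq_det (squareJacobian A P σ 1 s₀)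
    (Matrix.of fun a p ↦ squareJacobian A P σ 1 s a (Sum.inl p))
  rw [Fintype.card_coe] at hdeg hcoeff
  refine ⟨f, hdeg, hcoeff, fun τ ↦ ?_⟩
  rw [heval]
  congr 1
  ext a b
  rcases b with p | q
  · by_cases h : (σ a).2 = p <;>
      simp [squareJacobian, jacobian, h, Matrix.mulVec_add, Matrix.mulVec_smul, mul_comm τ]
  · simp [squareJacobian, jacobian]

/-- The square subsystem of the noiseless channel: the outputs selected by `σ`, as functions of the
unknowns. -/
def observe (z : Unknown P R Q → ℂ) : Unknown P R Q → ℂ :=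
  fun b ↦ pilotInput P (freeInputs P z) (σ b).2 * (A *ᵥ fadings P z (σ b).1) (σ b).2

lemma hasFDerivAt_pilotInput_freeInputs (z : Unknown P R Q → ℂ) (i : Fin L) :
    HasFDerivAt (fun z : Unknown P R Q → ℂ ↦ pilotInput P (freeInputs P z) i)
      (if h : i ∈ P then
        ContinuousLinearMap.proj (R := ℂ) (φ := fun _ : Unknown P R Q ↦ ℂ) (Sum.inl ⟨i, h⟩)
      else 0) z := by
  by_cases h : i ∈ P
  · simpa only [pilotInput, h, dite_true] using! hasFDerivAt_apply (𝕜 := ℂ) _ z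
  · simpa only [pilotInput, h, dite_false] using hasFDerivAt_const 1 z

lemma hasFDerivAt_observe (z : Unknown P R Q → ℂ) :
    HasFDerivAt (observe A P σ) (LinearMap.toContinuousLinearMap (Matrix.toLin'
      (squareJacobian A P σ (pilotInput P (freeInputs P z)) (fadings P z)))) z := by
  rw [hasFDerivAt_pi']
  intro b
  have hgain : HasFDerivAt (fun z : Unknown P R Q → ℂ ↦ (A *ᵥ fadings P z (σ b).1) (σ b).2)
      (∑ j, A (σ b).2 j • ContinuousLinearMap.proj (R := ℂ)
        (φ := fun _ : Unknown P R Q ↦ ℂ) (Sum.inr ((σ b).1, j))) z :=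
    HasFDerivAt.fun_sum (u := Finset.univ) fun j _ ↦
      (hasFDerivAt_apply (𝕜 := ℂ) (Sum.inr ((σ b).1, j)) z).const_mul _
  refine ((hasFDerivAt_pilotInput_freeInputs P z (σ b).2).mul hgain).congr_fderiv ?_
  ext v
  trans (jacobian A P (pilotInput P (freeInputs P z)) (fadings P z) *ᵥ v) (σ b)
  · rw [jacobian_mulVec]
    by_cases h : (σ b).2 ∈ P <;>
      simp [h, freeInputs, fadings, Matrix.mulVec, dotProduct, add_comm, mul_comm]
  · rfl

/-- The unknowns with nonzero inputs at which the square subsystem has an invertible Jacobian. -/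
def regularPoints : Set (Unknown P R Q → ℂ) :=
  {z | (∀ p, freeInputs P z p ≠ 0) ∧
    (squareJacobian A P σ (pilotInput P (freeInputs P z)) (fadings P z)).det ≠ 0}

lemma measurableSet_regularPoints : MeasurableSet (regularPoints A P σ) := by
  have hcont : Continuous fun z : Unknown P R Q → ℂ ↦
      (squareJacobian A P σ (pilotInput P (freeInputs P z)) (fadings P z)).det := by
    refine Continuous.matrix_det (continuous_matrix fun a b ↦ ?_)
    rcases b with p | q
    all_goals
      simp only [squareJacobian, Matrix.submatrix_apply, jacobian, Matrix.of_apply, id_eq,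
        Sum.elim_inl, Sum.elim_inr, Matrix.mulVec, dotProduct, fadings, pilotInput, freeInputs]
      split_ifs <;> fun_prop
  refine (IsOpen.and ?_ (isOpen_ne_fun hcont continuous_const)).measurableSet
  simp only [Set.ofPred_forall, freeInputs]
  exact isOpen_iInter_of_finite fun p ↦ isOpen_ne_fun (by fun_prop) (by fun_prop)

/- Dividing an equation by `x_i` makes it linear in `x_i⁻¹` and `s`. The difference of two solutions
in these coordinates is rescaled so that it lies in the kernel of the Jacobian at `z`. -/
lemma squareJacobian_mulVec_eq_zero {z z' : Unknown P R Q → ℂ} (hz : ∀ p, freeInputs P z p ≠ 0)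
    (hz' : ∀ p, freeInputs P z' p ≠ 0) (h : observe A P σ z = observe A P σ z') :
    squareJacobian A P σ (pilotInput P (freeInputs P z)) (fadings P z) *ᵥ
      Sum.elim (fun p ↦ freeInputs P z p ^ 2 * ((freeInputs P z p)⁻¹ - (freeInputs P z' p)⁻¹))
        (fun q ↦ fadings P z' q.1 q.2 - fadings P z q.1 q.2) = 0 := by
  set d : Unknown P R Q → ℂ := _
  change squareJacobian A P σ (pilotInput P (freeInputs P z)) (fadings P z) *ᵥ d = 0
  have hd : fadings P d = fadings P z' - fadings P z := rfl
  funext b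
  change (jacobian A P (pilotInput P (freeInputs P z)) (fadings P z) *ᵥ d) (σ b) = 0
  rw [jacobian_mulVec, hd, Pi.sub_apply, Matrix.mulVec_sub, Pi.sub_apply]
  have hb := congrFun h b
  simp only [observe] at hb
  by_cases hi : (σ b).2 ∈ P
  · have hx := hz ⟨_, hi⟩
    have hx' := hz' ⟨_, hi⟩
    have hdi : freeInputs P d ⟨_, hi⟩ = freeInputs P z ⟨_, hi⟩ ^ 2 *
      ((freeInputs P z ⟨_, hi⟩)⁻¹ - (freeInputs P z' ⟨_, hi⟩)⁻¹) := rfl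
    simp only [pilotInput, hi, dite_true] at hb ⊢
    rw [hdi]
    field_simp
    linear_combination -freeInputs P z ⟨_, hi⟩ * hb
  · simp only [pilotInput, hi, dite_false] at hb ⊢
    linear_combination -hb

lemma injOn_observe : Set.InjOn (observe A P σ) (regularPoints A P σ) := by
  intro z hz z' hz' h
  have hunit : IsUnit (squareJacobian A P σ (pilotInput P (freeInputs P z)) (fadings P z)) :=
    (Matrix.isUnit_iff_isUnit_det _).2 hz.2.isUnit
  have hzero := Matrix.mulVec_injective_iff_isUnit.2 hunit
    ((squareJacobian_mulVec_eq_zero A P σ hz.1 hz'.1 h).trans (Matrix.mulVec_zero _).symm)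
  funext b
  rcases b with p | q
  · have hp := congrFun hzero (Sum.inl p)
    exact inv_injective (sub_eq_zero.1
      ((mul_eq_zero.1 hp).resolve_left (pow_ne_zero 2 (hz.1 p))))
  · exact (sub_eq_zero.1 (congrFun hzero (Sum.inr q))).symm

theorem setLIntegral_regularPoints_le (g : (Unknown P R Q → ℂ) → ℝ≥0∞) :
    ∫⁻ z in regularPoints A P σ, ENNReal.ofReal (‖(squareJacobian A P σ
      (pilotInput P (freeInputs P z)) (fadings P z)).det‖ ^ 2) * g (observe A P σ z) ≤
        ∫⁻ w, g w := by
  have hchange := lintegral_image_eq_lintegral_abs_det_fderiv_mul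
    (volume : Measure (Unknown P R Q → ℂ)) (measurableSet_regularPoints A P σ)
    (fun z _ ↦ ((hasFDerivAt_observe A P σ z).restrictScalars ℝ).hasFDerivWithinAt)
    (injOn_observe A P σ) g
  refine (lintegral_congr fun z ↦ ?_).trans_le
    (hchange.symm.trans_le (setLIntegral_le_lintegral _ _))
  have hdet := det_restrictScalars_eq_sq_norm (Matrix.toLin'
    (squareJacobian A P σ (pilotInput P (freeInputs P z)) (fadings P z)))
  rw [LinearMap.det_toLin'] at hdet
  rw [← abs_of_nonneg (sq_nonneg ‖_‖), ← hdet]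
  rfl

end SquareJacobian

section UniformInputs

lemma lintegral_cond {α : Type*} [MeasurableSpace α] (μ : Measure α) (S : Set α) (g : α → ℝ≥0∞) :
    ∫⁻ z, g z ∂μ[|S] = (μ S)⁻¹ * ∫⁻ z in S, g z ∂μ := by
  rw [ProbabilityTheory.cond, lintegral_smul_measure, smul_eq_mul]

/-- The closed annulus in which the random input entries are uniformly distributed. -/
def annulus : Set ℂ := {z | 2⁻¹ ≤ ‖z‖ ∧ ‖z‖ ≤ 1}

lemma measurableSet_annulus : MeasurableSet annulus :=
  ((isClosed_le continuous_const continuous_norm).and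
    (isClosed_le continuous_norm continuous_const)).measurableSet

lemma volume_annulus_ne_top : volume annulus ≠ ∞ :=
  ne_top_of_le_ne_top (isCompact_closedBall (0 : ℂ) 1).measure_lt_top.ne
    (measure_mono fun z hz ↦ by simpa using hz.2)

lemma volume_annulus_ne_zero : volume annulus ≠ 0 := by
  have hball : Metric.ball (3 / 4 : ℂ) (1 / 4) ⊆ annulus := by
    intro z hz
    rw [Metric.mem_ball, dist_eq_norm] at hz
    have hcenter : ‖(3 / 4 : ℂ)‖ = 3 / 4 := by norm_num
    have hle := norm_sub_norm_le z (3 / 4)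
    have hge := norm_sub_norm_le (3 / 4) z
    rw [norm_sub_rev] at hge
    constructor <;> linarith
  exact ((Metric.measure_ball_pos volume _ (by norm_num)).trans_le (measure_mono hball)).ne'

variable {L Q R : ℕ} (P : Finset (Fin L))

/-- The set of admitted values of the free inputs. -/
def freeRegion : Set (P → ℂ) := Set.univ.pi fun _ ↦ annulus

lemma measurableSet_freeRegion : MeasurableSet (freeRegion P) :=
  MeasurableSet.univ_pi fun _ ↦ measurableSet_annulus

lemma volume_freeRegion : volume (freeRegion P) = volume annulus ^ P.card := by
  simp [freeRegion, volume_pi, Measure.pi_pi]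

lemma volume_freeRegion_ne_zero : volume (freeRegion P) ≠ 0 := by
  rw [volume_freeRegion]
  exact pow_ne_zero _ volume_annulus_ne_zero

lemma volume_freeRegion_ne_top : volume (freeRegion P) ≠ ∞ := by
  rw [volume_freeRegion]
  exact ENNReal.pow_ne_top volume_annulus_ne_top

@[fun_prop]
lemma measurable_pilotInput : Measurable (pilotInput P) := by
  refine measurable_pi_lambda _ fun i ↦ ?_
  unfold pilotInput
  split_ifs <;> fun_prop

/-- The input law of the lower bound: the entries with index in `P` are independent and uniform on
the annulus, the remaining entries are pilots. -/
def inputLaw : Measure (Fin L → ℂ) := (cond volume (freeRegion P)).map (pilotInput P)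

instance : IsProbabilityMeasure (inputLaw P) := by
  have := cond_isProbabilityMeasure_of_finite (volume_freeRegion_ne_zero P)
    (volume_freeRegion_ne_top P)
  exact Measure.isProbabilityMeasure_map (measurable_pilotInput P).aemeasurable

lemma ae_inputLaw_norm_le_one : ∀ᵐ x ∂inputLaw P, ‖x‖ ≤ 1 := by
  rw [inputLaw, ae_map_iff (measurable_pilotInput P).aemeasurable
    (measurableSet_le measurable_norm measurable_const)]
  filter_upwards [ae_cond_mem (measurableSet_freeRegion P)] with x hx
  refine (pi_norm_le_iff_of_nonneg zero_le_one).2 fun i ↦ ?_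
  rw [pilotInput]
  split_ifs with hi
  exacts [(hx ⟨i, hi⟩ trivial).2, norm_one.le]

lemma inputLaw_mem_admissibleInputs : inputLaw P ∈ admissibleInputs L := by
  refine ⟨inferInstance, ?_⟩
  calc ∫⁻ x, ∑ i, ‖x i‖ₑ ^ 2 ∂inputLaw P ≤ ∫⁻ _, (L : ℝ≥0∞) ∂inputLaw P := by
        refine lintegral_mono_ae ?_
        filter_upwards [ae_inputLaw_norm_le_one P] with x hx
        calc ∑ i, ‖x i‖ₑ ^ 2 ≤ ∑ _i : Fin L, (1 : ℝ≥0∞) := by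
              gcongr with i
              refine pow_le_one₀ zero_le ?_
              rw [← ofReal_norm, ← ENNReal.ofReal_one]
              exact ENNReal.ofReal_le_ofReal ((norm_le_pi_norm x i).trans hx)
          _ = L := by simp
    _ = L := by simp

/-- The free inputs and the fadings of a vector of unknowns. -/
def splitUnknowns (z : Unknown P R Q → ℂ) : (P → ℂ) × (Fin R → Fin Q → ℂ) :=
  (freeInputs P z, fadings P z)

@[fun_prop]
lemma measurable_splitUnknowns : Measurable (splitUnknowns (R := R) (Q := Q) P) := by
  unfold splitUnknowns freeInputs fadings; fun_prop

lemma exists_volume_eq_smul_map_splitUnknowns :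
    ∃ κ : ℝ≥0, (volume : Measure ((P → ℂ) × (Fin R → Fin Q → ℂ))) =
      κ • volume.map (splitUnknowns P) := by
  let e : (Unknown P R Q → ℂ) ≃ₗ[ℝ] (P → ℂ) × (Fin R → Fin Q → ℂ) :=
    { toFun := splitUnknowns P
      invFun := fun p ↦ Sum.elim p.1 fun q ↦ p.2 q.1 q.2
      map_add' := fun _ _ ↦ rfl
      map_smul' := fun _ _ ↦ rfl
      left_inv := fun z ↦ by ext (b | b) <;> rfl
      right_inv := fun p ↦ rfl }
  have : (volume.map (splitUnknowns (R := R) (Q := Q) P)).IsAddHaarMeasure :=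
    e.toContinuousLinearEquiv.isAddHaarMeasure_map volume
  have : (volume : Measure ((P → ℂ) × (Fin R → Fin Q → ℂ))).IsAddHaarMeasure :=
    Measure.prod.instIsAddHaarMeasure _ _
  exact ⟨_, Measure.isAddLeftInvariant_eq_smul _ _⟩

lemma exists_lintegral_inputLaw :
    ∃ κ : ℝ≥0, ∀ h : (Fin L → ℂ) → (Fin R → Fin Q → ℂ) → ℝ≥0∞, Measurable (Function.uncurry h) →
      ∫⁻ x, ∫⁻ s, h x s ∂volume ∂inputLaw P = κ * ∫⁻ z in freeInputs P ⁻¹' freeRegion P,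
        h (pilotInput P (freeInputs P z)) (fadings P z) := by
  obtain ⟨κ, hκ⟩ := exists_volume_eq_smul_map_splitUnknowns (R := R) (Q := Q) P
  have hV : (volume (freeRegion P))⁻¹ ≠ ∞ := ENNReal.inv_ne_top.2 (volume_freeRegion_ne_zero P)
  refine ⟨(volume (freeRegion P))⁻¹.toNNReal * κ, fun h hh ↦ ?_⟩
  have hint : Measurable fun x ↦ ∫⁻ s, h x s := hh.lintegral_prod_right'
  have hpilot : Measurable fun p : (P → ℂ) × (Fin R → Fin Q → ℂ) ↦ h (pilotInput P p.1) p.2 :=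
    hh.comp (((measurable_pilotInput P).comp measurable_fst).prodMk measurable_snd)
  have hS : MeasurableSet (freeRegion P ×ˢ (Set.univ : Set (Fin R → Fin Q → ℂ))) :=
    (measurableSet_freeRegion P).prod .univ
  have hpreimage : splitUnknowns (R := R) (Q := Q) P ⁻¹' (freeRegion P ×ˢ Set.univ) =
      freeInputs P ⁻¹' freeRegion P := by
    ext z; simp [splitUnknowns]
  calc ∫⁻ x, ∫⁻ s, h x s ∂volume ∂inputLaw P
      = (volume (freeRegion P))⁻¹ *
          ∫⁻ x in freeRegion P, ∫⁻ s, h (pilotInput P x) s ∂volume := by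
        rw [inputLaw, lintegral_map hint (measurable_pilotInput P), lintegral_cond]
    _ = (volume (freeRegion P))⁻¹ *
          ∫⁻ p in freeRegion P ×ˢ Set.univ, h (pilotInput P p.1) p.2 := by
        rw [Measure.volume_eq_prod, ← Measure.prod_restrict, Measure.restrict_univ,
          lintegral_prod _ hpilot.aemeasurable]
    _ = _ := by
        rw [hκ, Measure.restrict_smul, lintegral_smul_measure, setLIntegral_map hS hpilot
          (measurable_splitUnknowns P), hpreimage, ENNReal.coe_mul, ENNReal.coe_toNNReal hV,
          mul_assoc]
        rfl

end UniformInputs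

section DeterminantWeight

lemma lintegral_exp_neg_sum_sq_norm_sub_mul {ι : Type*} [Fintype ι] (y : ι → ℂ) {β : ℂ}
    (hβ : β ≠ 0) :
    ∫⁻ w : ι → ℂ, ENNReal.ofReal (Real.exp (-∑ a, ‖y a - β * w a‖ ^ 2)) =
      ENNReal.ofReal ((Real.pi / ‖β‖ ^ 2) ^ Fintype.card ι) := by
  have hprod (w : ι → ℂ) : ENNReal.ofReal (Real.exp (-∑ a, ‖y a - β * w a‖ ^ 2)) =
      ∏ a, ENNReal.ofReal (Real.exp (-‖y a - β * w a‖ ^ 2)) := by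
    rw [← ENNReal.ofReal_prod_of_nonneg fun _ _ ↦ (Real.exp_pos _).le, ← Real.exp_sum,
      Finset.sum_neg_distrib]
  simp_rw [hprod]
  rw [volume_pi, lintegral_pi_prod (fun _ ↦ (volume : Measure ℂ))
    (f := fun a t ↦ ENNReal.ofReal (Real.exp (-‖y a - β * t‖ ^ 2))) fun a ↦ by fun_prop]
  simp_rw [lintegral_exp_neg_sq_norm_sub_mul _ hβ]
  rw [Finset.prod_const, Finset.card_univ, ENNReal.ofReal_pow (by positivity)]

variable {L Q R : ℕ} (A : Matrix (Fin L) (Fin Q) ℂ) (P : Finset (Fin L))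
  (σ : Unknown P R Q → Fin R × Fin L) (ρ : ℝ)

/-- The squared distance of two channel outputs, restricted to the entries selected by `σ`. -/
def misfit {B : Type*} [Fintype B] (σ : B → Fin R × Fin L) (y v : Fin R → Fin L → ℂ) : ℝ :=
  ∑ b, ‖y (σ b).1 (σ b).2 - v (σ b).1 (σ b).2‖ ^ 2

lemma misfit_nonneg {B : Type*} [Fintype B] (σ : B → Fin R × Fin L) (y v : Fin R → Fin L → ℂ) :
    0 ≤ misfit σ y v := by
  unfold misfit; positivity

@[fun_prop]
lemma measurable_misfit {B α : Type*} [Fintype B] [MeasurableSpace α] (σ : B → Fin R × Fin L)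
    {y v : α → Fin R → Fin L → ℂ} (hy : Measurable y) (hv : Measurable v) :
    Measurable fun t ↦ misfit σ (y t) (v t) := by
  unfold misfit; fun_prop

/-- The squared Jacobian determinant at the all-ones input times the Gaussian weight of the outputs
selected by `σ`. Up to a constant it bounds from above a weight that is integrated by the change of
variables to the selected noiseless outputs. -/
def detWeight (x : Fin L → ℂ) (s : Fin R → Fin Q → ℂ) (y : Fin R → Fin L → ℂ) : ℝ≥0∞ :=
  ENNReal.ofReal (‖(squareJacobian A P σ 1 s).det‖ ^ 2) *
    ENNReal.ofReal (Real.exp (-misfit σ y (signal A ρ x s)))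

@[fun_prop]
lemma measurable_detWeight {α : Type*} [MeasurableSpace α] {x : α → Fin L → ℂ}
    {s : α → Fin R → Fin Q → ℂ} {y : α → Fin R → Fin L → ℂ} (hx : Measurable x)
    (hs : Measurable s) (hy : Measurable y) :
    Measurable fun t ↦ detWeight A P σ ρ (x t) (s t) (y t) := by
  have hdet := (measurable_det_squareJacobian_one A P σ).comp hs
  unfold detWeight
  fun_prop

lemma detWeight_le (y : Fin R → Fin L → ℂ) {z : Unknown P R Q → ℂ}
    (hz : freeInputs P z ∈ freeRegion P) :
    detWeight A P σ ρ (pilotInput P (freeInputs P z)) (fadings P z) y ≤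
      (regularPoints A P σ).indicator (fun z ↦
        ENNReal.ofReal (4 ^ Fintype.card (Unknown P R Q)) *
          (ENNReal.ofReal (‖(squareJacobian A P σ
            (pilotInput P (freeInputs P z)) (fadings P z)).det‖ ^ 2) *
          ENNReal.ofReal (Real.exp (-∑ b, ‖y (σ b).1 (σ b).2 -
            ((Real.sqrt ρ : ℝ) : ℂ) * observe A P σ z b‖ ^ 2)))) z := by
  have hdet := norm_det_squareJacobian_le A P σ (fadings P z) fun p ↦ hz p trivial
  by_cases hzero : (squareJacobian A P σ (pilotInput P (freeInputs P z)) (fadings P z)).det = 0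
  · rw [hzero, norm_zero, mul_zero] at hdet
    simp [detWeight, norm_le_zero_iff.1 hdet]
  have hreg : z ∈ regularPoints A P σ :=
    ⟨fun p ↦ norm_pos_iff.1 ((by norm_num : (0 : ℝ) < 2⁻¹).trans_le (hz p trivial).1), hzero⟩
  rw [Set.indicator_of_mem hreg, ← mul_assoc, ← ENNReal.ofReal_mul (by positivity), detWeight]
  refine mul_le_mul_left (ENNReal.ofReal_le_ofReal ?_) _
  calc ‖(squareJacobian A P σ 1 (fadings P z)).det‖ ^ 2
      ≤ (2 ^ Fintype.card (Unknown P R Q) * ‖(squareJacobian A P σ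
          (pilotInput P (freeInputs P z)) (fadings P z)).det‖) ^ 2 := by gcongr
    _ = 4 ^ Fintype.card (Unknown P R Q) * ‖(squareJacobian A P σ
          (pilotInput P (freeInputs P z)) (fadings P z)).det‖ ^ 2 := by
        rw [mul_pow, ← pow_mul, mul_comm _ 2, pow_mul]
        norm_num

theorem exists_lintegral_detWeight_le :
    ∃ C : ℝ≥0, ∀ ρ : ℝ, 0 < ρ → ∀ y : Fin R → Fin L → ℂ,
      ∫⁻ x, ∫⁻ s, detWeight A P σ ρ x s y ∂volume ∂inputLaw P ≤
        C * ENNReal.ofReal ((ρ ^ Fintype.card (Unknown P R Q))⁻¹) := by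
  obtain ⟨κ, hκ⟩ := exists_lintegral_inputLaw (R := R) (Q := Q) P
  set n := Fintype.card (Unknown P R Q)
  refine ⟨κ * (4 ^ n * NNReal.pi ^ n), fun ρ hρ y ↦ ?_⟩
  have hsqrt : ((Real.sqrt ρ : ℝ) : ℂ) ≠ 0 := by exact_mod_cast (Real.sqrt_pos.2 hρ).ne'
  have hgauss : ENNReal.ofReal ((Real.pi / ‖((Real.sqrt ρ : ℝ) : ℂ)‖ ^ 2) ^ n) =
      (NNReal.pi ^ n : ℝ≥0) * ENNReal.ofReal ((ρ ^ n)⁻¹) := by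
    rw [Complex.norm_real, Real.norm_eq_abs, sq_abs, Real.sq_sqrt hρ.le, div_pow, div_eq_mul_inv,
      ENNReal.ofReal_mul (by positivity), ← NNReal.coe_real_pi, ← NNReal.coe_pow,
      ENNReal.ofReal_coe_nnreal]
  have hS : MeasurableSet (freeInputs (R := R) (Q := Q) P ⁻¹' freeRegion P) :=
    (measurableSet_freeRegion P).preimage (measurable_splitUnknowns P).fst
  rw [hκ _ (by unfold Function.uncurry; fun_prop), ENNReal.coe_mul, mul_assoc]
  gcongr
  let g (w : Unknown P R Q → ℂ) : ℝ≥0∞ :=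
    ENNReal.ofReal (Real.exp (-∑ b, ‖y (σ b).1 (σ b).2 - ((Real.sqrt ρ : ℝ) : ℂ) * w b‖ ^ 2))
  let D (z : Unknown P R Q → ℂ) : ℝ≥0∞ := ENNReal.ofReal (‖(squareJacobian A P σ
    (pilotInput P (freeInputs P z)) (fadings P z)).det‖ ^ 2)
  calc ∫⁻ z in freeInputs P ⁻¹' freeRegion P,
        detWeight A P σ ρ (pilotInput P (freeInputs P z)) (fadings P z) y
      ≤ ∫⁻ z, (regularPoints A P σ).indicator
          (fun z ↦ ENNReal.ofReal (4 ^ n) * (D z * g (observe A P σ z))) z :=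
        (setLIntegral_mono' hS fun z hz ↦ detWeight_le A P σ ρ y hz).trans
          (setLIntegral_le_lintegral _ _)
    _ = ENNReal.ofReal (4 ^ n) * ∫⁻ z in regularPoints A P σ, D z * g (observe A P σ z) := by
        rw [lintegral_indicator (measurableSet_regularPoints A P σ),
          lintegral_const_mul' _ _ ENNReal.ofReal_ne_top]
    _ ≤ ENNReal.ofReal (4 ^ n) * ∫⁻ w, g w := by
        exact mul_le_mul_right (setLIntegral_regularPoints_le A P σ g) _
    _ = (4 ^ n * NNReal.pi ^ n : ℝ≥0) * ENNReal.ofReal ((ρ ^ n)⁻¹) := by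
        rw [lintegral_exp_neg_sum_sq_norm_sub_mul (fun b ↦ y (σ b).1 (σ b).2) hsqrt, hgauss,
          ← mul_assoc, ENNReal.coe_mul, ENNReal.ofReal_pow (by norm_num), ENNReal.ofReal_ofNat]
        push_cast
        rfl

end DeterminantWeight

section InformationLowerBound

section SmallBall

lemma ae_cond_closedBall_norm_le_one {E : Type*} [NormedAddCommGroup E] [MeasurableSpace E]
    [BorelSpace E] (μ : Measure E) : ∀ᵐ u ∂μ[|Metric.closedBall (0 : E) 1], ‖u‖ ≤ 1 := by
  filter_upwards [ae_cond_mem (μ := μ) Metric.isClosed_closedBall.measurableSet] with u hu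
  simpa using hu

variable {E : Type*} [NormedAddCommGroup E] [NormedSpace ℝ E] [FiniteDimensional ℝ E]
  [MeasurableSpace E] [BorelSpace E] (μ : Measure E) [μ.IsAddHaarMeasure]

instance isProbabilityMeasure_cond_closedBall :
    IsProbabilityMeasure μ[|Metric.closedBall (0 : E) 1] :=
  cond_isProbabilityMeasure_of_finite (Metric.measure_closedBall_pos μ _ one_pos).ne'
    (isCompact_closedBall (0 : E) 1).measure_lt_top.ne

lemma lintegral_add_smul_cond_closedBall_le [NormedSpace ℂ E] [IsScalarTower ℝ ℂ E] {c : ℂ}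
    (hc : c ≠ 0) (s : E) {f : E → ℝ≥0∞} (hf : Measurable f) :
    ∫⁻ u, f (s + c • u) ∂μ[|Metric.closedBall (0 : E) 1] ≤ (μ (Metric.closedBall 0 1))⁻¹ *
      (ENNReal.ofReal ((‖c‖ ^ 2) ^ Module.finrank ℂ E)⁻¹ * ∫⁻ v, f v ∂μ) := by
  rw [lintegral_cond, ← lintegral_add_left_eq_self f s, ← lintegral_comp_complex_smul μ hc
    (g := fun v ↦ f (s + v)) (by fun_prop)]
  exact mul_le_mul_right (setLIntegral_le_lintegral _ _) _

end SmallBall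

variable {L Q R : ℕ} (A : Matrix (Fin L) (Fin Q) ℂ)

lemma sq_norm_mulVec_apply_le {m n : Type*} [Fintype n] (M : Matrix m n ℂ) (v : n → ℂ) (i : m) :
    ‖(M *ᵥ v) i‖ ^ 2 ≤ (∑ j, ‖M i j‖ ^ 2) * ∑ j, ‖v j‖ ^ 2 :=
  calc ‖(M *ᵥ v) i‖ ^ 2 ≤ (∑ j, ‖M i j‖ * ‖v j‖) ^ 2 := by
        gcongr
        exact (norm_sum_le _ _).trans_eq (by simp only [norm_mul])
    _ ≤ (∑ j, ‖M i j‖ ^ 2) * ∑ j, ‖v j‖ ^ 2 := Finset.sum_mul_sq_le_sq_mul_sq _ _ _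

lemma sqNorm_signal_one_le {x : Fin L → ℂ} (hx : ‖x‖ ≤ 1) (s : Fin R → Fin Q → ℂ) :
    sqNorm (signal A 1 x s) ≤ sqNorm A * sqNorm s := by
  have hentry (m : Fin R) (i : Fin L) :
      ‖signal A 1 x s m i‖ ^ 2 ≤ (∑ j, ‖A i j‖ ^ 2) * ∑ j, ‖s m j‖ ^ 2 := by
    simp only [signal, Real.sqrt_one, Complex.ofReal_one, one_mul, norm_mul, mul_pow]
    exact (mul_le_of_le_one_left (sq_nonneg _)
      (pow_le_one₀ (norm_nonneg _) ((norm_le_pi_norm x i).trans hx))).trans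
        (sq_norm_mulVec_apply_le A (s m) i)
  calc sqNorm (signal A 1 x s) ≤ ∑ m, ∑ i, (∑ j, ‖A i j‖ ^ 2) * ∑ j, ‖s m j‖ ^ 2 :=
        Finset.sum_le_sum fun m _ ↦ Finset.sum_le_sum fun i _ ↦ hentry m i
    _ = sqNorm A * sqNorm s := by
        rw [Finset.sum_comm]
        simp only [← Finset.mul_sum, ← Finset.sum_mul]
        rfl

lemma signal_add_smul {ρ : ℝ} {c : ℂ} (hc : ((Real.sqrt ρ : ℝ) : ℂ) * c = 1) (x : Fin L → ℂ)
    (s u : Fin R → Fin Q → ℂ) :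
    signal A ρ x (s + c • u) = signal A ρ x s + signal A 1 x u := by
  ext m i
  simp only [signal, Pi.add_apply, Pi.smul_apply, Matrix.mulVec_add, Matrix.mulVec_smul,
    smul_eq_mul, Real.sqrt_one, Complex.ofReal_one]
  linear_combination x i * (A *ᵥ u m) i * hc

lemma misfit_le {B : Type*} [Fintype B] (σ : B → Fin R × Fin L) (y v : Fin R → Fin L → ℂ) :
    misfit σ y v ≤ Fintype.card B * sqNorm (y - v) := by
  rw [← nsmul_eq_mul]
  exact Finset.sum_le_card_nsmul _ _ _ fun b _ ↦ sq_norm_apply_le_sqNorm (y - v) _ _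

lemma misfit_signal_add_le {B : Type*} [Fintype B] (σ : B → Fin R × Fin L) {ρ : ℝ} {c : ℂ}
    (hc : ((Real.sqrt ρ : ℝ) : ℂ) * c = 1) {x : Fin L → ℂ} (hx : ‖x‖ ≤ 1)
    (s : Fin R → Fin Q → ℂ) {u : Fin R → Fin Q → ℂ} (hu : ‖u‖ ≤ 1) (n : Fin R → Fin L → ℂ) :
    misfit σ (signal A ρ x s + n) (signal A ρ x (s + c • u)) ≤
      Fintype.card B * (2 * sqNorm n + 2 * (sqNorm A * (R * Q))) := by
  refine (misfit_le σ _ _).trans ?_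
  rw [signal_add_smul A hc, add_sub_add_left_eq_sub]
  have := sqNorm_nonneg A
  gcongr
  refine (sqNorm_sub_le _ _).trans ?_
  gcongr
  refine (sqNorm_signal_one_le A hx u).trans ?_
  gcongr
  exact sqNorm_le_of_norm_le_one hu

variable (P : Finset (Fin L)) (σ : Unknown P R Q → Fin R × Fin L) (ρ : ℝ)

/-- The exponent of the auxiliary density of the lower bound; `Real.exp (-penalty)` is a truncation
of `detWeight` with an integrable logarithm. -/
def penalty (x : Fin L → ℂ) (s : Fin R → Fin Q → ℂ) (y : Fin R → Fin L → ℂ) : ℝ :=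
  misfit σ y (signal A ρ x s) + 2 * max (-Real.log ‖(squareJacobian A P σ 1 s).det‖) 0

@[fun_prop]
lemma measurable_penalty {α : Type*} [MeasurableSpace α] {x : α → Fin L → ℂ}
    {s : α → Fin R → Fin Q → ℂ} {y : α → Fin R → Fin L → ℂ} (hx : Measurable x)
    (hs : Measurable s) (hy : Measurable y) :
    Measurable fun t ↦ penalty A P σ ρ (x t) (s t) (y t) := by
  have hdet := (measurable_det_squareJacobian_one A P σ).comp hs
  unfold penalty
  fun_prop

lemma penalty_nonneg (x : Fin L → ℂ) (s : Fin R → Fin Q → ℂ) (y : Fin R → Fin L → ℂ) :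
    0 ≤ penalty A P σ ρ x s y :=
  add_nonneg (misfit_nonneg _ _ _) (by positivity)

lemma ofReal_exp_neg_penalty_le (x : Fin L → ℂ) {s : Fin R → Fin Q → ℂ}
    (hs : (squareJacobian A P σ 1 s).det ≠ 0) (y : Fin R → Fin L → ℂ) :
    ENNReal.ofReal (Real.exp (-penalty A P σ ρ x s y)) ≤ detWeight A P σ ρ x s y := by
  have hpos := norm_pos_iff.2 hs
  rw [detWeight, ← ENNReal.ofReal_mul (by positivity), penalty, neg_add_rev, Real.exp_add]
  gcongr
  rw [← Real.exp_log (pow_pos hpos 2), Real.exp_le_exp, Real.log_pow]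
  push_cast
  linarith [le_max_left (-Real.log ‖(squareJacobian A P σ 1 s).det‖) 0]

variable {σ}

lemma exists_lintegral_neg_log_det_add_smul_le {s₀ : Fin R → Fin Q → ℂ}
    (hs₀ : (squareJacobian A P σ 1 s₀).det ≠ 0) {η : Measure (Fin R → Fin Q → ℂ)}
    [IsProbabilityMeasure η] (hη : ∀ᵐ u ∂η, ‖u‖ ≤ 1) :
    ∃ C : ℝ≥0, ∀ c : ℂ, ‖c‖ ≤ 1 →
      ∫⁻ q, ENNReal.ofReal (-Real.log ‖(squareJacobian A P σ 1 (q.1 + c • q.2)).det‖)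
        ∂((complexGaussianVectors R Q).prod η) ≤ C := by
  have hdet := measurable_det_squareJacobian_one A P σ
  obtain ⟨C, hC⟩ := (isPolynomialAlong_det_squareJacobian A P σ s₀).exists_lintegral_neg_log_le
    hdet hs₀
  refine ⟨C, fun c hc ↦ ?_⟩
  have hdet' : Measurable fun q : (Fin R → Fin Q → ℂ) × (Fin R → Fin Q → ℂ) ↦
      (squareJacobian A P σ 1 (q.1 + c • q.2)).det := hdet.comp (by fun_prop)
  rw [lintegral_prod_symm' _ (by fun_prop), ← mul_one (C : ℝ≥0∞), ← measure_univ (μ := η),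
    ← lintegral_const]
  refine lintegral_mono_ae (hη.mono fun u hu ↦ ?_)
  simp only [add_comm _ (c • u)]
  exact hC (c • u) ((norm_smul c u).trans_le (mul_le_one₀ hc (norm_nonneg u) hu))

lemma exists_lintegral_penalty_le {s₀ : Fin R → Fin Q → ℂ}
    (hs₀ : (squareJacobian A P σ 1 s₀).det ≠ 0) {η : Measure (Fin R → Fin Q → ℂ)}
    [IsProbabilityMeasure η] (hη : ∀ᵐ u ∂η, ‖u‖ ≤ 1) :
    ∃ H : ℝ≥0, ∀ (ρ : ℝ) (c : ℂ), ((Real.sqrt ρ : ℝ) : ℂ) * c = 1 → ‖c‖ ≤ 1 →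
      ∫⁻ p, ENNReal.ofReal (penalty A P σ ρ p.1.1 (p.1.2.1 + c • p.2)
          (signal A ρ p.1.1 p.1.2.1 + p.1.2.2)) ∂((inputLaw P).prod
        ((complexGaussianVectors R Q).prod (complexGaussianVectors R L))).prod η ≤ H := by
  have hdet := measurable_det_squareJacobian_one A P σ
  obtain ⟨C, hC⟩ := exists_lintegral_neg_log_det_add_smul_le A P hs₀ hη
  let f (n : Fin R → Fin L → ℂ) : ℝ≥0∞ := ENNReal.ofReal
    (Fintype.card (Unknown P R Q) * (2 * sqNorm n + 2 * (sqNorm A * (R * Q))))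
  let ℓ (s : Fin R → Fin Q → ℂ) : ℝ≥0∞ :=
    ENNReal.ofReal (-Real.log ‖(squareJacobian A P σ 1 s).det‖)
  have hf : Measurable f := by fun_prop
  have hℓ : Measurable ℓ := by fun_prop
  have hfint : ∫⁻ n, f n ∂complexGaussianVectors R L ≠ ∞ := (Integrable.lintegral_lt_top
    ((((integrable_sqNorm R L).const_mul 2).add (integrable_const _)).const_mul _)).ne
  refine ⟨(∫⁻ n, f n ∂complexGaussianVectors R L).toNNReal + 2 * C, fun ρ c hc hc1 ↦ ?_⟩
  set P₀ := ((inputLaw P).prod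
    ((complexGaussianVectors R Q).prod (complexGaussianVectors R L))).prod η
  have hnoise : MeasurePreserving (fun p ↦ p.1.2.2) P₀ (complexGaussianVectors R L) :=
    (measurePreserving_snd.comp measurePreserving_snd).comp measurePreserving_fst
  have hstate : MeasurePreserving (fun p ↦ (p.1.2.1, p.2)) P₀
      ((complexGaussianVectors R Q).prod η) :=
    (measurePreserving_fst.comp measurePreserving_snd).prod (MeasurePreserving.id η)
  have hlog : ∫⁻ p, ℓ (p.1.2.1 + c • p.2) ∂P₀ ≤ C :=
    (hstate.lintegral_comp (f := fun q ↦ ℓ (q.1 + c • q.2)) (by fun_prop)).trans_le (hC c hc1)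
  calc _ ≤ ∫⁻ p, f p.1.2.2 + 2 * ℓ (p.1.2.1 + c • p.2) ∂P₀ := by
        refine lintegral_mono_ae ?_
        filter_upwards [(measurePreserving_fst.comp measurePreserving_fst).quasiMeasurePreserving.ae
          (ae_inputLaw_norm_le_one P), measurePreserving_snd.quasiMeasurePreserving.ae hη]
          with p hx hu
        refine ENNReal.ofReal_add_le.trans (add_le_add (ENNReal.ofReal_le_ofReal
          (misfit_signal_add_le A σ hc hx _ hu _)) ?_)
        rw [ENNReal.ofReal_mul zero_le_two, ENNReal.ofReal_ofNat, ENNReal.ofReal_max,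
          ENNReal.ofReal_zero, max_eq_left zero_le]
    _ = ∫⁻ n, f n ∂complexGaussianVectors R L + 2 * ∫⁻ p, ℓ (p.1.2.1 + c • p.2) ∂P₀ := by
        rw [lintegral_add_left (by fun_prop), lintegral_const_mul _ (by fun_prop),
          hnoise.lintegral_comp hf]
    _ ≤ _ := by
        rw [ENNReal.coe_add, ENNReal.coe_toNNReal hfint, ENNReal.coe_mul, ENNReal.coe_ofNat]
        gcongr

/-- The sub-probability density of the lower bound, as a function of input and output; the power of
`ρ` normalizes it, as every unknown contributes a factor `ρ⁻¹` to the integral of `detWeight`. -/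
def auxiliaryDensity (σ : Unknown P R Q → Fin R × Fin L) (ρ : ℝ)
    (p : (Fin L → ℂ) × (Fin R → Fin L → ℂ)) : ℝ≥0∞ :=
  (volume (Metric.closedBall (0 : Fin R → Fin Q → ℂ) 1))⁻¹ *
    (ENNReal.ofReal (ρ ^ Fintype.card (Unknown P R Q)) * ∫⁻ s, detWeight A P σ ρ p.1 s p.2)

lemma measurable_auxiliaryDensity (σ : Unknown P R Q → Fin R × Fin L) (ρ : ℝ) :
    Measurable (auxiliaryDensity A P σ ρ) := by
  have : Measurable fun q : ((Fin L → ℂ) × (Fin R → Fin L → ℂ)) × (Fin R → Fin Q → ℂ) ↦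
      detWeight A P σ ρ q.1.1 q.2 q.1.2 := by fun_prop
  exact (this.lintegral_prod_right'.const_mul _).const_mul _

lemma exists_lintegral_auxiliaryDensity_le (σ : Unknown P R Q → Fin R × Fin L) :
    ∃ C : ℝ≥0, ∀ ρ : ℝ, 0 < ρ → ∀ y, ∫⁻ x, auxiliaryDensity A P σ ρ (x, y) ∂inputLaw P ≤ C := by
  obtain ⟨C, hC⟩ := exists_lintegral_detWeight_le A P σ
  set V := volume (Metric.closedBall (0 : Fin R → Fin Q → ℂ) 1)
  have hV : V⁻¹ ≠ ∞ :=
    ENNReal.inv_ne_top.2 (Metric.measure_closedBall_pos volume _ one_pos).ne'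
  refine ⟨V⁻¹.toNNReal * C, fun ρ hρ y ↦ ?_⟩
  simp only [auxiliaryDensity]
  rw [lintegral_const_mul' _ _ hV, lintegral_const_mul' _ _ ENNReal.ofReal_ne_top, ENNReal.coe_mul,
    ENNReal.coe_toNNReal hV]
  refine mul_le_mul_right ((mul_le_mul_right (hC ρ hρ y) _).trans_eq ?_) _
  rw [mul_left_comm, ← ENNReal.ofReal_mul (by positivity), mul_inv_cancel₀ (by positivity),
    ENNReal.ofReal_one, mul_one]

lemma lintegral_exp_sub_penalty_le {s₀ : Fin R → Fin Q → ℂ}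
    (hs₀ : (squareJacobian A P σ 1 s₀).det ≠ 0) {ρ : ℝ} (hρ : 0 < ρ) {c : ℂ}
    (hc : ((Real.sqrt ρ : ℝ) : ℂ) * c = 1) (x : Fin L → ℂ) (s : Fin R → Fin Q → ℂ)
    (y : Fin R → Fin L → ℂ) :
    ∫⁻ u, ENNReal.ofReal (Real.exp (P.card * Real.log ρ - penalty A P σ ρ x (s + c • u) y))
        ∂volume[|Metric.closedBall (0 : Fin R → Fin Q → ℂ) 1] ≤
      auxiliaryDensity A P σ ρ (x, y) := by
  have hexp (t : ℝ) : ENNReal.ofReal (Real.exp (P.card * Real.log ρ - t)) =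
      ENNReal.ofReal (ρ ^ P.card) * ENNReal.ofReal (Real.exp (-t)) := by
    rw [← ENNReal.ofReal_mul (by positivity), sub_eq_add_neg, Real.exp_add, ← Real.log_pow,
      Real.exp_log (by positivity)]
  have hscale : ((‖c‖ ^ 2) ^ Module.finrank ℂ (Fin R → Fin Q → ℂ))⁻¹ = ρ ^ (R * Q) := by
    have hnorm : ρ * ‖c‖ ^ 2 = 1 := by
      have h := congrArg (‖·‖ ^ 2) hc
      rwa [norm_mul, mul_pow, Complex.norm_real, Real.norm_eq_abs, sq_abs, Real.sq_sqrt hρ.le,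
        norm_one, one_pow] at h
    rw [Module.finrank_pi_fintype, ← inv_pow, inv_eq_of_mul_eq_one_left hnorm]
    simp
  have hcard : ρ ^ Fintype.card (Unknown P R Q) = ρ ^ (R * Q) * ρ ^ P.card := by
    rw [← pow_add]
    simp [Unknown, add_comm]
  have hweight : ∀ᵐ s, ENNReal.ofReal (Real.exp (-penalty A P σ ρ x s y)) ≤
      detWeight A P σ ρ x s y := by
    filter_upwards [(isPolynomialAlong_det_squareJacobian A P σ s₀).ae_ne_zero
      (measurable_det_squareJacobian_one A P σ) hs₀] with s hs
    exact ofReal_exp_neg_penalty_le A P σ ρ x hs y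
  refine (lintegral_add_smul_cond_closedBall_le volume (right_ne_zero_of_mul_eq_one hc) s
    (f := fun v ↦ ENNReal.ofReal (Real.exp (P.card * Real.log ρ - penalty A P σ ρ x v y)))
    (by fun_prop)).trans (mul_le_mul_right ?_ _)
  simp only [hexp]
  rw [lintegral_const_mul' _ _ ENNReal.ofReal_ne_top, hscale, hcard,
    ENNReal.ofReal_mul (by positivity), mul_assoc]
  exact mul_le_mul_right (mul_le_mul_right (lintegral_mono_ae hweight) _) _

theorem IsIdentifiable.exists_le_klDiv_inputLaw {A : Matrix (Fin L) (Fin Q) ℂ}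
    {P : Finset (Fin L)} {s₀ : Fin R → Fin Q → ℂ} (h : IsIdentifiable A Finset.univ P s₀) :
    ∃ C : ℝ, ∀ ρ : ℝ, 1 ≤ ρ →
      ENNReal.ofReal (P.card * Real.log ρ - C) ≤
        InformationTheory.klDiv (jointLaw A R ρ (inputLaw P))
          ((jointLaw A R ρ (inputLaw P)).fst.prod (jointLaw A R ρ (inputLaw P)).snd) := by
  obtain ⟨σ, hσ⟩ := h.exists_det_squareJacobian_ne_zero
  obtain ⟨H, hH⟩ := exists_lintegral_penalty_le A P hσ (ae_cond_closedBall_norm_le_one volume)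
  obtain ⟨C, hC⟩ := exists_lintegral_auxiliaryDensity_le A P σ
  refine ⟨H + C - 1, fun ρ hρ ↦ ?_⟩
  have hρ0 : 0 < ρ := one_pos.trans_le hρ
  have hsqrt : 0 < Real.sqrt ρ := Real.sqrt_pos.2 hρ0
  set c : ℂ := (((Real.sqrt ρ)⁻¹ : ℝ) : ℂ) with hcdef
  have hc : ((Real.sqrt ρ : ℝ) : ℂ) * c = 1 := by
    rw [hcdef, ← Complex.ofReal_mul, mul_inv_cancel₀ hsqrt.ne', Complex.ofReal_one]
  have hc1 : ‖c‖ ≤ 1 := by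
    rw [hcdef, Complex.norm_real, Real.norm_of_nonneg (by positivity)]
    exact inv_le_one_of_one_le₀ (Real.one_le_sqrt.2 hρ)
  let g (p : ((Fin L → ℂ) × (Fin R → Fin Q → ℂ) × (Fin R → Fin L → ℂ)) × (Fin R → Fin Q → ℂ)) : ℝ :=
    penalty A P σ ρ p.1.1 (p.1.2.1 + c • p.2) (signal A ρ p.1.1 p.1.2.1 + p.1.2.2)
  have hg : Measurable g := by fun_prop
  obtain ⟨hint, hle⟩ := integrable_and_integral_le_of_lintegral_ofReal_le hg.aestronglyMeasurable
    (fun p ↦ penalty_nonneg A P σ ρ _ _ _) (hH ρ c hc hc1)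
  have hchannel : MeasurePreserving (inputOutput (signal A ρ)) ((inputLaw P).prod
      ((complexGaussianVectors R Q).prod (complexGaussianVectors R L)))
      (jointLaw A R ρ (inputLaw P)) :=
    ⟨measurable_inputOutput (measurable_signal A ρ), (jointLaw_eq_map_inputOutput A ρ _).symm⟩
  have hfst : (jointLaw A R ρ (inputLaw P)).fst = inputLaw P := by
    rw [jointLaw_eq_map_inputOutput, fst_map_inputOutput (measurable_signal A ρ)]
  have hlower := ofReal_integral_le_klDiv_fst_prod_snd hchannel
    ((integrable_const (P.card * Real.log ρ)).sub hint) (measurable_auxiliaryDensity A P σ ρ)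
    (ae_of_all _ fun ω ↦ lintegral_exp_sub_penalty_le A P hσ hρ0 hc ω.1 ω.2.1
      (signal A ρ ω.1 ω.2.1 + ω.2.2))
    (hfst.symm ▸ hC ρ hρ0)
  refine (ENNReal.ofReal_le_ofReal ?_).trans hlower
  simp only [Pi.sub_apply]
  rw [integral_sub (integrable_const _) hint, integral_const, probReal_univ, one_smul]
  linarith

end InformationLowerBound

section InformationUpperBound

section Smearing

instance isProbabilityMeasure_cond_annulus : IsProbabilityMeasure (volume : Measure ℂ)[|annulus] :=
  cond_isProbabilityMeasure_of_finite volume_annulus_ne_zero volume_annulus_ne_top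

lemma ne_zero_of_mem_annulus {c : ℂ} (hc : c ∈ annulus) : c ≠ 0 :=
  norm_pos_iff.1 ((by norm_num : (0 : ℝ) < 2⁻¹).trans_le hc.1)

lemma lintegral_cond_annulus_exp_le (y β : ℂ) :
    (∫⁻ c, ENNReal.ofReal (Real.exp (-‖y - β * c‖ ^ 2)) ∂volume[|annulus]) *
        ENNReal.ofReal ((1 + ‖β‖) ^ 2) ≤
      4 + (volume annulus)⁻¹ * ENNReal.ofReal (4 * Real.pi) := by
  rcases le_or_gt ‖β‖ 1 with hβ | hβ
  · refine le_add_right ?_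
    calc _ ≤ (∫⁻ _, 1 ∂(volume : Measure ℂ)[|annulus]) * ENNReal.ofReal ((1 + 1) ^ 2) := by
          gcongr with c
          exact ENNReal.ofReal_le_one.2 (Real.exp_le_one_iff.2 (neg_nonpos.2 (sq_nonneg _)))
      _ = 4 := by norm_num
  · have hβ0 : 0 < ‖β‖ := one_pos.trans hβ
    refine le_add_left ?_
    rw [lintegral_cond, mul_assoc]
    refine mul_le_mul_right ?_ _
    calc _ ≤ (∫⁻ c : ℂ, ENNReal.ofReal (Real.exp (-‖y - β * c‖ ^ 2))) *
          ENNReal.ofReal ((‖β‖ + ‖β‖) ^ 2) := by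
          refine mul_le_mul' (setLIntegral_le_lintegral _ _) ?_
          gcongr
      _ = ENNReal.ofReal (4 * Real.pi) := by
          rw [lintegral_exp_neg_sq_norm_sub_mul y (norm_pos_iff.1 hβ0),
            ← ENNReal.ofReal_mul (by positivity)]
          congr 1
          field_simp
          ring

variable {E : Type*} [NormedAddCommGroup E] [NormedSpace ℝ E] [NormedSpace ℂ E]
  [IsScalarTower ℝ ℂ E] [FiniteDimensional ℝ E] [MeasurableSpace E] [BorelSpace E] (μ : Measure E)
  [μ.IsAddHaarMeasure]

lemma lintegral_comp_inv_smul_le {c : ℂ} (hc : c ≠ 0) (hc1 : ‖c‖ ≤ 1) {f : E → ℝ≥0∞}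
    (hf : Measurable f) : ∫⁻ s, f (c⁻¹ • s) ∂μ ≤ ∫⁻ t, f t ∂μ := by
  rw [lintegral_comp_complex_smul μ (inv_ne_zero hc) hf]
  refine mul_le_of_le_one_left zero_le (ENNReal.ofReal_le_one.2 (inv_le_one_of_one_le₀
    (one_le_pow₀ (one_le_pow₀ ?_))))
  rw [norm_inv]
  exact (one_le_inv₀ (norm_pos_iff.2 hc)).2 hc1

/- Exchanging the integrals and substituting `t = c⁻¹ • s` turns the exponential, constant in `c`,
into a Gaussian in `c` of width `‖a t‖⁻¹`, which compensates for the quadratic factor. -/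
lemma exists_lintegral_exp_mul_lintegral_inv_smul_le :
    ∃ K : ℝ≥0, ∀ (a : E →L[ℂ] ℂ) (z : ℂ) {T : E → ℝ≥0∞}, Measurable T →
      ∫⁻ s, ENNReal.ofReal (Real.exp (-‖z - a s‖ ^ 2)) *
          ∫⁻ c, ENNReal.ofReal ((1 + ‖a (c⁻¹ • s)‖) ^ 2) * T (c⁻¹ • s) ∂volume[|annulus] ∂μ ≤
        K * ∫⁻ t, T t ∂μ := by
  set K := 4 + (volume annulus)⁻¹ * ENNReal.ofReal (4 * Real.pi)
  have hK : K ≠ ∞ := ENNReal.add_ne_top.2 ⟨by simp, ENNReal.mul_ne_top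
    (ENNReal.inv_ne_top.2 volume_annulus_ne_zero) ENNReal.ofReal_ne_top⟩
  refine ⟨K.toNNReal, fun a z T hT ↦ ?_⟩
  rw [ENNReal.coe_toNNReal hK]
  let W (c : ℂ) (t : E) : ℝ≥0∞ := ENNReal.ofReal (Real.exp (-‖z - a t * c‖ ^ 2)) *
    (ENNReal.ofReal ((1 + ‖a t‖) ^ 2) * T t)
  have hW : Measurable (Function.uncurry W) := by unfold W Function.uncurry; fun_prop
  have hmem : ∀ᵐ c ∂(volume : Measure ℂ)[|annulus], c ∈ annulus :=
    ae_cond_mem measurableSet_annulus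
  calc _ = ∫⁻ s, ∫⁻ c, W c (c⁻¹ • s) ∂volume[|annulus] ∂μ := by
        refine lintegral_congr fun s ↦ ?_
        rw [← lintegral_const_mul' _ _ ENNReal.ofReal_ne_top]
        refine lintegral_congr_ae (hmem.mono fun c hc ↦ ?_)
        have hac : a (c⁻¹ • s) * c = a s := by
          rw [map_smul, smul_eq_mul, mul_right_comm, inv_mul_cancel₀ (ne_zero_of_mem_annulus hc),
            one_mul]
        simp only [W, hac]
    _ = ∫⁻ c, ∫⁻ s, W c (c⁻¹ • s) ∂μ ∂volume[|annulus] :=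
        lintegral_lintegral_swap (hW.comp (f := fun q : E × ℂ ↦ (q.2, q.2⁻¹ • q.1))
          (by fun_prop)).aemeasurable
    _ ≤ ∫⁻ c, ∫⁻ t, W c t ∂μ ∂volume[|annulus] :=
        lintegral_mono_ae (hmem.mono fun c hc ↦ lintegral_comp_inv_smul_le μ
          (ne_zero_of_mem_annulus hc) hc.2 hW.of_uncurry_left)
    _ = ∫⁻ t, ∫⁻ c, W c t ∂volume[|annulus] ∂μ := lintegral_lintegral_swap hW.aemeasurable
    _ ≤ ∫⁻ t, K * T t ∂μ := by
        refine lintegral_mono fun t ↦ ?_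
        rw [lintegral_mul_const _ (by fun_prop), ← mul_assoc]
        exact mul_le_mul_left (lintegral_cond_annulus_exp_le z (a t)) _
    _ = K * ∫⁻ t, T t ∂μ := lintegral_const_mul _ hT

end Smearing

section InputWeight

variable {L : ℕ}

/-- The density, up to normalization, of one entry of the scaled input under the reference law: the
distinguished entry `i₀` carries the scale and is heavy tailed, the others are Gaussian. -/
def inputWeight (ε ρ : ℝ) (i₀ i : Fin L) (z : ℂ) : ℝ :=
  if i = i₀ then (1 + ‖z‖) ^ (-(2 + 2 * ε)) else ρ⁻¹ * Real.exp (-‖z‖ ^ 2 / ρ)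

@[fun_prop]
lemma measurable_inputWeight (ε ρ : ℝ) (i₀ i : Fin L) : Measurable (inputWeight ε ρ i₀ i) := by
  unfold inputWeight
  split_ifs <;> fun_prop

lemma inputWeight_nonneg (ε : ℝ) {ρ : ℝ} (hρ : 0 < ρ) (i₀ i : Fin L) (z : ℂ) :
    0 ≤ inputWeight ε ρ i₀ i z := by
  unfold inputWeight
  split_ifs <;> positivity

lemma lintegral_inv_mul_exp_neg_sq_norm_div {ρ : ℝ} (hρ : 0 < ρ) :
    ∫⁻ z : ℂ, ENNReal.ofReal (ρ⁻¹ * Real.exp (-‖z‖ ^ 2 / ρ)) = ENNReal.ofReal Real.pi := by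
  set β : ℂ := (((Real.sqrt ρ)⁻¹ : ℝ) : ℂ) with hβdef
  have hβ : β ≠ 0 := Complex.ofReal_ne_zero.2 (inv_pos.2 (Real.sqrt_pos.2 hρ)).ne'
  have hnorm : ‖β‖ ^ 2 = ρ⁻¹ := by
    rw [hβdef, Complex.norm_real, Real.norm_eq_abs, sq_abs, inv_pow, Real.sq_sqrt hρ.le]
  have hexp (z : ℂ) : -‖z‖ ^ 2 / ρ = -‖0 - β * z‖ ^ 2 := by
    rw [zero_sub, norm_neg, norm_mul, mul_pow, hnorm, neg_div, div_eq_inv_mul]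
  simp only [hexp, ENNReal.ofReal_mul (inv_nonneg.2 hρ.le)]
  rw [lintegral_const_mul' _ _ ENNReal.ofReal_ne_top, lintegral_exp_neg_sq_norm_sub_mul 0 hβ,
    ← ENNReal.ofReal_mul (by positivity), hnorm, mul_div_cancel₀ _ (inv_pos.2 hρ).ne']

lemma exists_lintegral_prod_inputWeight_le {ε : ℝ} (hε : 0 < ε) (i₀ : Fin L) :
    ∃ C : ℝ≥0, ∀ ρ : ℝ, 0 < ρ →
      ∫⁻ w : Fin L → ℂ, ∏ i, ENNReal.ofReal (inputWeight ε ρ i₀ i (w i)) ≤ C := by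
  set J := ∫⁻ z : ℂ, ENNReal.ofReal ((1 + ‖z‖) ^ (-(2 + 2 * ε)))
  have hJ : J ≠ ∞ := by
    refine (integrable_one_add_norm ?_).lintegral_lt_top.ne
    rw [Complex.finrank_real_complex]
    push_cast
    linarith
  set C := ∏ i : Fin L, if i = i₀ then J else ENNReal.ofReal Real.pi
  have hC : C ≠ ∞ :=
    ENNReal.prod_ne_top fun i _ ↦ by split_ifs <;> finiteness
  refine ⟨C.toNNReal, fun ρ hρ ↦ ?_⟩
  rw [ENNReal.coe_toNNReal hC, volume_pi, lintegral_pi_prod (fun _ ↦ volume)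
    (f := fun i z ↦ ENNReal.ofReal (inputWeight ε ρ i₀ i z)) fun i ↦ by fun_prop]
  refine Finset.prod_le_prod' fun i _ ↦ ?_
  unfold inputWeight
  split_ifs
  · exact le_rfl
  · exact (lintegral_inv_mul_exp_neg_sq_norm_div hρ).le

lemma norm_sqrt_mul_mul_add_le (ρ : ℝ) {c u : ℂ} (hc : ‖c‖ ≤ 1) (hu : ‖u‖ ≤ 1) (x : ℂ) :
    ‖((Real.sqrt ρ : ℝ) : ℂ) * c * x + u‖ ≤ Real.sqrt ρ * ‖x‖ + 1 := by
  refine (norm_add_le _ _).trans (add_le_add ?_ hu)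
  rw [norm_mul, norm_mul, Complex.norm_real, Real.norm_of_nonneg (Real.sqrt_nonneg _)]
  gcongr
  exact mul_le_of_le_one_right (Real.sqrt_nonneg _) hc

lemma exp_neg_le_inputWeight_of_ne (ε : ℝ) {ρ : ℝ} (hρ : 1 ≤ ρ) {i₀ i : Fin L} (hi : i ≠ i₀)
    {x w : ℂ} (hw : ‖w‖ ≤ Real.sqrt ρ * ‖x‖ + 1) :
    Real.exp (-(Real.log ρ + 2 * ‖x‖ ^ 2 + 2)) ≤ inputWeight ε ρ i₀ i w := by
  have hρ0 : 0 < ρ := one_pos.trans_le hρ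
  rw [inputWeight, if_neg hi, add_assoc, neg_add, Real.exp_add, Real.exp_neg, Real.exp_log hρ0]
  gcongr
  rw [neg_div, neg_le_neg_iff, div_le_iff₀ hρ0]
  calc ‖w‖ ^ 2 ≤ (Real.sqrt ρ * ‖x‖ + 1) ^ 2 := by gcongr
    _ ≤ 2 * (Real.sqrt ρ ^ 2 * ‖x‖ ^ 2) + 2 := by nlinarith [sq_nonneg (Real.sqrt ρ * ‖x‖ - 1)]
    _ ≤ (2 * ‖x‖ ^ 2 + 2) * ρ := by rw [Real.sq_sqrt hρ0.le]; linarith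

lemma log_one_add_le_add_neg_log {r a w : ℝ} (hr : 0 ≤ r) (ha : 0 < a) (hw0 : 0 ≤ w)
    (hw : w ≤ r + 1) :
    Real.log (1 + w) ≤ Real.log 2 + Real.log (1 + r * a) + max (-Real.log a) 0 := by
  set ℓ := max (-Real.log a) 0
  have hℓ : 1 ≤ Real.exp ℓ := Real.one_le_exp (le_max_right _ _)
  have haℓ : 1 ≤ a * Real.exp ℓ := by
    rw [← Real.exp_log ha, ← Real.exp_add]
    exact Real.one_le_exp (by linarith [le_max_left (-Real.log a) 0])
  calc Real.log (1 + w) ≤ Real.log (2 * (1 + r * a) * Real.exp ℓ) := by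
        refine Real.log_le_log (by positivity) ?_
        nlinarith [mul_le_mul_of_nonneg_left haℓ hr]
    _ = Real.log 2 + Real.log (1 + r * a) + ℓ := by
        rw [Real.log_mul (by positivity) (by positivity),
          Real.log_mul (by positivity) (by positivity), Real.log_exp]

lemma two_mul_log_one_add_le {ρ b w : ℝ} (hρ : 1 ≤ ρ) (hb : 0 ≤ b) (hw0 : 0 ≤ w)
    (hw : w ≤ Real.sqrt ρ * b + 1) : 2 * Real.log (1 + w) ≤ Real.log ρ + 2 * (2 + b ^ 2) := by
  have hsqrt : 1 ≤ Real.sqrt ρ := Real.one_le_sqrt.2 hρ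
  have hlog : Real.log (1 + w) ≤ Real.log ρ / 2 + Real.log (2 + b) := by
    rw [← Real.log_sqrt (by linarith), ← Real.log_mul (by positivity) (by positivity)]
    exact Real.log_le_log (by positivity) (by linarith)
  have hlin : Real.log (2 + b) ≤ 1 + b := by
    linarith [Real.log_le_sub_one_of_pos (by positivity : 0 < 2 + b)]
  nlinarith [sq_nonneg (b - 1)]

lemma exp_neg_le_mul_inputWeight_self {ε ρ : ℝ} (hε : 0 ≤ ε) (hρ : 1 ≤ ρ) (i₀ : Fin L) {a x w : ℂ}
    (ha : a ≠ 0) (hw : ‖w‖ ≤ Real.sqrt ρ * ‖x‖ + 1) :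
    Real.exp (-(2 * Real.log 2 + 2 * max (-Real.log ‖a‖) 0 + ε * Real.log ρ +
        2 * ε * (2 + ‖x‖ ^ 2))) ≤
      (1 + ‖((Real.sqrt ρ : ℝ) : ℂ) * x * a‖) ^ 2 * inputWeight ε ρ i₀ i₀ w := by
  have ha0 : 0 < ‖a‖ := norm_pos_iff.2 ha
  have hnorm : ‖((Real.sqrt ρ : ℝ) : ℂ) * x * a‖ = Real.sqrt ρ * ‖x‖ * ‖a‖ := by
    rw [norm_mul, norm_mul, Complex.norm_real, Real.norm_of_nonneg (Real.sqrt_nonneg _)]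
  have hpos : 0 < 1 + Real.sqrt ρ * ‖x‖ * ‖a‖ := by positivity
  have hgain := log_one_add_le_add_neg_log (by positivity) ha0 (norm_nonneg w) hw
  have hscale := two_mul_log_one_add_le hρ (norm_nonneg x) (norm_nonneg w) hw
  rw [inputWeight, if_pos rfl, hnorm, ← Real.exp_log (pow_pos hpos 2),
    Real.rpow_def_of_pos (by positivity), ← Real.exp_add, Real.exp_le_exp, Real.log_pow]
  push_cast
  nlinarith [mul_le_mul_of_nonneg_left hscale hε]

lemma exp_neg_le_mul_prod_inputWeight {ε ρ : ℝ} (hε : 0 ≤ ε) (hρ : 1 ≤ ρ) (i₀ : Fin L) {a : ℂ}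
    (ha : a ≠ 0) {x w : Fin L → ℂ} (hw : ∀ i, ‖w i‖ ≤ Real.sqrt ρ * ‖x i‖ + 1) :
    Real.exp (-((L - 1 + ε) * Real.log ρ + (2 * Real.log 2 + 4 * ε + 2 * L +
        (2 + 2 * ε) * ∑ i, ‖x i‖ ^ 2) + 2 * max (-Real.log ‖a‖) 0)) ≤
      (1 + ‖((Real.sqrt ρ : ℝ) : ℂ) * x i₀ * a‖) ^ 2 * ∏ i, inputWeight ε ρ i₀ i (w i) := by
  have hcard : ((Finset.univ.erase i₀).card : ℝ) = L - 1 := by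
    rw [Finset.card_erase_of_mem (Finset.mem_univ _), Finset.card_univ, Fintype.card_fin,
      Nat.cast_pred i₀.pos]
  have hsum := Finset.add_sum_erase Finset.univ (fun i ↦ ‖x i‖ ^ 2) (Finset.mem_univ i₀)
  have hrest : 0 ≤ ∑ i ∈ Finset.univ.erase i₀, ‖x i‖ ^ 2 := Finset.sum_nonneg fun _ _ ↦ sq_nonneg _
  rw [← Finset.mul_prod_erase _ _ (Finset.mem_univ i₀), ← mul_assoc]
  refine le_trans ?_ (mul_le_mul (exp_neg_le_mul_inputWeight_self hε hρ i₀ ha (hw i₀))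
    (Finset.prod_le_prod (fun _ _ ↦ (Real.exp_pos _).le) fun i hi ↦
      exp_neg_le_inputWeight_of_ne ε hρ (Finset.ne_of_mem_erase hi) (hw i))
    (Finset.prod_nonneg fun _ _ ↦ (Real.exp_pos _).le)
    (mul_nonneg (sq_nonneg _) (inputWeight_nonneg ε (one_pos.trans_le hρ) i₀ i₀ _)))
  rw [← Real.exp_sum, ← Real.exp_add, Real.exp_le_exp, Finset.sum_neg_distrib,
    Finset.sum_add_distrib, Finset.sum_add_distrib, Finset.sum_const, Finset.sum_const,
    nsmul_eq_mul, nsmul_eq_mul, hcard, ← Finset.mul_sum, ← hsum]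
  nlinarith [mul_nonneg hε hrest]

end InputWeight

variable {L Q R : ℕ} (A : Matrix (Fin L) (Fin Q) ℂ)

lemma complexGaussianVectors_le_volume (R n : ℕ) : complexGaussianVectors R n ≤ volume := by
  rw [complexGaussianVectors_eq_withDensity]
  refine (withDensity_mono (ae_of_all _ fun y ↦ ?_)).trans_eq withDensity_one
  exact (gaussianDensity_le_exp y).trans
    (ENNReal.ofReal_le_one.2 (Real.exp_le_one_iff.2 (neg_nonpos.2 (sqNorm_nonneg y))))

/-- The fading coefficient of receive antenna `m` at time `i`, as a functional of the state. -/
def gain (m : Fin R) (i : Fin L) : (Fin R → Fin Q → ℂ) →L[ℂ] ℂ :=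
  LinearMap.toContinuousLinearMap (LinearMap.proj i ∘ₗ A.mulVecLin ∘ₗ LinearMap.proj m)

lemma gain_apply (m : Fin R) (i : Fin L) (s : Fin R → Fin Q → ℂ) : gain A m i s = (A *ᵥ s m) i :=
  rfl

lemma exists_isPolynomialAlong_gain (m : Fin R) {i : Fin L} (hi : A.row i ≠ 0) :
    ∃ s₀ κ, IsPolynomialAlong (gain A m i) s₀ 1 κ ∧ κ ≠ 0 := by
  obtain ⟨j, hj⟩ := Function.ne_iff.1 hi
  have hs₀ : gain A m i (Pi.single m (Pi.single j 1)) = A i j := by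
    rw [gain_apply, Pi.single_eq_same, Matrix.mulVec_single_one, Matrix.col_apply]
  refine ⟨Pi.single m (Pi.single j 1), A i j, fun s ↦ ?_, hj⟩
  refine ⟨Polynomial.C (A i j) * Polynomial.X + Polynomial.C (gain A m i s),
    Polynomial.natDegree_linear_le, by simp, fun τ ↦ ?_⟩
  rw [map_add, map_smul, hs₀, Polynomial.eval_add, Polynomial.eval_mul, Polynomial.eval_C,
    Polynomial.eval_X, Polynomial.eval_C, smul_eq_mul, mul_comm, add_comm]

lemma sub_signal_smul_add (ρ : ℝ) {c : ℂ} (hc : c ≠ 0) (x u : Fin L → ℂ) (s : Fin R → Fin Q → ℂ)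
    (y : Fin R → Fin L → ℂ) :
    y - signal A 1 ((((Real.sqrt ρ : ℝ) : ℂ) * c) • x + u) (c⁻¹ • s) =
      (y - signal A ρ x s) - signal A 1 u (c⁻¹ • s) := by
  ext m i
  simp only [signal, Pi.sub_apply, Pi.add_apply, Pi.smul_apply, Matrix.mulVec_smul, smul_eq_mul,
    Real.sqrt_one, Complex.ofReal_one]
  field_simp
  ring

lemma sqNorm_inv_smul_le {n : ℕ} {c : ℂ} (hc : c ∈ annulus) (s : Fin R → Fin n → ℂ) :
    sqNorm (c⁻¹ • s) ≤ 4 * sqNorm s := by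
  have hinv : ‖c⁻¹‖ ≤ 2 := by
    rw [norm_inv]
    exact inv_le_of_inv_le₀ two_pos hc.1
  rw [sqNorm_smul]
  have := sqNorm_nonneg s
  gcongr
  nlinarith [norm_nonneg c⁻¹]

lemma sqNorm_sub_signal_smul_add_le (ρ : ℝ) {c : ℂ} (hc : c ∈ annulus) (x : Fin L → ℂ)
    {u : Fin L → ℂ} (hu : ‖u‖ ≤ 1) (s : Fin R → Fin Q → ℂ) (y : Fin R → Fin L → ℂ) :
    sqNorm (y - signal A 1 ((((Real.sqrt ρ : ℝ) : ℂ) * c) • x + u) (c⁻¹ • s)) ≤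
      2 * sqNorm (y - signal A ρ x s) + 8 * sqNorm A * sqNorm s := by
  rw [sub_signal_smul_add A ρ (ne_zero_of_mem_annulus hc)]
  refine (sqNorm_sub_le _ _).trans (add_le_add_right ?_ _)
  have hsignal := (sqNorm_signal_one_le A hu (c⁻¹ • s)).trans
    (mul_le_mul_of_nonneg_left (sqNorm_inv_smul_le hc s) (sqNorm_nonneg A))
  linarith

section ReferenceModel

variable (ε ρ : ℝ) (i₀ : Fin L)

/-- The joint density, up to normalization, of the scaled state `t`, the scaled input `w` and the
output `y` under the reference law. -/
def referenceWeight (t : Fin R → Fin Q → ℂ) (w : Fin L → ℂ) (y : Fin R → Fin L → ℂ) : ℝ≥0∞ :=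
  ENNReal.ofReal ((∏ i, inputWeight ε ρ i₀ i (w i)) *
    Real.exp (-(sqNorm t + sqNorm (y - signal A 1 w t))))

@[fun_prop]
lemma measurable_referenceWeight {α : Type*} [MeasurableSpace α] {t : α → Fin R → Fin Q → ℂ}
    {w : α → Fin L → ℂ} {y : α → Fin R → Fin L → ℂ} (ht : Measurable t) (hw : Measurable w)
    (hy : Measurable y) : Measurable fun a ↦ referenceWeight A ε ρ i₀ (t a) (w a) (y a) := by
  unfold referenceWeight
  fun_prop

/-- The density, up to normalization, of the scaled state and the output under the reference law. -/
def stateWeight (t : Fin R → Fin Q → ℂ) (y : Fin R → Fin L → ℂ) : ℝ≥0∞ :=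
  ∫⁻ w, referenceWeight A ε ρ i₀ t w y

@[fun_prop]
lemma measurable_stateWeight {α : Type*} [MeasurableSpace α] {t : α → Fin R → Fin Q → ℂ}
    {y : α → Fin R → Fin L → ℂ} (ht : Measurable t) (hy : Measurable y) :
    Measurable fun a ↦ stateWeight A ε ρ i₀ (t a) (y a) := by
  have : Measurable fun q : α × (Fin L → ℂ) ↦ referenceWeight A ε ρ i₀ (t q.1) q.2 (y q.1) := by
    fun_prop
  exact this.lintegral_prod_right'

variable {ε ρ}

lemma exists_lintegral_stateWeight_le (hε : 0 < ε) :
    ∃ C : ℝ≥0, ∀ ρ : ℝ, 0 < ρ →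
      ∫⁻ y : Fin R → Fin L → ℂ, ∫⁻ t, stateWeight A ε ρ i₀ t y ≤ C := by
  obtain ⟨C, hC⟩ := exists_lintegral_prod_inputWeight_le hε i₀
  have hexp (n : ℕ) : ∫⁻ y : Fin R → Fin n → ℂ, ENNReal.ofReal (Real.exp (-sqNorm y)) ≠ ∞ := by
    simpa only [one_mul] using lintegral_exp_neg_mul_sqNorm_ne_top R n one_pos
  set I₁ := ∫⁻ t : Fin R → Fin Q → ℂ, ENNReal.ofReal (Real.exp (-sqNorm t))
  set I₂ := ∫⁻ y : Fin R → Fin L → ℂ, ENNReal.ofReal (Real.exp (-sqNorm y))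
  refine ⟨I₂.toNNReal * C * I₁.toNNReal, fun ρ hρ ↦ ?_⟩
  let p (w : Fin L → ℂ) : ℝ≥0∞ := ∏ i, ENNReal.ofReal (inputWeight ε ρ i₀ i (w i))
  have hp : Measurable p := by unfold p; fun_prop
  have houtput (t : Fin R → Fin Q → ℂ) (w : Fin L → ℂ) : ∫⁻ y, referenceWeight A ε ρ i₀ t w y =
      I₂ * p w * ENNReal.ofReal (Real.exp (-sqNorm t)) := by
    have hsplit (y : Fin R → Fin L → ℂ) : referenceWeight A ε ρ i₀ t w y =
        p w * ENNReal.ofReal (Real.exp (-sqNorm t)) *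
          ENNReal.ofReal (Real.exp (-sqNorm (y - signal A 1 w t))) := by
      have hnonneg (i : Fin L) := inputWeight_nonneg ε hρ i₀ i (w i)
      rw [referenceWeight, neg_add, Real.exp_add, ENNReal.ofReal_mul
        (Finset.prod_nonneg fun i _ ↦ hnonneg i), ENNReal.ofReal_prod_of_nonneg
        (fun i _ ↦ hnonneg i), ENNReal.ofReal_mul (Real.exp_pos _).le, mul_assoc]
    simp only [hsplit]
    rw [lintegral_const_mul _ (by fun_prop), lintegral_sub_right_eq_self
      (fun y ↦ ENNReal.ofReal (Real.exp (-sqNorm y))), mul_comm, mul_assoc]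
  calc _ = ∫⁻ t : Fin R → Fin Q → ℂ, ∫⁻ w, ∫⁻ y : Fin R → Fin L → ℂ,
          referenceWeight A ε ρ i₀ t w y := by
        rw [lintegral_lintegral_swap (by fun_prop)]
        exact lintegral_congr fun t ↦ lintegral_lintegral_swap (by fun_prop)
    _ = I₂ * (∫⁻ w, p w) * I₁ := by
        simp only [houtput]
        rw [← lintegral_const_mul _ (by fun_prop)]
        refine lintegral_congr fun t ↦ ?_
        rw [lintegral_mul_const _ (by fun_prop), lintegral_const_mul _ hp]
    _ ≤ _ := by
        rw [ENNReal.coe_mul, ENNReal.coe_mul, ENNReal.coe_toNNReal (hexp L),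
          ENNReal.coe_toNNReal (hexp Q)]
        gcongr
        exact hC ρ hρ

end ReferenceModel

section Excess

lemma lintegral_prod_add_add {α β γ : Type*} [MeasurableSpace α] [MeasurableSpace β]
    [MeasurableSpace γ] (μ : Measure α) [IsProbabilityMeasure μ] (ν : Measure β)
    [IsProbabilityMeasure ν] (ξ : Measure γ) [IsProbabilityMeasure ξ] {f : α → ℝ≥0∞}
    {g : β → ℝ≥0∞} {h : γ → ℝ≥0∞} (hf : Measurable f) (hg : Measurable g) (hh : Measurable h) :
    ∫⁻ p, f p.1 + g p.2.1 + h p.2.2 ∂(μ.prod (ν.prod ξ)) =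
      ∫⁻ a, f a ∂μ + ∫⁻ b, g b ∂ν + ∫⁻ c, h c ∂ξ := by
  have hfst : MeasurePreserving (fun p : α × β × γ ↦ p.2.1) (μ.prod (ν.prod ξ)) ν :=
    measurePreserving_fst.comp measurePreserving_snd
  have hsnd : MeasurePreserving (fun p : α × β × γ ↦ p.2.2) (μ.prod (ν.prod ξ)) ξ :=
    measurePreserving_snd.comp measurePreserving_snd
  rw [lintegral_add_right _ (by fun_prop), lintegral_add_right _ (by fun_prop),
    measurePreserving_fst.lintegral_comp hf, hfst.lintegral_comp hg, hsnd.lintegral_comp hh]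

/-- The contribution of the input `x` to the exponent of the upper bound. -/
def inputExcess (ε : ℝ) (x : Fin L → ℂ) : ℝ :=
  2 * Real.log 2 + 4 * ε + 2 * L + (2 + 2 * ε) * ∑ j, ‖x j‖ ^ 2

/-- The contribution of the state `s` to the exponent of the upper bound, when the gain of antenna
`m` at time `i` is used to measure the scale of the input. -/
def stateExcess (m : Fin R) (i : Fin L) (s : Fin R → Fin Q → ℂ) : ℝ :=
  (4 + 8 * sqNorm A) * sqNorm s + 2 * max (-Real.log ‖gain A m i s‖) 0

/-- The part of the exponent of the upper bound, for input `x`, state `s` and noise `n`, whose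
expectation is bounded independently of the signal-to-noise ratio. -/
def excess (ε : ℝ) (m : Fin R) (i : Fin L) (x : Fin L → ℂ) (s : Fin R → Fin Q → ℂ)
    (n : Fin R → Fin L → ℂ) : ℝ :=
  inputExcess ε x + stateExcess A m i s + 2 * sqNorm n

lemma measurable_inputExcess (ε : ℝ) : Measurable (inputExcess (L := L) ε) := by
  unfold inputExcess
  fun_prop

lemma measurable_stateExcess (m : Fin R) (i : Fin L) : Measurable (stateExcess A m i) := by
  unfold stateExcess
  fun_prop

@[fun_prop]
lemma measurable_excess {α : Type*} [MeasurableSpace α] (ε : ℝ) (m : Fin R) (i : Fin L)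
    {x : α → Fin L → ℂ} {s : α → Fin R → Fin Q → ℂ} {n : α → Fin R → Fin L → ℂ}
    (hx : Measurable x) (hs : Measurable s) (hn : Measurable n) :
    Measurable fun a ↦ excess A ε m i (x a) (s a) (n a) :=
  (((measurable_inputExcess ε).comp hx).add ((measurable_stateExcess A m i).comp hs)).add
    ((measurable_sqNorm.comp hn).const_mul 2)

lemma inputExcess_nonneg {ε : ℝ} (hε : 0 ≤ ε) (x : Fin L → ℂ) : 0 ≤ inputExcess ε x := by
  have := Real.log_nonneg (one_le_two (α := ℝ))
  unfold inputExcess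
  positivity

lemma stateExcess_nonneg (m : Fin R) (i : Fin L) (s : Fin R → Fin Q → ℂ) :
    0 ≤ stateExcess A m i s := by
  have := sqNorm_nonneg A
  have := sqNorm_nonneg s
  unfold stateExcess
  positivity

lemma excess_nonneg {ε : ℝ} (hε : 0 ≤ ε) (m : Fin R) (i : Fin L) (x : Fin L → ℂ)
    (s : Fin R → Fin Q → ℂ) (n : Fin R → Fin L → ℂ) : 0 ≤ excess A ε m i x s n :=
  add_nonneg (add_nonneg (inputExcess_nonneg hε x) (stateExcess_nonneg A m i s))
    (mul_nonneg zero_le_two (sqNorm_nonneg n))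

lemma lintegral_inputExcess_le {ε : ℝ} (hε : 0 ≤ ε) {μ : Measure (Fin L → ℂ)}
    (hμ : μ ∈ admissibleInputs L) :
    ∫⁻ x, ENNReal.ofReal (inputExcess ε x) ∂μ ≤
      ENNReal.ofReal (2 * Real.log 2 + 4 * ε + 2 * L) + ENNReal.ofReal (2 + 2 * ε) * L := by
  have := hμ.1
  have hpower : ∫⁻ x, ENNReal.ofReal (∑ i, ‖x i‖ ^ 2) ∂μ ≤ L := by
    refine (lintegral_congr fun x ↦ ?_).trans_le hμ.2
    rw [ENNReal.ofReal_sum_of_nonneg fun _ _ ↦ sq_nonneg _]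
    refine Finset.sum_congr rfl fun i _ ↦ ?_
    rw [ENNReal.ofReal_pow (norm_nonneg _), ofReal_norm]
  calc ∫⁻ x, ENNReal.ofReal (inputExcess ε x) ∂μ
      ≤ ∫⁻ x, ENNReal.ofReal (2 * Real.log 2 + 4 * ε + 2 * L) +
          ENNReal.ofReal (2 + 2 * ε) * ENNReal.ofReal (∑ i, ‖x i‖ ^ 2) ∂μ := by
        refine lintegral_mono fun x ↦ ENNReal.ofReal_add_le.trans_eq ?_
        rw [ENNReal.ofReal_mul (by positivity)]
    _ ≤ _ := by
        rw [lintegral_add_left measurable_const, lintegral_const, measure_univ, mul_one,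
          lintegral_const_mul _ (by fun_prop)]
        gcongr

variable {A}

lemma lintegral_stateExcess_ne_top (m : Fin R) {i : Fin L} (hi : A.row i ≠ 0) :
    ∫⁻ s, ENNReal.ofReal (stateExcess A m i s) ∂complexGaussianVectors R Q ≠ ∞ := by
  obtain ⟨s₀, κ, hgain, hκ⟩ := exists_isPolynomialAlong_gain A m hi
  obtain ⟨C, hC⟩ := hgain.exists_lintegral_neg_log_le (by fun_prop) hκ
  have hlog : ∫⁻ s, ENNReal.ofReal (max (-Real.log ‖gain A m i s‖) 0)
      ∂complexGaussianVectors R Q ≠ ∞ := by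
    simp only [ENNReal.ofReal_max, ENNReal.ofReal_zero, zero_le, max_eq_left]
    refine ne_top_of_le_ne_top (ENNReal.coe_ne_top (r := C)) ?_
    simpa only [zero_add] using hC 0 (norm_zero.trans_le zero_le_one)
  have hint : Integrable (fun s ↦ max (-Real.log ‖gain A m i s‖) 0) (complexGaussianVectors R Q) :=
    ⟨Measurable.aestronglyMeasurable (by fun_prop),
      (hasFiniteIntegral_iff_ofReal (ae_of_all _ fun _ ↦ le_max_right _ _)).2 hlog.lt_top⟩
  exact (((integrable_sqNorm R Q).const_mul _).add (hint.const_mul 2)).lintegral_lt_top.ne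

lemma exists_lintegral_excess_le {ε : ℝ} (hε : 0 ≤ ε) (m : Fin R) {i : Fin L} (hi : A.row i ≠ 0) :
    ∃ H : ℝ≥0, ∀ μ ∈ admissibleInputs L, ∫⁻ p, ENNReal.ofReal (excess A ε m i p.1 p.2.1 p.2.2)
      ∂(μ.prod ((complexGaussianVectors R Q).prod (complexGaussianVectors R L))) ≤ H := by
  set HX := ENNReal.ofReal (2 * Real.log 2 + 4 * ε + 2 * L) + ENNReal.ofReal (2 + 2 * ε) * L
  set HS := ∫⁻ s, ENNReal.ofReal (stateExcess A m i s) ∂complexGaussianVectors R Q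
  set HN := ∫⁻ n, ENNReal.ofReal (2 * sqNorm n) ∂complexGaussianVectors R L
  have hHS : HS ≠ ∞ := lintegral_stateExcess_ne_top m hi
  have hHN : HN ≠ ∞ := ((integrable_sqNorm R L).const_mul 2).lintegral_lt_top.ne
  have hH : HX + HS + HN ≠ ∞ := by finiteness
  refine ⟨(HX + HS + HN).toNNReal, fun μ hμ ↦ ?_⟩
  have := hμ.1
  rw [ENNReal.coe_toNNReal hH]
  calc _ ≤ ∫⁻ p, ENNReal.ofReal (inputExcess ε p.1) + ENNReal.ofReal (stateExcess A m i p.2.1) +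
          ENNReal.ofReal (2 * sqNorm p.2.2)
          ∂(μ.prod ((complexGaussianVectors R Q).prod (complexGaussianVectors R L))) :=
        lintegral_mono fun p ↦ ENNReal.ofReal_add_le.trans
          (add_le_add ENNReal.ofReal_add_le le_rfl)
    _ = ∫⁻ x, ENNReal.ofReal (inputExcess ε x) ∂μ + HS + HN :=
        lintegral_prod_add_add μ _ _ (measurable_inputExcess ε).ennreal_ofReal
          (measurable_stateExcess A m i).ennreal_ofReal
          (measurable_sqNorm.const_mul 2).ennreal_ofReal
    _ ≤ HX + HS + HN := by
        gcongr
        exact lintegral_inputExcess_le hε hμ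

end Excess

section OutputBound

variable {A}

lemma exp_neg_excess_le {ε ρ : ℝ} (hε : 0 ≤ ε) (hρ : 1 ≤ ρ) (m : Fin R) (i₀ : Fin L)
    (x : Fin L → ℂ) {s : Fin R → Fin Q → ℂ} (hs : gain A m i₀ s ≠ 0) (y : Fin R → Fin L → ℂ)
    {c : ℂ} (hc : c ∈ annulus) {u : Fin L → ℂ} (hu : ‖u‖ ≤ 1) :
    ENNReal.ofReal (Real.exp
        (-((L - 1 + ε) * Real.log ρ + excess A ε m i₀ x s (y - signal A ρ x s)))) ≤
      ENNReal.ofReal ((1 + ‖((Real.sqrt ρ : ℝ) : ℂ) * x i₀ * gain A m i₀ (c⁻¹ • s)‖) ^ 2) *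
        referenceWeight A ε ρ i₀ (c⁻¹ • s) ((((Real.sqrt ρ : ℝ) : ℂ) * c) • x + u) y := by
  set w := (((Real.sqrt ρ : ℝ) : ℂ) * c) • x + u
  set a := gain A m i₀ (c⁻¹ • s) with hadef
  have hnorm : ‖a‖ = ‖c‖⁻¹ * ‖gain A m i₀ s‖ := by rw [hadef, map_smul, norm_smul, norm_inv]
  have hc0 := norm_pos_iff.2 (ne_zero_of_mem_annulus hc)
  have hs0 := norm_pos_iff.2 hs
  have ha : a ≠ 0 := norm_pos_iff.1 (hnorm ▸ by positivity)
  have hlog : -Real.log ‖a‖ ≤ -Real.log ‖gain A m i₀ s‖ := by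
    rw [hnorm]
    exact neg_le_neg (Real.log_le_log hs0 (le_mul_of_one_le_left hs0.le ((one_le_inv₀ hc0).2 hc.2)))
  have hw (i : Fin L) : ‖w i‖ ≤ Real.sqrt ρ * ‖x i‖ + 1 :=
    norm_sqrt_mul_mul_add_le ρ hc.2 ((norm_le_pi_norm u i).trans hu) (x i)
  have hstate := sqNorm_inv_smul_le hc s
  have hnoise := sqNorm_sub_signal_smul_add_le A ρ hc x hu s y
  rw [referenceWeight, ← ENNReal.ofReal_mul (by positivity), ← mul_assoc]
  refine ENNReal.ofReal_le_ofReal (le_trans ?_ (mul_le_mul_of_nonneg_right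
    (exp_neg_le_mul_prod_inputWeight hε hρ i₀ ha hw) (Real.exp_pos _).le))
  rw [← Real.exp_add, Real.exp_le_exp, excess, inputExcess, stateExcess]
  linarith [max_le_max_right 0 hlog]

lemma exp_neg_excess_le_lintegral {ε ρ : ℝ} (hε : 0 ≤ ε) (hρ : 1 ≤ ρ) (m : Fin R) (i₀ : Fin L)
    (x : Fin L → ℂ) {s : Fin R → Fin Q → ℂ} (hs : gain A m i₀ s ≠ 0) (y : Fin R → Fin L → ℂ) :
    ENNReal.ofReal (Real.exp
        (-((L - 1 + ε) * Real.log ρ + excess A ε m i₀ x s (y - signal A ρ x s)))) ≤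
      (volume (Metric.closedBall (0 : Fin L → ℂ) 1))⁻¹ *
        ∫⁻ c, ENNReal.ofReal ((1 + ‖((Real.sqrt ρ : ℝ) : ℂ) * x i₀ * gain A m i₀ (c⁻¹ • s)‖) ^ 2) *
          stateWeight A ε ρ i₀ (c⁻¹ • s) y ∂volume[|annulus] := by
  set E := ENNReal.ofReal (Real.exp
    (-((L - 1 + ε) * Real.log ρ + excess A ε m i₀ x s (y - signal A ρ x s))))
  set B := Metric.closedBall (0 : Fin L → ℂ) 1
  have hB : (volume B)⁻¹ ≠ ∞ :=
    ENNReal.inv_ne_top.2 (Metric.measure_closedBall_pos volume _ one_pos).ne'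
  let F (c : ℂ) : ℝ≥0∞ :=
    ENNReal.ofReal ((1 + ‖((Real.sqrt ρ : ℝ) : ℂ) * x i₀ * gain A m i₀ (c⁻¹ • s)‖) ^ 2)
  have haverage {c : ℂ} (hc : c ∈ annulus) :
      E ≤ F c * ((volume B)⁻¹ * stateWeight A ε ρ i₀ (c⁻¹ • s) y) :=
    calc E = ∫⁻ _, E ∂volume[|B] := by rw [lintegral_const, measure_univ, mul_one]
      _ ≤ ∫⁻ u, F c * referenceWeight A ε ρ i₀ (c⁻¹ • s)
            ((((Real.sqrt ρ : ℝ) : ℂ) * c) • x + u) y ∂volume[|B] :=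
          lintegral_mono_ae ((ae_cond_closedBall_norm_le_one volume).mono fun u hu ↦
            exp_neg_excess_le hε hρ m i₀ x hs y hc hu)
      _ ≤ F c * ((volume B)⁻¹ * stateWeight A ε ρ i₀ (c⁻¹ • s) y) := by
          rw [lintegral_const_mul _ (by fun_prop)]
          refine mul_le_mul_right ?_ _
          simpa [B, stateWeight] using lintegral_add_smul_cond_closedBall_le volume one_ne_zero
            ((((Real.sqrt ρ : ℝ) : ℂ) * c) • x)
            (f := fun w ↦ referenceWeight A ε ρ i₀ (c⁻¹ • s) w y) (by fun_prop)
  calc E = ∫⁻ _, E ∂(volume : Measure ℂ)[|annulus] := by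
        rw [lintegral_const, measure_univ, mul_one]
    _ ≤ ∫⁻ c, (volume B)⁻¹ * (F c * stateWeight A ε ρ i₀ (c⁻¹ • s) y) ∂volume[|annulus] := by
        refine lintegral_mono_ae ((ae_cond_mem measurableSet_annulus).mono fun c hc ↦ ?_)
        rw [mul_left_comm]
        exact haverage hc
    _ = _ := lintegral_const_mul' _ _ hB

lemma exists_lintegral_gaussianDensity_mul_exp_le (m : Fin R) {i₀ : Fin L} (hi₀ : A.row i₀ ≠ 0)
    {ε : ℝ} (hε : 0 ≤ ε) :
    ∃ K : ℝ≥0, ∀ ρ : ℝ, 1 ≤ ρ → ∀ (x : Fin L → ℂ) (y : Fin R → Fin L → ℂ),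
      ∫⁻ s, gaussianDensity R L (y - signal A ρ x s) * ENNReal.ofReal (Real.exp
        (-((L - 1 + ε) * Real.log ρ + excess A ε m i₀ x s (y - signal A ρ x s))))
        ∂complexGaussianVectors R Q ≤ K * ∫⁻ t, stateWeight A ε ρ i₀ t y := by
  obtain ⟨s₀, κ, hgain, hκ⟩ := exists_isPolynomialAlong_gain A m hi₀
  obtain ⟨K, hK⟩ := exists_lintegral_exp_mul_lintegral_inv_smul_le
    (volume : Measure (Fin R → Fin Q → ℂ))
  set V := (volume (Metric.closedBall (0 : Fin L → ℂ) 1))⁻¹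
  have hV : V ≠ ∞ := ENNReal.inv_ne_top.2 (Metric.measure_closedBall_pos volume _ one_pos).ne'
  refine ⟨V.toNNReal * K, fun ρ hρ x y ↦ ?_⟩
  let a : (Fin R → Fin Q → ℂ) →L[ℂ] ℂ := (((Real.sqrt ρ : ℝ) : ℂ) * x i₀) • gain A m i₀
  have hnoise (s : Fin R → Fin Q → ℂ) : gaussianDensity R L (y - signal A ρ x s) ≤
      ENNReal.ofReal (Real.exp (-‖y m i₀ - a s‖ ^ 2)) := by
    refine (gaussianDensity_le_exp _).trans (ENNReal.ofReal_le_ofReal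
      (Real.exp_le_exp.2 (neg_le_neg ?_)))
    have hentry := sq_norm_apply_le_sqNorm (y - signal A ρ x s) m i₀
    rwa [Pi.sub_apply, Pi.sub_apply, signal, ← mul_assoc] at hentry
  calc _ ≤ ∫⁻ s, ENNReal.ofReal (Real.exp (-‖y m i₀ - a s‖ ^ 2)) * (V *
          ∫⁻ c, ENNReal.ofReal ((1 + ‖a (c⁻¹ • s)‖) ^ 2) * stateWeight A ε ρ i₀ (c⁻¹ • s) y
            ∂volume[|annulus]) := by
        refine lintegral_mono_ae ?_ |>.trans
          (lintegral_mono' (complexGaussianVectors_le_volume R Q) le_rfl)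
        filter_upwards [ae_mono (complexGaussianVectors_le_volume R Q)
          (hgain.ae_ne_zero (by fun_prop) hκ)] with s hs
        exact mul_le_mul' (hnoise s) (exp_neg_excess_le_lintegral hε hρ m i₀ x hs y)
    _ = V * ∫⁻ s, ENNReal.ofReal (Real.exp (-‖y m i₀ - a s‖ ^ 2)) *
          ∫⁻ c, ENNReal.ofReal ((1 + ‖a (c⁻¹ • s)‖) ^ 2) * stateWeight A ε ρ i₀ (c⁻¹ • s) y
            ∂volume[|annulus] := by
        simp only [mul_left_comm _ V]
        exact lintegral_const_mul' _ _ hV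
    _ ≤ _ := by
        rw [ENNReal.coe_mul, ENNReal.coe_toNNReal hV, mul_assoc]
        exact mul_le_mul_right (hK a (y m i₀) (by fun_prop)) _

theorem exists_klDiv_jointLaw_le (m : Fin R) {i₀ : Fin L} (hi₀ : A.row i₀ ≠ 0) {ε : ℝ}
    (hε : 0 < ε) :
    ∃ C : ℝ, ∀ ρ : ℝ, 1 ≤ ρ → ∀ μ ∈ admissibleInputs L,
      InformationTheory.klDiv (jointLaw A R ρ μ)
          ((jointLaw A R ρ μ).fst.prod (jointLaw A R ρ μ).snd) ≤
        ENNReal.ofReal ((L - 1 + ε) * Real.log ρ + C) := by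
  obtain ⟨H, hH⟩ := exists_lintegral_excess_le hε.le m hi₀
  obtain ⟨K, hK⟩ := exists_lintegral_gaussianDensity_mul_exp_le m hi₀ hε.le
  obtain ⟨C, hC⟩ := exists_lintegral_stateWeight_le (R := R) A i₀ hε
  refine ⟨H + (K * C : ℝ≥0) - 1, fun ρ hρ μ hμ ↦ ?_⟩
  have := hμ.1
  let e (p : (Fin L → ℂ) × (Fin R → Fin Q → ℂ) × (Fin R → Fin L → ℂ)) : ℝ :=
    excess A ε m i₀ p.1 p.2.1 p.2.2
  have he : Measurable e := by fun_prop
  obtain ⟨hint, hle⟩ := integrable_and_integral_le_of_lintegral_ofReal_le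
    he.aestronglyMeasurable (fun p ↦ excess_nonneg A hε.le m i₀ p.1 p.2.1 p.2.2) (hH μ hμ)
  let G (y : Fin R → Fin L → ℂ) : ℝ≥0∞ := K * ∫⁻ t, stateWeight A ε ρ i₀ t y
  have hG : Measurable G :=
    (measurable_stateWeight A ε ρ i₀ measurable_snd
      measurable_fst).lintegral_prod_right'.const_mul _
  have hmass : ∫⁻ y, G y ≤ (K * C : ℝ≥0) := by
    rw [lintegral_const_mul' _ _ ENNReal.coe_ne_top, ENNReal.coe_mul]
    exact mul_le_mul_right (hC ρ (one_pos.trans_le hρ)) _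
  have hbound : InformationTheory.klDiv (jointLaw A R ρ μ)
      ((jointLaw A R ρ μ).fst.prod (jointLaw A R ρ μ).snd) ≤
      ENNReal.ofReal (∫ p, (L - 1 + ε) * Real.log ρ + e p
        ∂(μ.prod ((complexGaussianVectors R Q).prod (complexGaussianVectors R L))) +
        (K * C : ℝ≥0) - 1) := by
    rw [jointLaw_eq_map_inputOutput]
    exact klDiv_map_inputOutput_le (measurable_signal A ρ)
      (complexGaussianVectors_eq_withDensity R L) (measurable_gaussianDensity R L)
      (fun y ↦ (gaussianDensity_pos y).ne') (he.const_add _)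
      ((integrable_const _).add hint) hG (hK ρ hρ) hmass
  refine hbound.trans (ENNReal.ofReal_le_ofReal ?_)
  rw [integral_add (integrable_const _) hint, integral_const, probReal_univ, one_smul]
  linarith

end OutputBound

end InformationUpperBound

section LogarithmicGrowth

variable {f : ℝ → ℝ≥0∞} {k : ℝ}

lemma exists_isBigO_one_of_le {C : ℝ}
    (h : ∀ ρ : ℝ, 1 ≤ ρ → ENNReal.ofReal (k * Real.logb 2 ρ - C) ≤ f ρ) :
    ∃ g : ℝ → ℝ, g =O[atTop] (fun _ ↦ (1 : ℝ)) ∧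
      ∀ ρ : ℝ, 0 < ρ → ((k * Real.logb 2 ρ + g ρ : ℝ) : EReal) ≤ (f ρ : EReal) := by
  refine ⟨fun ρ ↦ if 1 ≤ ρ then -C else -(k * Real.logb 2 ρ), ?_, fun ρ _ ↦ ?_⟩
  · refine (isBigO_const_const (-C) one_ne_zero atTop).congr' ?_ EventuallyEq.rfl
    filter_upwards [eventually_ge_atTop 1] with ρ hρ
    rw [if_pos hρ]
  · beta_reduce
    split_ifs with hρ
    · refine le_trans ?_ (EReal.coe_ennreal_le_coe_ennreal_iff.2 (h ρ hρ))
      rw [← sub_eq_add_neg, EReal.coe_ennreal_ofReal]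
      exact_mod_cast le_max_left _ _
    · rw [add_neg_cancel, EReal.coe_zero]
      exact EReal.coe_ennreal_nonneg _

lemma tendsto_ofReal_mul_logb_add_div (k C : ℝ) :
    Tendsto (fun ρ : ℝ ↦ ENNReal.ofReal (k * Real.logb 2 ρ + C) / ENNReal.ofReal (Real.logb 2 ρ))
      atTop (𝓝 (ENNReal.ofReal k)) := by
  have hlogb : Tendsto (Real.logb 2) atTop atTop := Real.tendsto_logb_atTop one_lt_two
  have hlim : Tendsto (fun ρ ↦ k + C / Real.logb 2 ρ) atTop (𝓝 k) := by
    simpa only [add_zero] using tendsto_const_nhds.add (hlogb.const_div_atTop C)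
  refine (ENNReal.tendsto_ofReal hlim).congr' ?_
  filter_upwards [hlogb.eventually_gt_atTop 0] with ρ hρ
  rw [← ENNReal.ofReal_div_of_pos hρ, add_div, mul_div_cancel_right₀ _ hρ.ne']

lemma tendsto_div_logb_of_bounds (hk : 0 ≤ k)
    (hlower : ∃ C : ℝ, ∀ ρ : ℝ, 1 ≤ ρ → ENNReal.ofReal (k * Real.logb 2 ρ - C) ≤ f ρ)
    (hupper : ∀ ε : ℝ, 0 < ε → ∃ C : ℝ, ∀ ρ : ℝ, 1 ≤ ρ →
      f ρ ≤ ENNReal.ofReal ((k + ε) * Real.logb 2 ρ + C)) :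
    Tendsto (fun ρ : ℝ ↦ f ρ / ENNReal.ofReal (Real.logb 2 ρ)) atTop (𝓝 (ENNReal.ofReal k)) := by
  refine tendsto_order.2 ⟨fun a ha ↦ ?_, fun a ha ↦ ?_⟩
  · obtain ⟨C, hC⟩ := hlower
    filter_upwards [(tendsto_ofReal_mul_logb_add_div k (-C)).eventually_const_lt ha,
      eventually_ge_atTop 1] with ρ hlt hρ
    exact hlt.trans_le (ENNReal.div_le_div_right (hC ρ hρ) _)
  · obtain ⟨r, -, hkr, hra⟩ := ENNReal.lt_iff_exists_real_btwn.1 ha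
    obtain ⟨C, hC⟩ := hupper (r - k)
      (sub_pos.2 ((ENNReal.ofReal_lt_ofReal_iff_of_nonneg hk).1 hkr))
    rw [add_sub_cancel] at hC
    filter_upwards [(tendsto_ofReal_mul_logb_add_div r C).eventually_lt_const hra,
      eventually_ge_atTop 1] with ρ hlt hρ
    exact (ENNReal.div_le_div_right (hC ρ hρ) _).trans_lt hlt

end LogarithmicGrowth

section Capacity

variable {L Q R : ℕ} {A : Matrix (Fin L) (Fin Q) ℂ}

lemma le_capacity_of_le_klDiv (hL : 0 < L) {ρ b : ℝ} {μ : Measure (Fin L → ℂ)}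
    (hμ : μ ∈ admissibleInputs L) (h : ENNReal.ofReal b ≤ InformationTheory.klDiv
      (jointLaw A R ρ μ) ((jointLaw A R ρ μ).fst.prod (jointLaw A R ρ μ).snd)) :
    ENNReal.ofReal (b / Real.log 2 / L) ≤ capacity A R ρ := by
  rw [ENNReal.ofReal_div_of_pos (Nat.cast_pos.2 hL),
    ENNReal.ofReal_div_of_pos (Real.log_pos one_lt_two), ENNReal.ofReal_natCast]
  exact ENNReal.div_le_div_right
    (le_iSup₂_of_le μ hμ (ENNReal.div_le_div_right h _)) _

lemma capacity_le_of_klDiv_le (hL : 0 < L) {ρ b : ℝ} (h : ∀ μ ∈ admissibleInputs L,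
    InformationTheory.klDiv (jointLaw A R ρ μ)
      ((jointLaw A R ρ μ).fst.prod (jointLaw A R ρ μ).snd) ≤ ENNReal.ofReal b) :
    capacity A R ρ ≤ ENNReal.ofReal (b / Real.log 2 / L) := by
  rw [ENNReal.ofReal_div_of_pos (Nat.cast_pos.2 hL),
    ENNReal.ofReal_div_of_pos (Real.log_pos one_lt_two), ENNReal.ofReal_natCast]
  exact ENNReal.div_le_div_right (iSup₂_le fun μ hμ ↦ ENNReal.div_le_div_right (h μ hμ) _) _

lemma IsIdentifiable.exists_le_capacity {P : Finset (Fin L)} {s₀ : Fin R → Fin Q → ℂ}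
    (h : IsIdentifiable A Finset.univ P s₀) (hL : 0 < L) :
    ∃ C : ℝ, ∀ ρ : ℝ, 1 ≤ ρ →
      ENNReal.ofReal ((P.card / L : ℝ) * Real.logb 2 ρ - C) ≤ capacity A R ρ := by
  obtain ⟨C, hC⟩ := h.exists_le_klDiv_inputLaw
  refine ⟨C / Real.log 2 / L, fun ρ hρ ↦ ?_⟩
  convert le_capacity_of_le_klDiv hL (inputLaw_mem_admissibleInputs P) (hC ρ hρ) using 2
  rw [Real.logb]
  ring

lemma exists_capacity_le (hR : 0 < R) (hL : 0 < L) (hrow : ∃ i, A.row i ≠ 0) {ε : ℝ}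
    (hε : 0 < ε) : ∃ C : ℝ, ∀ ρ : ℝ, 1 ≤ ρ →
      capacity A R ρ ≤ ENNReal.ofReal ((1 - 1 / L + ε : ℝ) * Real.logb 2 ρ + C) := by
  have hL' : (0 : ℝ) < L := Nat.cast_pos.2 hL
  obtain ⟨i₀, hi₀⟩ := hrow
  obtain ⟨C, hC⟩ := exists_klDiv_jointLaw_le (⟨0, hR⟩ : Fin R) hi₀ (mul_pos hε hL')
  refine ⟨C / Real.log 2 / L, fun ρ hρ ↦ ?_⟩
  convert capacity_le_of_klDiv_le hL (hC ρ hρ) using 2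
  have hlog : Real.log 2 ≠ 0 := (Real.log_pos one_lt_two).ne'
  rw [Real.logb]
  field_simp

lemma le_and_sub_one_le_mul_sub_of_div_le (hR : 2 ≤ R) {N : ℕ}
    (h : ((Q : ℝ) * R - 1) / ((R : ℝ) - 1) ≤ N) : Q ≤ N ∧ N - 1 ≤ R * (N - Q) := by
  have hR' : (2 : ℝ) ≤ R := by exact_mod_cast hR
  have hreal : (Q * R + N : ℝ) ≤ N * R + 1 := by
    linarith [(div_le_iff₀ (by linarith)).1 h]
  have hnat : Q * R + N ≤ N * R + 1 := by exact_mod_cast hreal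
  have hQN : Q ≤ N := by
    by_contra! hlt
    have := Nat.mul_le_mul_right R hlt
    rw [Nat.succ_mul] at this
    lia
  refine ⟨hQN, ?_⟩
  rw [Nat.mul_sub, mul_comm R N, mul_comm R Q]
  lia

lemma div_le_of_eq_two (hR : R = 2) (h : 2 * (Q : ℤ) - 1 ≤ L) :
    ((Q : ℝ) * R - 1) / ((R : ℝ) - 1) ≤ L := by
  have hreal : (2 * Q - 1 : ℝ) ≤ L := by exact_mod_cast h
  subst hR
  norm_num
  linarith

lemma one_le_of_row_ne_zero {i : Fin L} (hi : A.row i ≠ 0) : 1 ≤ Q := by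
  by_contra! hQ
  obtain rfl := Nat.lt_one_iff.1 hQ
  exact hi (Subsingleton.elim _ _)

lemma exists_le_capacity_of_div_le (hR : 2 ≤ R) (hL : 0 < L) (hQ : 1 ≤ Q)
    (hrow : ∀ i, A.row i ≠ 0) (hA : PropertyA A R)
    (h : ((Q : ℝ) * R - 1) / ((R : ℝ) - 1) ≤ L) :
    ∃ C : ℝ, ∀ ρ : ℝ, 1 ≤ ρ →
      ENNReal.ofReal ((1 - 1 / (L : ℝ)) * Real.logb 2 ρ - C) ≤ capacity A R ρ := by
  obtain ⟨K, hKcard, hK⟩ := hA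
  rw [min_eq_left (Nat.ceil_le.2 h)] at hKcard
  obtain ⟨hQK, hmin⟩ := le_and_sub_one_le_mul_sub_of_div_le (N := K.card) hR
    (hKcard ▸ Nat.le_ceil _)
  obtain ⟨P, s₀, hPcard, hP⟩ := InGeneralPosition.exists_isIdentifiable_univ (R := R) hK hrow hQ hQK
    (by lia)
  have hKL : K.card ≤ L := (Finset.card_le_univ K).trans_eq (Fintype.card_fin L)
  replace hPcard : P.card = L - 1 := by
    rw [hPcard, min_eq_left hmin]
    lia
  have hcoef : (P.card / L : ℝ) = 1 - 1 / (L : ℝ) := by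
    rw [hPcard, Nat.cast_pred hL, sub_div, div_self (Nat.cast_pos.2 hL).ne']
  simpa only [hcoef] using hP.exists_le_capacity hL

lemma exists_le_capacity_of_lt_div (hR : 2 ≤ R) (hL : 0 < L) (hQ : 1 ≤ Q)
    (hrow : ∀ i, A.row i ≠ 0) (hA : PropertyA A R)
    (h : (L : ℝ) < ((Q : ℝ) * R - 1) / ((R : ℝ) - 1)) :
    ∃ C : ℝ, ∀ ρ : ℝ, 1 ≤ ρ →
      ENNReal.ofReal ((R : ℝ) * (1 - (Q : ℝ) / (L : ℝ)) * Real.logb 2 ρ - C) ≤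
        capacity A R ρ := by
  have hL' : (0 : ℝ) < L := Nat.cast_pos.2 hL
  have hR' : (2 : ℝ) ≤ R := by exact_mod_cast hR
  rcases lt_or_ge L Q with hLQ | hQL
  · refine ⟨0, fun ρ hρ ↦ (ENNReal.ofReal_of_nonpos ?_).trans_le zero_le⟩
    have hcoef : 1 - (Q : ℝ) / L ≤ 0 :=
      sub_nonpos.2 ((one_le_div hL').2 (by exact_mod_cast hLQ.le))
    rw [sub_zero]
    exact mul_nonpos_of_nonpos_of_nonneg (mul_nonpos_of_nonneg_of_nonpos (by linarith) hcoef)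
      (Real.logb_nonneg one_lt_two hρ)
  obtain ⟨K, hKcard, hK⟩ := hA
  rw [min_eq_right (Nat.lt_ceil.2 h).le] at hKcard
  have hmin : R * (L - Q) ≤ L - 1 := by
    have hreal : (R * (L - Q : ℕ) : ℝ) < L := by
      rw [Nat.cast_sub hQL]
      linarith [(lt_div_iff₀ (by linarith)).1 h]
    have : R * (L - Q) < L := by exact_mod_cast hreal
    lia
  obtain ⟨P, s₀, hPcard, hP⟩ := InGeneralPosition.exists_isIdentifiable_univ (R := R) hK hrow hQ
    (hKcard.symm ▸ hQL) (by lia)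
  rw [hKcard, min_eq_right hmin, Nat.sub_self, add_zero] at hPcard
  have hcoef : (P.card / L : ℝ) = R * (1 - Q / L) := by
    rw [hPcard, Nat.cast_mul, Nat.cast_sub hQL]
    field_simp
  simpa only [hcoef] using hP.exists_le_capacity hL

end Capacity

end SIMO

end

theorem theorem1_general (L Q R : ℕ) (hR : 2 ≤ R) (hL : 0 < L)
    (A : Matrix (Fin L) (Fin Q) ℂ) (hrow : ∀ i, A.row i ≠ 0) (hA : SIMO.PropertyA A R) :
    (((Q : ℝ) * R - 1) / ((R : ℝ) - 1) ≤ L →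
      ∃ g : ℝ → ℝ, g =O[atTop] (fun _ ↦ (1 : ℝ)) ∧
        ∀ ρ : ℝ, 0 < ρ →
          (((1 - 1 / (L : ℝ)) * Real.logb 2 ρ + g ρ : ℝ) : EReal)
            ≤ (SIMO.capacity A R ρ : EReal)) ∧
    (¬ ((Q : ℝ) * R - 1) / ((R : ℝ) - 1) ≤ L →
      ∃ g : ℝ → ℝ, g =O[atTop] (fun _ ↦ (1 : ℝ)) ∧
        ∀ ρ : ℝ, 0 < ρ →
          (((R : ℝ) * (1 - (Q : ℝ) / (L : ℝ)) * Real.logb 2 ρ + g ρ : ℝ) : EReal)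
            ≤ (SIMO.capacity A R ρ : EReal)) ∧
    (((Q : ℝ) * R - 1) / ((R : ℝ) - 1) ≤ L →
      Tendsto (fun ρ : ℝ ↦ SIMO.capacity A R ρ / ENNReal.ofReal (Real.logb 2 ρ)) atTop
        (𝓝 (ENNReal.ofReal (1 - 1 / (L : ℝ))))) := by
  have hQ : 1 ≤ Q := SIMO.one_le_of_row_ne_zero (hrow ⟨0, hL⟩)
  refine ⟨fun h ↦ ?_, fun h ↦ ?_, fun h ↦ ?_⟩
  · obtain ⟨C, hC⟩ := SIMO.exists_le_capacity_of_div_le hR hL hQ hrow hA h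
    exact SIMO.exists_isBigO_one_of_le hC
  · obtain ⟨C, hC⟩ := SIMO.exists_le_capacity_of_lt_div hR hL hQ hrow hA (not_le.1 h)
    exact SIMO.exists_isBigO_one_of_le hC
  · have hcoef : 0 ≤ 1 - 1 / (L : ℝ) :=
      sub_nonneg.2 (div_le_self zero_le_one (Nat.one_le_cast.2 hL))
    exact SIMO.tendsto_div_logb_of_bounds hcoef
      (SIMO.exists_le_capacity_of_div_le hR hL hQ hrow hA h)
      fun ε hε ↦ SIMO.exists_capacity_le (by lia) hL ⟨⟨0, hL⟩, hrow ⟨0, hL⟩⟩ hε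

theorem theorem1 (L Q R : ℕ) (hR : 2 ≤ R) (hQL : Q < L)
    (A : Matrix (Fin L) (Fin Q) ℂ) (hrank : A.rank = Q) (hrow : ∀ i, A.row i ≠ 0)
    (hA : SIMO.PropertyA A R) :
    (((Q : ℝ) * R - 1) / ((R : ℝ) - 1) ≤ L →
      ∃ g : ℝ → ℝ, g =O[atTop] (fun _ => (1 : ℝ)) ∧
        ∀ ρ : ℝ, 0 < ρ →
          (((1 - 1 / (L : ℝ)) * Real.logb 2 ρ + g ρ : ℝ) : EReal)
            ≤ (SIMO.capacity A R ρ : EReal)) ∧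
    (¬ ((Q : ℝ) * R - 1) / ((R : ℝ) - 1) ≤ L →
      ∃ g : ℝ → ℝ, g =O[atTop] (fun _ => (1 : ℝ)) ∧
        ∀ ρ : ℝ, 0 < ρ →
          (((R : ℝ) * (1 - (Q : ℝ) / (L : ℝ)) * Real.logb 2 ρ + g ρ : ℝ) : EReal)
            ≤ (SIMO.capacity A R ρ : EReal)) ∧
    (R = 2 → 2 * (Q : ℤ) - 1 ≤ L →
      Tendsto (fun ρ : ℝ => SIMO.capacity A R ρ / ENNReal.ofReal (Real.logb 2 ρ)) atTop
        (𝓝 (ENNReal.ofReal (1 - 1 / (L : ℝ))))) := by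
  obtain ⟨hlower, hlower', htendsto⟩ := theorem1_general L Q R hR (Nat.zero_lt_of_lt hQL) A hrow hA
  exact ⟨hlower, hlower', fun hR2 hL ↦ htendsto (SIMO.div_le_of_eq_two hR2 hL)⟩
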